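/- **Setting.** Let $M$ be a connected smooth manifold (Hausdorff, second countable, without boundary). A *(conic) pseudo-Finsler metric* on $M$ is a smooth function $F:A\to(0,\infty)$ on an open set $A\subset TM\setminus 0$ whose fibres $A_p=A\cap T_pM$ are non-empty, connected and invariant under multiplication by positive scalars, such that $F(\lambda v)=\lambda F(v)$ for $\lambda>0$, and such that for every $v\in A$ the fundamental tensor $g_v(u,w)=\frac12\frac{\partial^2}{\partial t\,\partial s}F(v+tu+sw)^2\big|_{t=s=0}$ is non-degenerate. Its indicatrix is $\Sigma=\{v\in A: F(v)=1\}$. A *geodesic* of $F$ is a smooth curve $\gamma$ on an open interval with $\dot\gamma\in A$ whose restriction to every compact subinterval $[a,b]$ is a critical point of the energy $\frac12\int_a^bF(\dot\gamma)^2\,dt$ for variations with fixed end points through curves with velocities in $A$; it has unit speed if $F(\dot\gamma)=1$. $(M,F)$ is *geodesically complete* if every geodesic extends to a geodesic defined on $\mathbb R$. Let $F:A\to(0,\infty)$ and $\hat F:\hat A\to(0,\infty)$ be pseudo-Finsler metrics on $M$, with indicatrices $\Sigma$ and $\hat\Sigma$, and let $W$ be a smooth vector field on $M$ with (maximal local)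 flow $\psi^W_t$. Suppose that $\hat F$ is a *translation* of $F$ by $W$, that is, $v/\hat F(v)-W\in\Sigma$ for every $v\in\hat A$. Suppose that $W$ is *homothetic* for $F$ with constant $\sigma\in\mathbb R$, that is, $(\psi^W_t)^*F=e^{-\sigma t}F$ wherever $\psi^W_t$ is defined (the domains of the two sides also being equal). Put $f(t)=(e^{\sigma t}-1)/\sigma$ if $\sigma\neq0$, and $f(t)=t$ if $\sigma=0$. **Theorem 1.2.** 1. The unit speed geodesics of $(M,\hat F)$ are locally the curves $\hat\gamma(t)=\psi^W_t(\gamma(f(t)))$ with $\gamma$ a unit speed geodesic of $(M,F)$. Precisely: if $\hat\gamma$ is a unit speed geodesic of $\hat F$ on an open interval containing $0$, then there are $\varepsilon>0$ and a unit speed geodesic $\gamma$ of $F$ on $f((-\varepsilon,\varepsilon))$ such that $\psi^W_t(\gamma(f(t)))$ is defined and equal to $\hat\gamma(t)$ for $|t|<\varepsilon$. Conversely, if $\gamma$ is a unit speed geodesic of $F$ on an open interval containing $0$ with $\dot\gamma(0)+W_{\gamma(0)}\in\hat\Sigma$, then for some $\varepsilon>0$ the curve $t\mapsto\psi^W_t(\gamma(f(t)))$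 is defined and is a unit speed geodesic of $\hat F$ on $(-\varepsilon,\varepsilon)$. 2. Suppose moreover that $\hat\Sigma$ is a whole connected component of the set $\{v/F(v)+W_{\pi(v)} : v\in A,\ F(v)+g_v(W_{\pi(v)},v)\neq0\}\subset TM$, where $\pi:TM\to M$ is the projection. If $(M,F)$ is geodesically complete and $W$ is a complete vector field, then $(M,\hat F)$ is geodesically complete. -/

import Mathlib

open scoped Manifold ContDiff Topology

noncomputable section

namespace Zermelo

variable {E : Type*} [NormedAddCommGroup E] [NormedSpace ℝ E]
  {M : Type*} [TopologicalSpace M] [ChartedSpace E M]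

/-- The fundamental tensor `g_v(u, w) = (1/2) ∂²/∂t∂s F(v + t u + s w)² |_{t = s = 0}` of a function
`F` on the tangent bundle, at a tangent vector `v` based at `p`. -/
def fundamentalTensor (F : TangentBundle 𝓘(ℝ, E) M → ℝ) (p : M)
    (v u w : TangentSpace 𝓘(ℝ, E) p) : ℝ :=
  (1 / 2) * deriv (fun t : ℝ => deriv (fun s : ℝ => F ⟨p, v + t • u + s • w⟩ ^ 2) 0) 0

variable (E M) in
/-- A (conic) pseudo-Finsler metric on `M`: a smooth positive function `F`, positively homogeneous
of degree one and with non-degenerate fundamental tensor, on an open subset `A` (`dom`) of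
`TM \ 0` whose fibres `A_p` are conic, connected and non-empty.
The values of `toFun` outside `dom` are irrelevant. -/
structure PseudoFinsler [IsManifold 𝓘(ℝ, E) ∞ M] where
  /-- the domain `A` -/
  dom : Set (TangentBundle 𝓘(ℝ, E) M)
  /-- the metric `F` -/
  toFun : TangentBundle 𝓘(ℝ, E) M → ℝ
  isOpen_dom : IsOpen dom
  ne_zero : ∀ (p : M) (v : TangentSpace 𝓘(ℝ, E) p),
    (⟨p, v⟩ : TangentBundle 𝓘(ℝ, E) M) ∈ dom → v ≠ 0
  conic : ∀ (p : M) (v : TangentSpace 𝓘(ℝ, E) p) (c : ℝ), 0 < c →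
    (⟨p, v⟩ : TangentBundle 𝓘(ℝ, E) M) ∈ dom → (⟨p, c • v⟩ : TangentBundle 𝓘(ℝ, E) M) ∈ dom
  isConnected_fibre : ∀ p : M,
    IsConnected {v : TangentSpace 𝓘(ℝ, E) p | (⟨p, v⟩ : TangentBundle 𝓘(ℝ, E) M) ∈ dom}
  smooth : ContMDiffOn (𝓘(ℝ, E).tangent) 𝓘(ℝ, ℝ) ∞ toFun dom
  pos : ∀ x ∈ dom, 0 < toFun x
  homogeneous : ∀ (p : M) (v : TangentSpace 𝓘(ℝ, E) p) (c : ℝ), 0 < c →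
    (⟨p, v⟩ : TangentBundle 𝓘(ℝ, E) M) ∈ dom → toFun ⟨p, c • v⟩ = c * toFun ⟨p, v⟩
  nondegenerate : ∀ (p : M) (v : TangentSpace 𝓘(ℝ, E) p),
    (⟨p, v⟩ : TangentBundle 𝓘(ℝ, E) M) ∈ dom →
    ∀ u : TangentSpace 𝓘(ℝ, E) p, (∀ w, fundamentalTensor toFun p v u w = 0) → u = 0

/-- The velocity vector `γ'(t)` of a curve. -/
def velocityVec (γ : ℝ → M) (t : ℝ) : TangentSpace 𝓘(ℝ, E) (γ t) :=
  mfderiv 𝓘(ℝ, ℝ) 𝓘(ℝ, E) γ t (1 : ℝ)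

/-- The velocity of a curve, as a point of the tangent bundle. -/
def velocity (γ : ℝ → M) (t : ℝ) : TangentBundle 𝓘(ℝ, E) M :=
  ⟨γ t, velocityVec γ t⟩

section Geodesics

variable [IsManifold 𝓘(ℝ, E) ∞ M]

/-- The indicatrix `Σ = {v ∈ A : F(v) = 1}`. -/
def PseudoFinsler.indicatrix (F : PseudoFinsler E M) : Set (TangentBundle 𝓘(ℝ, E) M) :=
  {x | x ∈ F.dom ∧ F.toFun x = 1}

/-- The energy `(1/2) ∫_a^b F(γ')² dt`. -/
def PseudoFinsler.energy (F : PseudoFinsler E M) (γ : ℝ → M) (a b : ℝ) : ℝ :=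
  (1 / 2) * ∫ t in a..b, F.toFun (velocity (E := E) γ t) ^ 2

/-- `Γ` is a smooth variation of `γ` on `[a, b]`, with parameter `s ∈ (-ε, ε)`, through admissible
curves `Γ(s, ·)` with the same end points as `γ`. -/
structure PseudoFinsler.IsProperVariation (F : PseudoFinsler E M) (γ : ℝ → M) (a b ε : ℝ)
    (Γ : ℝ × ℝ → M) : Prop where
  smooth : ∀ s ∈ Set.Ioo (-ε) ε, ∀ t ∈ Set.Icc a b,
    ContMDiffAt 𝓘(ℝ, ℝ × ℝ) 𝓘(ℝ, E) ∞ Γ (s, t)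
  base : ∀ t ∈ Set.Icc a b, Γ (0, t) = γ t
  left : ∀ s ∈ Set.Ioo (-ε) ε, Γ (s, a) = γ a
  right : ∀ s ∈ Set.Ioo (-ε) ε, Γ (s, b) = γ b
  admissible : ∀ s ∈ Set.Ioo (-ε) ε, ∀ t ∈ Set.Icc a b,
    velocity (E := E) (fun t' => Γ (s, t')) t ∈ F.dom

/-- `γ` is a geodesic of `F` on the open interval `J`: it is smooth and admissible on `J`, and its
restriction to each compact subinterval is a critical point of the energy among admissible curves
with the same end points. -/
structure PseudoFinsler.IsGeodesicOn (F : PseudoFinsler E M) (γ : ℝ → M) (J : Set ℝ) : Prop where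
  smooth : ContMDiffOn 𝓘(ℝ, ℝ) 𝓘(ℝ, E) ∞ γ J
  admissible : ∀ t ∈ J, velocity (E := E) γ t ∈ F.dom
  critical : ∀ a b : ℝ, a < b → Set.Icc a b ⊆ J → ∀ ε > 0, ∀ Γ : ℝ × ℝ → M,
    F.IsProperVariation γ a b ε Γ →
    HasDerivAt (fun s : ℝ => F.energy (fun t => Γ (s, t)) a b) 0 0

/-- A geodesic of unit speed: moreover `F(γ') = 1`. -/
def PseudoFinsler.IsUnitGeodesicOn (F : PseudoFinsler E M) (γ : ℝ → M) (J : Set ℝ) : Prop :=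
  F.IsGeodesicOn γ J ∧ ∀ t ∈ J, F.toFun (velocity (E := E) γ t) = 1

/-- `F` is geodesically complete: every geodesic, defined on a non-empty open interval, extends to
a geodesic defined on the whole real line. -/
def PseudoFinsler.GeodesicallyComplete (F : PseudoFinsler E M) : Prop :=
  ∀ (J : Set ℝ) (γ : ℝ → M), IsOpen J → J.OrdConnected → J.Nonempty → F.IsGeodesicOn γ J →
    ∃ γ' : ℝ → M, F.IsGeodesicOn γ' Set.univ ∧ Set.EqOn γ' γ J

end Geodesics

section Flow

/-- `γ` is an integral curve of `W` through `x` at time `0`, on the open interval `J ∋ 0`. -/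
structure IsIntegralCurveFrom (W : (x : M) → TangentSpace 𝓘(ℝ, E) x) (x : M)
    (γ : ℝ → M) (J : Set ℝ) : Prop where
  isOpen : IsOpen J
  ordConnected : J.OrdConnected
  zero_mem : (0 : ℝ) ∈ J
  init : γ 0 = x
  integral : IsMIntegralCurveOn (I := 𝓘(ℝ, E)) γ W J

/-- The domain of the maximal flow of `W`: the pairs `(t, x)` such that the integral curve of `W`
starting at `x` is defined up to time `t`. -/
def flowDomain (W : (x : M) → TangentSpace 𝓘(ℝ, E) x) : Set (ℝ × M) :=
  {q | ∃ (γ : ℝ → M) (J : Set ℝ), IsIntegralCurveFrom W q.2 γ J ∧ q.1 ∈ J}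

open Classical in
/-- The maximal flow `ψ^W_t(x)`: the value at time `t` of the integral curve of `W` starting at
`x`. It is meaningful for `(t, x) ∈ flowDomain W`, and set equal to `x` elsewhere. -/
def flow (W : (x : M) → TangentSpace 𝓘(ℝ, E) x) (t : ℝ) (x : M) : M :=
  if h : (t, x) ∈ flowDomain W then h.choose t else x

/-- The vector field `W` is complete. -/
def IsCompleteField (W : (x : M) → TangentSpace 𝓘(ℝ, E) x) : Prop :=
  ∀ x : M, ∃ γ : ℝ → M, γ 0 = x ∧ IsMIntegralCurve (I := 𝓘(ℝ, E)) γ W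

variable [IsManifold 𝓘(ℝ, E) ∞ M]

/-- `W` is homothetic for `F` with constant `σ`: `(ψ^W_t)^* F = e^{-σ t} F` (an equality of
functions, so that the domains agree as well) wherever `ψ^W_t` is defined. -/
def IsHomothetic (F : PseudoFinsler E M) (W : (x : M) → TangentSpace 𝓘(ℝ, E) x) (σ : ℝ) : Prop :=
  ∀ (t : ℝ) (x : M), (t, x) ∈ flowDomain W → ∀ v : TangentSpace 𝓘(ℝ, E) x,
    ((⟨flow W t x, mfderiv 𝓘(ℝ, E) 𝓘(ℝ, E) (flow W t) x v⟩ : TangentBundle 𝓘(ℝ, E) M) ∈ F.dom ↔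
      (⟨x, v⟩ : TangentBundle 𝓘(ℝ, E) M) ∈ F.dom) ∧
    ((⟨x, v⟩ : TangentBundle 𝓘(ℝ, E) M) ∈ F.dom →
      F.toFun ⟨flow W t x, mfderiv 𝓘(ℝ, E) 𝓘(ℝ, E) (flow W t) x v⟩ =
        Real.exp (-(σ * t)) * F.toFun ⟨x, v⟩)

/-- `F'` is a translation of `F` by `W`: `v / F'(v) - W` lies in the indicatrix of `F` for every
`v` in the domain of `F'`. -/
def IsTranslation (F F' : PseudoFinsler E M) (W : (x : M) → TangentSpace 𝓘(ℝ, E) x) : Prop :=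
  ∀ (p : M) (v : TangentSpace 𝓘(ℝ, E) p), (⟨p, v⟩ : TangentBundle 𝓘(ℝ, E) M) ∈ F'.dom →
    (⟨p, (F'.toFun ⟨p, v⟩)⁻¹ • v - W p⟩ : TangentBundle 𝓘(ℝ, E) M) ∈ F.indicatrix

/-- The transversal part of the translated indicatrix:
`{v / F(v) + W : v ∈ A, F(v) + g_v(W, v) ≠ 0}`. -/
def transversalTranslate (F : PseudoFinsler E M) (W : (x : M) → TangentSpace 𝓘(ℝ, E) x) :
    Set (TangentBundle 𝓘(ℝ, E) M) :=
  {y | ∃ (p : M) (v : TangentSpace 𝓘(ℝ, E) p), (⟨p, v⟩ : TangentBundle 𝓘(ℝ, E) M) ∈ F.dom ∧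
    F.toFun ⟨p, v⟩ + fundamentalTensor F.toFun p v (W p) v ≠ 0 ∧
    y = ⟨p, (F.toFun ⟨p, v⟩)⁻¹ • v + W p⟩}

/-- The indicatrix of `F'` is a whole connected component of the transversal part of the
translated indicatrix of `F`. -/
def IsFullTranslation (F F' : PseudoFinsler E M) (W : (x : M) → TangentSpace 𝓘(ℝ, E) x) : Prop :=
  ∃ y ∈ transversalTranslate F W,
    F'.indicatrix = connectedComponentIn (transversalTranslate F W) y

end Flow

/-- The time change `f(t) = (e^{σ t} - 1) / σ`, and `f(t) = t` if `σ = 0`. -/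
def timeChange (σ t : ℝ) : ℝ :=
  if σ = 0 then t else (Real.exp (σ * t) - 1) / σ

end Zermelo

end

/-!
# Geodesics of a translation by a homothetic vector field

**Geodesics in coordinates.** A smooth admissible curve is a geodesic of `F` if and only if it
solves the Euler–Lagrange equation of `F² / 2` in charts (`IsGeodesicOn.isELAt`, by bump-function
variations, and `isGeodesicOn_of_isELAt`, by the first variation formula). At unit speed, the
Lagrangians `F² / 2` and `F` have the same Euler–Lagrange equation, and the latter is invariant
under changes of the parameter by homogeneity (`IsFinslerOn.isELAt_comp_iff`). Thus one has to
compare the Euler–Lagrange equations of `F` along `γ ∘ f` and of `F'` along its image `x` under the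
flow `ψ_t` of `W`.

**The translated metric.** A translation satisfies `F(u - F'(u) W) = F'(u)`. Differentiating, with
`v = u - W` and `F'(u) = 1`, one finds `F'_u = p / N` and `F'_x = (F_x - p ∘ dW) / N` for `p = F_v`
and `N = 1 + p(W)`; the same relation shows `N ≠ 0` (`zermelo_transversal`). Since `W` is
infinitesimally homothetic, `N' = Z(W) - σ N` for the expression
`Z = (d/dt) p - F_x + p ∘ dW + σ p`, and the Euler–Lagrange equation of `F'` becomes
`N Z = Z(W) p`. Evaluated at `W` this says `Z(W) = 0`, so it is equivalent to `Z = 0`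
(`isELAt_zermelo_iff`).

**Transport by the flow.** Comparing the first variations of `F` along `c + s η` and along
`ψ_t(c + s η)` gives `Z ∘ dψ_t = e^{-σt} ((d/dt) F_v - F_x)`, the right side being evaluated along
`c = γ ∘ f` (`flow_transport`). The map `dψ_t` is invertible, because a homothety preserves the
non-degenerate fundamental tensor up to a factor (`IsFinslerOn.injective_of_homothety`). Hence
`Z = 0` along `x` is the Euler–Lagrange equation of `F` along `c` (`isELAt_flow_iff`). The time
change `f' = e^{σt}` compensates the factor `e^{-σt}` in the homothety, so that `x' - W` has unit
length for `F` when `γ` has unit speed.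

**Which transported curves have unit speed for `F'`.** The relation `F(x' - W) = 1` does not
determine `F'(x')`, since the equation `F(u - λ W) = λ` can have several solutions `λ`. It has only
one near `λ = 1`, because its derivative in `λ` involves `N ≠ 0`
(`eventually_eq_one_of_transversal`); so `F'(x') = 1` persists for a short time once it holds at
time zero.

**Completeness.** A unit speed geodesic of `F'` is pulled back by the flow, extended by the
completeness of `F`, and pushed forward again. Along the resulting curve, `Z = 0` gives
`N' = -σ N`, so `N` never vanishes: the velocities form a connected subset of the transversal part
of the translated indicatrix, and hence stay in the component which is the indicatrix of `F'`
(`exists_complete_unit_geodesic`).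

**Smoothness of the flow.** The joint smoothness of the flow in time and initial point is obtained
from the implicit function theorem in the Banach space of continuous curves
(`exists_contDiffAt_solution`) and is continued along integral curves (`flow_contMDiffAt`).
-/

noncomputable section

namespace Zermelo

open Set Filter MeasureTheory

/-! ### Smooth dependence of the solutions of an ordinary differential equation -/

section Superposition

universe u

variable {K : Type*} [TopologicalSpace K] [CompactSpace K]

/-- Pointwise application of a continuous family of operators to a continuous family of vectors,
as a bounded bilinear map. -/
def pointwiseApply (K : Type*) [TopologicalSpace K] [CompactSpace K] (E F : Type*)
    [NormedAddCommGroup E] [NormedSpace ℝ E] [NormedAddCommGroup F] [NormedSpace ℝ F] :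
    C(K, E →L[ℝ] F) →L[ℝ] C(K, E) →L[ℝ] C(K, F) :=
  LinearMap.mkContinuous₂
    (LinearMap.mk₂ ℝ (fun (A : C(K, E →L[ℝ] F)) (h : C(K, E)) =>
        (⟨fun k => A k (h k), by fun_prop⟩ : C(K, F)))
      (fun _ _ _ => by ext; simp) (fun _ _ _ => by ext; simp)
      (fun _ _ _ => by ext; simp) (fun _ _ _ => by ext; simp))
    1 (fun A h => by
      rw [one_mul, ContinuousMap.norm_le _ (by positivity)]
      intro k
      exact (A k).le_of_opNorm_le_of_le (A.norm_coe_le_norm k) (h.norm_coe_le_norm k))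

variable {E F : Type u} [NormedAddCommGroup E] [NormedSpace ℝ E]
  [NormedAddCommGroup F] [NormedSpace ℝ F]

theorem pointwiseApply_apply (A : C(K, E →L[ℝ] F)) (h : C(K, E)) (k : K) :
    pointwiseApply K E F A h k = A k (h k) := rfl

/-- The superposition operator is Fréchet differentiable; the required uniformity in the point of
`K` comes from the continuity of `u ↦ dg ∘ u` in the supremum norm. -/
theorem hasFDerivAt_postcomp {g : E → F} (hg : ContDiff ℝ ∞ g) (u : C(K, E)) :
    HasFDerivAt (fun u : C(K, E) => (⟨g, hg.continuous⟩ : C(E, F)).comp u)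
      (pointwiseApply K E F
        ((⟨fderiv ℝ g, hg.continuous_fderiv (by simp)⟩ : C(E, E →L[ℝ] F)).comp u)) u := by
  set Dg : C(E, E →L[ℝ] F) := ⟨fderiv ℝ g, hg.continuous_fderiv (by simp)⟩ with hDg
  rw [hasFDerivAt_iff_isLittleO_nhds_zero, Asymptotics.isLittleO_iff]
  intro ε hε
  have hc : ContinuousAt (fun u : C(K, E) => Dg.comp u) u :=
    (ContinuousMap.continuous_postcomp Dg).continuousAt
  obtain ⟨δ, hδ, hball⟩ : ∃ δ > 0, ∀ v : C(K, E), dist v u < δ →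
      dist (Dg.comp v) (Dg.comp u) < ε := by
    obtain ⟨δ, hδ, h⟩ := Metric.mem_nhds_iff.1 (hc (Metric.ball_mem_nhds (Dg.comp u) hε))
    exact ⟨δ, hδ, fun v hv => h hv⟩
  filter_upwards [Metric.ball_mem_nhds (0 : C(K, E)) hδ] with h hh
  rw [ContinuousMap.norm_le _ (by positivity)]
  intro k
  have hbound : ∀ y ∈ Metric.ball (u k) δ, ‖fderiv ℝ g y - fderiv ℝ g (u k)‖ ≤ ε := by
    intro y hy
    -- a constant shift of the whole family turns the uniform estimate into a pointwise one
    have h1 : dist (u + ContinuousMap.const K (y - u k)) u < δ := by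
      rw [dist_eq_norm, add_sub_cancel_left]
      refine lt_of_le_of_lt ((ContinuousMap.norm_le _ (norm_nonneg (y - u k))).2 fun _ => ?_)
        (by simpa [dist_eq_norm] using hy)
      simp
    have h2 := (ContinuousMap.dist_apply_le_dist
      (f := Dg.comp (u + ContinuousMap.const K (y - u k)))
      (g := Dg.comp u) k).trans (hball _ h1).le
    simpa [hDg, dist_eq_norm] using h2
  have hmem : u k + h k ∈ Metric.ball (u k) δ := by
    have := (h.norm_coe_le_norm k).trans_lt (by simpa [dist_eq_norm] using hh)
    simpa [dist_eq_norm] using this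
  have := (convex_ball (u k) δ).norm_image_sub_le_of_norm_hasFDerivWithin_le'
    (f := g) (f' := fderiv ℝ g) (φ := fderiv ℝ g (u k))
    (fun y _ => (hg.differentiable (by simp) y).hasFDerivAt.hasFDerivWithinAt) hbound
    (Metric.mem_ball_self hδ) hmem
  rw [add_sub_cancel_left] at this
  refine le_trans (le_of_eq ?_) (this.trans
    (mul_le_mul_of_nonneg_left (h.norm_coe_le_norm k) hε.le))
  simp [pointwiseApply_apply, hDg]

/-- The superposition operator `u ↦ g ∘ u` on continuous functions on a compact space is smooth when
`g` is: its derivative is again a superposition operator, followed by a bounded bilinear map. -/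
theorem contDiff_postcomp (n : ℕ) : ∀ {F : Type u} [NormedAddCommGroup F] [NormedSpace ℝ F]
    {g : E → F} (hg : ContDiff ℝ ∞ g),
    ContDiff ℝ n (fun u : C(K, E) => (⟨g, hg.continuous⟩ : C(E, F)).comp u) := by
  induction n with
  | zero =>
    intro F _ _ g hg
    exact contDiff_zero.2 (ContinuousMap.continuous_postcomp _)
  | succ n ih =>
    intro F _ _ g hg
    have : ((n + 1 : ℕ) : WithTop ℕ∞) = (n : WithTop ℕ∞) + 1 := by simp
    rw [this, contDiff_succ_iff_hasFDerivAt]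
    refine ⟨_, ?_, fun u => hasFDerivAt_postcomp hg u⟩
    exact (pointwiseApply K E F).contDiff.comp (ih (hg.fderiv_right (m := ∞) (by simp)))

theorem contDiff_infty_postcomp {g : E → F} (hg : ContDiff ℝ ∞ g) :
    ContDiff ℝ ∞ (fun u : C(K, E) => (⟨g, hg.continuous⟩ : C(E, F)).comp u) :=
  contDiff_infty.2 fun n => contDiff_postcomp n hg

end Superposition

section LocalFlow

variable {E : Type*} [NormedAddCommGroup E] [NormedSpace ℝ E]

/-- The primitive vanishing at `0` of a continuous function on `[-2, 2]`, as a bounded operator. -/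
def primitive (E : Type*) [NormedAddCommGroup E] [NormedSpace ℝ E] :
    C(Icc (-2 : ℝ) 2, E) →L[ℝ] C(Icc (-2 : ℝ) 2, E) :=
  LinearMap.mkContinuous
    { toFun := fun u => ⟨fun t => ∫ τ in (0 : ℝ)..t, u (projIcc (-2) 2 (by norm_num) τ), by
        have hc : Continuous fun τ : ℝ => u (projIcc (-2) 2 (by norm_num) τ) :=
          u.continuous.comp continuous_projIcc
        exact (intervalIntegral.continuous_primitive
          (fun a b => hc.intervalIntegrable a b) 0).comp continuous_subtype_val⟩
      map_add' := fun u v => by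
        ext t
        have hc : ∀ u : C(Icc (-2 : ℝ) 2, E),
            Continuous fun τ : ℝ => u (projIcc (-2) 2 (by norm_num) τ) :=
          fun u => u.continuous.comp continuous_projIcc
        exact intervalIntegral.integral_add ((hc u).intervalIntegrable _ _)
          ((hc v).intervalIntegrable _ _)
      map_smul' := fun c u => by
        ext t
        exact intervalIntegral.integral_smul c _ }
    2 (fun u => by
      rw [ContinuousMap.norm_le _ (by positivity)]
      intro t
      refine (intervalIntegral.norm_integral_le_of_norm_le_const (C := ‖u‖)
        (fun τ _ => u.norm_coe_le_norm _)).trans ?_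
      rw [mul_comm, sub_zero]
      exact mul_le_mul_of_nonneg_right (abs_le.2 t.2) (norm_nonneg u))

/-- For a smooth vector field `W` and `(s, x)` near `(0, x₀)`, the equation `u' = s W(u)`,
`u(0) = x` has a solution `u(s, x)` on `(-2, 2)`, with values near `x₀`, and `u(s, x)(1)` is a
smooth function of `(s, x)` at `(0, x₀)`. Thus `u(s, x)(1)` is the flow of `W` at time `s`, and the
rescaling of time gives smoothness in `s` and `x` jointly.
It is obtained from the implicit function theorem in the space of continuous functions. -/
theorem exists_contDiffAt_solution [CompleteSpace E] {W : E → E} (hW : ContDiff ℝ ∞ W) (x₀ : E)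
    {O : Set E} (hO : O ∈ 𝓝 x₀) :
    ∃ u : ℝ × E → ℝ → E, ContDiffAt ℝ ∞ (fun q => u q 1) (0, x₀) ∧
      ∀ᶠ q in 𝓝 ((0 : ℝ), x₀), u q 0 = q.2 ∧
        ∀ t ∈ Ioo (-2 : ℝ) 2, u q t ∈ O ∧ HasDerivAt (u q) (q.1 • W (u q t)) t := by
  let X := C(Icc (-2 : ℝ) 2, E)
  let N : X → X := fun u => (⟨W, hW.continuous⟩ : C(E, E)).comp u
  have hN : ContDiff ℝ ∞ N := contDiff_infty_postcomp hW
  let cst : E →L[ℝ] X := ContinuousLinearMap.const ℝ (Icc (-2 : ℝ) 2)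
  -- at `s = 0` this map is `u ↦ u - x`, so its partial derivative in `u` is the identity
  let Φ : (ℝ × E) × X → X := fun p => p.2 - cst p.1.2 - p.1.1 • primitive E (N p.2)
  have hΦ : ContDiff ℝ ∞ Φ := by
    have h1 : ContDiff ℝ ∞ fun p : (ℝ × E) × X => primitive E (N p.2) :=
      (primitive E).contDiff.comp (hN.comp contDiff_snd)
    have h2 : ContDiff ℝ ∞ fun p : (ℝ × E) × X => cst p.1.2 :=
      cst.contDiff.comp (contDiff_snd.comp contDiff_fst)
    exact (contDiff_snd.sub h2).sub ((contDiff_fst.comp contDiff_fst).smul h1)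
  let p₀ : (ℝ × E) × X := ((0, x₀), cst x₀)
  have hinr : (fderiv ℝ Φ p₀) ∘L (.inr ℝ (ℝ × E) X) = ContinuousLinearMap.id ℝ X := by
    have h1 : HasFDerivAt (fun u : X => Φ ((0, x₀), u))
        ((fderiv ℝ Φ p₀) ∘L (.inr ℝ (ℝ × E) X)) (cst x₀) :=
      (hΦ.differentiable (by simp) p₀).hasFDerivAt.comp (cst x₀)
        (hasFDerivAt_prodMk_right (0, x₀) (cst x₀))
    have h2 : HasFDerivAt (fun u : X => Φ ((0, x₀), u)) (ContinuousLinearMap.id ℝ X) (cst x₀) := by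
      have : (fun u : X => Φ ((0, x₀), u)) = fun u => u - cst x₀ := by
        funext u; simp [Φ]
      rw [this]
      exact (hasFDerivAt_id _).sub_const _
    exact h1.unique h2
  have hinv : ((fderiv ℝ Φ p₀) ∘L (.inr ℝ (ℝ × E) X)).IsInvertible := by
    rw [hinr]; exact ContinuousLinearMap.isInvertible_equiv (f := ContinuousLinearEquiv.refl ℝ X)
  have hΦ0 : ContDiffAt ℝ ∞ Φ p₀ := hΦ.contDiffAt
  let ψ := hΦ0.implicitFunction (by simp) hinv
  have hψ : ContDiffAt ℝ ∞ ψ (0, x₀) := hΦ0.contDiffAt_implicitFunction (by simp) hinv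
  have hψ0 : ψ (0, x₀) = cst x₀ := hΦ0.implicitFunction_apply_self (by simp) hinv
  have heq : ∀ᶠ q in 𝓝 ((0 : ℝ), x₀), Φ (q, ψ q) = Φ p₀ :=
    hΦ0.eventually_apply_implicitFunction (by simp) hinv
  have hΦp₀ : Φ p₀ = 0 := by simp [Φ, p₀]
  have hsol : ∀ᶠ q in 𝓝 ((0 : ℝ), x₀), ∀ t : Icc (-2 : ℝ) 2,
      ψ q t = q.2 + q.1 • ∫ τ in (0 : ℝ)..t, W (ψ q (projIcc (-2) 2 (by norm_num) τ)) := by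
    filter_upwards [heq] with q hq t
    rw [hΦp₀] at hq
    have h3 : ψ q = cst q.2 + q.1 • primitive E (N (ψ q)) := by
      have : ψ q - cst q.2 - q.1 • primitive E (N (ψ q)) = 0 := hq
      rw [sub_sub, sub_eq_zero] at this
      exact this
    have h4 := congrArg (fun u : X => u t) h3
    exact h4
  obtain ⟨δ, hδ, hball⟩ := Metric.mem_nhds_iff.1 hO
  have hnear : ∀ᶠ q in 𝓝 ((0 : ℝ), x₀), dist (ψ q) (cst x₀) < δ := by
    have := hψ.continuousAt
    rw [ContinuousAt, hψ0] at this
    exact this (Metric.ball_mem_nhds _ hδ)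
  refine ⟨fun q t => ψ q (projIcc (-2) 2 (by norm_num) t), ?_, ?_⟩
  · let ev : X →L[ℝ] E := ContinuousMap.evalCLM ℝ (projIcc (-2 : ℝ) 2 (by norm_num) 1)
    exact ev.contDiff.contDiffAt.comp _ hψ
  · filter_upwards [hsol, hnear] with q hq hd
    refine ⟨?_, fun t ht => ⟨?_, ?_⟩⟩
    · rw [hq, projIcc_of_mem (by norm_num) (show (0 : ℝ) ∈ Icc (-2) 2 by norm_num)]
      simp
    · refine hball ?_
      have := (ContinuousMap.dist_apply_le_dist (f := ψ q) (g := cst x₀)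
        (projIcc (-2) 2 (by norm_num) t)).trans_lt hd
      exact this
    · have hc : Continuous fun τ : ℝ => W (ψ q (projIcc (-2) 2 (by norm_num) τ)) :=
        hW.continuous.comp ((ψ q).continuous.comp continuous_projIcc)
      have h5 := ((intervalIntegral.integral_hasDerivAt_right (hc.intervalIntegrable 0 t)
        (hc.stronglyMeasurableAtFilter _ _) hc.continuousAt).const_smul q.1).const_add q.2
      refine h5.congr_of_eventuallyEq ?_
      filter_upwards [Ioo_mem_nhds ht.1 ht.2] with r hr
      rw [hq, projIcc_of_mem (by norm_num) (Ioo_subset_Icc_self hr)]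
      rfl

/-- A vector field smooth near a point of a finite-dimensional space agrees near this point with a
smooth vector field on the whole space. -/
theorem exists_contDiff_eventuallyEq [FiniteDimensional ℝ E] {W : E → E} {x₀ : E} {O : Set E}
    (hO : O ∈ 𝓝 x₀) (hW : ContDiffOn ℝ ∞ W O) :
    ∃ W' : E → E, ContDiff ℝ ∞ W' ∧ W' =ᶠ[𝓝 x₀] W := by
  obtain ⟨r, hr, hball⟩ := Metric.mem_nhds_iff.1 hO
  let χ : ContDiffBump x₀ := ⟨r / 3, r / 2, by positivity, by linarith⟩
  refine ⟨fun x => χ x • W x, ?_, ?_⟩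
  · rw [contDiff_iff_contDiffAt]
    intro x
    by_cases hx : x ∈ Metric.ball x₀ r
    · exact χ.contDiff.contDiffAt.smul
        ((hW.mono hball).contDiffAt (Metric.isOpen_ball.mem_nhds hx))
    · have : x ∈ (Metric.closedBall x₀ (r / 2))ᶜ := by
        simp only [Metric.mem_ball, not_lt, mem_compl_iff, Metric.mem_closedBall, not_le] at hx ⊢
        linarith
      refine (contDiffAt_const (c := (0 : E))).congr_of_eventuallyEq ?_
      filter_upwards [Metric.isClosed_closedBall.isOpen_compl.mem_nhds this] with y hy
      have hy' : χ y = 0 := χ.zero_of_le_dist (by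
        simpa using (not_le.1 (show ¬ dist y x₀ ≤ r / 2 from hy)).le)
      simp [hy']
  · filter_upwards [χ.eventuallyEq_one] with x hx
    simp [hx]

end LocalFlow

/-! ### Coordinates on the tangent bundle -/

section Coordinates

variable {E : Type*} [NormedAddCommGroup E] [NormedSpace ℝ E]
  {M : Type*} [TopologicalSpace M] [ChartedSpace E M]

/-- The coordinates `(x, v)` of a tangent vector in the chart of `M` at `p`. They are meaningful for
vectors based in the domain of this chart. -/
def tcoord (p : M) (z : TangentBundle 𝓘(ℝ, E) M) : E × E :=
  (extChartAt 𝓘(ℝ, E) p z.1, mfderiv 𝓘(ℝ, E) 𝓘(ℝ, E) (extChartAt 𝓘(ℝ, E) p) z.1 z.2)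

theorem tcoord_smul (p : M) (y : M) (c : ℝ) (v : TangentSpace 𝓘(ℝ, E) y) :
    tcoord p ⟨y, c • v⟩ = ((tcoord p ⟨y, v⟩).1, c • (tcoord p ⟨y, v⟩).2) := by
  simp only [tcoord, map_smul]; rfl

theorem tcoord_add (p : M) (y : M) (v w : TangentSpace 𝓘(ℝ, E) y) :
    tcoord p ⟨y, v + w⟩ =
      ((tcoord p ⟨y, v⟩).1, (tcoord p ⟨y, v⟩).2 + (tcoord p ⟨y, w⟩).2) := by
  simp only [tcoord, map_add]; rfl

theorem tcoord_sub (p : M) (y : M) (v w : TangentSpace 𝓘(ℝ, E) y) :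
    tcoord p ⟨y, v - w⟩ =
      ((tcoord p ⟨y, v⟩).1, (tcoord p ⟨y, v⟩).2 - (tcoord p ⟨y, w⟩).2) := by
  simp only [tcoord, map_sub]; rfl

theorem tcoord_fst_mem {p : M} {z : TangentBundle 𝓘(ℝ, E) M}
    (hz : z.1 ∈ (extChartAt 𝓘(ℝ, E) p).source) :
    (tcoord p z).1 ∈ (extChartAt 𝓘(ℝ, E) p).target :=
  (extChartAt 𝓘(ℝ, E) p).map_source hz

section Curves

variable {γ : ℝ → M} {t : ℝ} {p : M}

theorem tcoord_velocity [IsManifold 𝓘(ℝ, E) 1 M] (hγ : MDifferentiableAt 𝓘(ℝ, ℝ) 𝓘(ℝ, E) γ t)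
    (hp : γ t ∈ (extChartAt 𝓘(ℝ, E) p).source) :
    tcoord p (velocity γ t) =
      (extChartAt 𝓘(ℝ, E) p (γ t), deriv (fun r => extChartAt 𝓘(ℝ, E) p (γ r)) t) := by
  refine Prod.ext rfl ?_
  have h1 : MDifferentiableAt 𝓘(ℝ, E) 𝓘(ℝ, E) (extChartAt 𝓘(ℝ, E) p) (γ t) :=
    mdifferentiableAt_extChartAt (by rwa [extChartAt_source] at hp)
  have h2 := mfderiv_comp t h1 hγ
  have h3 : mfderiv 𝓘(ℝ, ℝ) 𝓘(ℝ, E) (extChartAt 𝓘(ℝ, E) p ∘ γ) t =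
    fderiv ℝ (extChartAt 𝓘(ℝ, E) p ∘ γ) t := mfderiv_eq_fderiv
  rw [h3] at h2
  exact (congrArg (fun A : ℝ →L[ℝ] E => A 1) h2).symm

end Curves

variable [IsManifold 𝓘(ℝ, E) ∞ M]

/-- The tangent vector with given coordinates in the chart at `p`. -/
def tcoordSymm (p : M) : E × E → TangentBundle 𝓘(ℝ, E) M :=
  (extChartAt 𝓘(ℝ, E).tangent (⟨p, 0⟩ : TangentBundle 𝓘(ℝ, E) M)).symm

/-- The coordinates `tcoord p` are the chart of the tangent bundle at `(p, 0)`, which is how their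
smoothness is obtained. -/
theorem tcoord_eq {p : M} {z : TangentBundle 𝓘(ℝ, E) M} (hz : z.1 ∈ (chartAt E p).source) :
    tcoord p z = extChartAt 𝓘(ℝ, E).tangent (⟨p, 0⟩ : TangentBundle 𝓘(ℝ, E) M) z := by
  have h := mfderiv_chartAt_eq_tangentCoordChange (I := 𝓘(ℝ, E)) hz
  refine Prod.ext ?_ ?_
  · simp [tcoord, mfld_simps]
  · have h2 : mfderiv 𝓘(ℝ, E) 𝓘(ℝ, E) (extChartAt 𝓘(ℝ, E) p) z.1 =
        mfderiv 𝓘(ℝ, E) 𝓘(ℝ, E) (chartAt E p) z.1 := by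
      simp only [mfld_simps]
      rfl
    simp only [tcoord]
    rw [h2, h]
    rfl

theorem tcoordSymm_tcoord {p : M} {z : TangentBundle 𝓘(ℝ, E) M}
    (hz : z.1 ∈ (extChartAt 𝓘(ℝ, E) p).source) : tcoordSymm p (tcoord p z) = z := by
  rw [extChartAt_source] at hz
  rw [tcoord_eq hz, tcoordSymm, PartialEquiv.left_inv]
  simpa [mfld_simps] using hz

theorem tcoordSymm_fst (p : M) (q : E × E) :
    (tcoordSymm p q).1 = (extChartAt 𝓘(ℝ, E) p).symm q.1 := by
  simp only [tcoordSymm, mfld_simps]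
  rfl

theorem mem_tangent_target {p : M} {q : E × E} (hq : q.1 ∈ (extChartAt 𝓘(ℝ, E) p).target) :
    q ∈ (extChartAt 𝓘(ℝ, E).tangent (⟨p, 0⟩ : TangentBundle 𝓘(ℝ, E) M)).target := by
  simp only [mfld_simps] at hq
  rw [extChartAt_target]
  refine ⟨?_, mem_range_self (f := 𝓘(ℝ, E).tangent) q⟩
  exact (TangentBundle.mem_chart_target_iff (I := 𝓘(ℝ, E)) q
    (⟨p, 0⟩ : TangentBundle 𝓘(ℝ, E) M)).2 hq

theorem tcoordSymm_fst_mem {p : M} {q : E × E} (hq : q.1 ∈ (extChartAt 𝓘(ℝ, E) p).target) :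
    (tcoordSymm p q).1 ∈ (extChartAt 𝓘(ℝ, E) p).source := by
  rw [tcoordSymm_fst]
  exact (extChartAt 𝓘(ℝ, E) p).map_target hq

theorem tcoord_tcoordSymm {p : M} {q : E × E} (hq : q.1 ∈ (extChartAt 𝓘(ℝ, E) p).target) :
    tcoord p (tcoordSymm p q) = q := by
  rw [tcoord_eq, tcoordSymm, PartialEquiv.right_inv _ (mem_tangent_target hq)]
  have := tcoordSymm_fst_mem hq
  rwa [extChartAt_source] at this

theorem contMDiffOn_tcoordSymm (p : M) :
    ContMDiffOn 𝓘(ℝ, E × E) 𝓘(ℝ, E).tangent ∞ (tcoordSymm p)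
      {q : E × E | q.1 ∈ (extChartAt 𝓘(ℝ, E) p).target} := by
  have h := contMDiffOn_extChartAt_symm (I := 𝓘(ℝ, E).tangent) (n := ∞)
    (⟨p, 0⟩ : TangentBundle 𝓘(ℝ, E) M)
  exact h.mono fun q hq => mem_tangent_target hq

theorem contMDiffOn_tcoord (p : M) :
    ContMDiffOn 𝓘(ℝ, E).tangent 𝓘(ℝ, E × E) ∞ (tcoord p)
      {z : TangentBundle 𝓘(ℝ, E) M | z.1 ∈ (extChartAt 𝓘(ℝ, E) p).source} := by
  have h := contMDiffOn_extChartAt (I := 𝓘(ℝ, E).tangent) (n := ∞)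
    (x := (⟨p, 0⟩ : TangentBundle 𝓘(ℝ, E) M))
  refine (h.mono fun z hz => ?_).congr fun z hz => ?_
  · simpa [mfld_simps] using hz
  · exact tcoord_eq (by simpa [mfld_simps] using hz)

end Coordinates

/-! ### Smoothness of the flow of a vector field -/

section Flow

variable {E : Type*} [NormedAddCommGroup E] [NormedSpace ℝ E]
  {M : Type*} [TopologicalSpace M] [ChartedSpace E M]

theorem hasMFDerivAt_extChartAt_symm_comp [IsManifold 𝓘(ℝ, E) 1 M] {p y : M} {c : ℝ → E} {t : ℝ}
    (hy : y ∈ (extChartAt 𝓘(ℝ, E) p).source) (hct : c t = extChartAt 𝓘(ℝ, E) p y)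
    {v : TangentSpace 𝓘(ℝ, E) y} (hc : HasDerivAt c (tcoord p ⟨y, v⟩).2 t) :
    HasMFDerivAt 𝓘(ℝ, ℝ) 𝓘(ℝ, E) (fun r => (extChartAt 𝓘(ℝ, E) p).symm (c r)) t
      ((1 : ℝ →L[ℝ] ℝ).smulRight v) := by
  have h1 : MDifferentiableAt 𝓘(ℝ, E) 𝓘(ℝ, E) (extChartAt 𝓘(ℝ, E) p).symm (c t) := by
    rw [hct]
    have := mdifferentiableWithinAt_extChartAt_symm (I := 𝓘(ℝ, E))
      ((extChartAt 𝓘(ℝ, E) p).map_source hy)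
    rwa [ModelWithCorners.range_eq_univ, mdifferentiableWithinAt_univ] at this
  have h2 := mfderivWithin_extChartAt_symm_comp_mfderiv_extChartAt' (I := 𝓘(ℝ, E)) hy
  rw [ModelWithCorners.range_eq_univ, mfderivWithin_univ, ← hct] at h2
  have h3 : HasMFDerivAt 𝓘(ℝ, ℝ) 𝓘(ℝ, E) c t
      ((1 : ℝ →L[ℝ] ℝ).smulRight (tcoord p ⟨y, v⟩).2) := hc.hasFDerivAt.hasMFDerivAt
  have h4 := h1.hasMFDerivAt.comp t h3
  refine h4.congr_mfderiv ?_
  have h5 := congrArg (fun A : E →L[ℝ] E => A v) h2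
  refine ContinuousLinearMap.ext fun r => ?_
  let r' : ℝ := r
  change mfderiv 𝓘(ℝ, E) 𝓘(ℝ, E) (extChartAt 𝓘(ℝ, E) p).symm (c t) (r' • (tcoord p ⟨y, v⟩).2) =
    r' • v
  exact ((mfderiv 𝓘(ℝ, E) 𝓘(ℝ, E) (extChartAt 𝓘(ℝ, E) p).symm (c t)).map_smul r'
    (tcoord p ⟨y, v⟩).2).trans (congrArg (fun z : E => r' • z) h5)

theorem isMIntegralCurveOn_congr {W : (x : M) → TangentSpace 𝓘(ℝ, E) x} {J : Set ℝ}
    {α β : ℝ → M} (hα : IsMIntegralCurveOn (I := 𝓘(ℝ, E)) α W J)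
    (h : EqOn β α J) : IsMIntegralCurveOn (I := 𝓘(ℝ, E)) β W J := by
  intro t ht
  have h1 := (hα t ht).congr_of_eventuallyEq (f₁ := β)
    (eventually_nhdsWithin_of_forall fun s hs => h hs) (h ht)
  rw [← h ht] at h1
  exact h1

section CoordField

variable {W : (x : M) → TangentSpace 𝓘(ℝ, E) x}

/-- The expression of a vector field in the chart at `p`. -/
def coordField (W : (x : M) → TangentSpace 𝓘(ℝ, E) x) (p : M) (x : E) : E :=
  (tcoord p ⟨(extChartAt 𝓘(ℝ, E) p).symm x, W ((extChartAt 𝓘(ℝ, E) p).symm x)⟩).2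

theorem coordField_apply {p y : M} (hy : y ∈ (extChartAt 𝓘(ℝ, E) p).source) :
    coordField W p (extChartAt 𝓘(ℝ, E) p y) = (tcoord p ⟨y, W y⟩).2 := by
  rw [coordField, (extChartAt 𝓘(ℝ, E) p).left_inv hy]

theorem contDiffOn_coordField [IsManifold 𝓘(ℝ, E) ∞ M]
    (hW : ContMDiff 𝓘(ℝ, E) 𝓘(ℝ, E).tangent ∞
      (fun x => (⟨x, W x⟩ : TangentBundle 𝓘(ℝ, E) M))) (p : M) :
    ContDiffOn ℝ ∞ (coordField W p) (extChartAt 𝓘(ℝ, E) p).target := by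
  have h1 := hW.comp_contMDiffOn (contMDiffOn_extChartAt_symm (I := 𝓘(ℝ, E)) (n := ∞) p)
  have h2 := (contMDiffOn_tcoord (E := E) p).comp h1
    (fun x hx => (extChartAt 𝓘(ℝ, E) p).map_target hx)
  exact contDiff_snd.comp_contDiffOn (contMDiffOn_iff_contDiffOn.1 h2)

end CoordField

variable [FiniteDimensional ℝ E] [IsManifold 𝓘(ℝ, E) ∞ M]
  {W : (x : M) → TangentSpace 𝓘(ℝ, E) x}
  (hW : ContMDiff 𝓘(ℝ, E) 𝓘(ℝ, E).tangent ∞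
    (fun x => (⟨x, W x⟩ : TangentBundle 𝓘(ℝ, E) M)))

include hW in
/-- Near `(0, x)`, the integral curves of a smooth vector field depend smoothly on time and initial
point. -/
theorem exists_local_flow (x : M) :
    ∃ Φ : ℝ × M → M, ContMDiffAt (𝓘(ℝ, ℝ).prod 𝓘(ℝ, E)) 𝓘(ℝ, E) ∞ Φ (0, x) ∧
      ∀ᶠ q in 𝓝 ((0 : ℝ), x), ∃ (γ : ℝ → M) (J : Set ℝ),
        IsIntegralCurveFrom W q.2 γ J ∧ q.1 ∈ J ∧ Φ q = γ q.1 := by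
  set φ := extChartAt 𝓘(ℝ, E) x with hφ
  have hT : φ.target ∈ 𝓝 (φ x) := extChartAt_target_mem_nhds x
  obtain ⟨w, hw, hwW⟩ := exists_contDiff_eventuallyEq hT (contDiffOn_coordField hW x)
  have hO : {y | w y = coordField W x y} ∩ φ.target ∈ 𝓝 (φ x) := inter_mem hwW hT
  have : CompleteSpace E := FiniteDimensional.complete ℝ E
  obtain ⟨u, hu, hev⟩ := exists_contDiffAt_solution hw (φ x) hO
  have hφx : ContinuousAt φ x := continuousAt_extChartAt x
  -- `γ τ = φ⁻¹ (u (s, y) (τ / s))` is the integral curve from `φ⁻¹ y` on `(-2|s|, 2|s|)`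
  have hcurve : ∀ (s : ℝ) (y : M), s ≠ 0 → y ∈ φ.source → (u (s, φ y) 0 = φ y ∧
      ∀ t ∈ Ioo (-2 : ℝ) 2, u (s, φ y) t ∈ {y | w y = coordField W x y} ∩ φ.target ∧
        HasDerivAt (u (s, φ y)) (s • w (u (s, φ y) t)) t) →
      IsIntegralCurveFrom W y (fun τ => φ.symm (u (s, φ y) (τ / s)))
        ((fun τ => τ / s) ⁻¹' Ioo (-2 : ℝ) 2) := by
    intro s y hs hy ⟨h0, h1⟩
    refine ⟨isOpen_Ioo.preimage (by fun_prop), ?_, by simp, ?_, ?_⟩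
    · rcases lt_or_gt_of_ne hs with hs | hs
      · exact (ordConnected_Ioo).preimage_anti
          (fun a b hab => div_le_div_of_nonpos_of_le hs.le hab)
      · exact (ordConnected_Ioo).preimage_mono
          (fun a b hab => div_le_div_of_nonneg_right hab hs.le)
    · simp only [zero_div, h0, φ.left_inv hy]
    · intro τ hτ
      obtain ⟨⟨hm1, hm2⟩, hd⟩ := h1 (τ / s) hτ
      refine (hasMFDerivAt_extChartAt_symm_comp (p := x) (y := φ.symm (u (s, φ y) (τ / s)))
        (c := fun τ => u (s, φ y) (τ / s)) (φ.map_target hm2) (φ.right_inv hm2).symm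
        (v := W (φ.symm (u (s, φ y) (τ / s)))) ?_).hasMFDerivWithinAt
      have h2 : HasDerivAt (fun τ : ℝ => τ / s) (1 / s) τ := (hasDerivAt_id τ).div_const s
      have h3 := hd.scomp τ h2
      refine h3.congr_deriv ?_
      rw [smul_smul, one_div, inv_mul_cancel₀ hs, one_smul, hm1]
      rfl
  refine ⟨fun q => φ.symm (u (q.1, φ q.2) 1), ?_, ?_⟩
  · have h0 : u (0, φ x) 1 ∈ φ.target :=
      ((hev.self_of_nhds).2 1 (by norm_num)).1.2
    have h1' : ContMDiffAt (𝓘(ℝ, ℝ).prod 𝓘(ℝ, E)) 𝓘(ℝ, E) ∞ (fun q : ℝ × M => φ q.2) (0, x) := by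
      have hφ' : ContMDiffAt 𝓘(ℝ, E) 𝓘(ℝ, E) ∞ φ ((0 : ℝ), x).2 := contMDiffAt_extChartAt
      exact hφ'.comp ((0 : ℝ), x) contMDiffAt_snd
    have h1 : ContMDiffAt (𝓘(ℝ, ℝ).prod 𝓘(ℝ, E)) 𝓘(ℝ, ℝ × E) ∞
        (fun q : ℝ × M => (q.1, φ q.2)) (0, x) :=
      contMDiffAt_fst.prodMk_space h1'
    have h2 := (hu.contMDiffAt (x := ((0 : ℝ), φ x))).comp ((0 : ℝ), x) h1
    have h3 : ContMDiffAt 𝓘(ℝ, E) 𝓘(ℝ, E) ∞ φ.symm (u (0, φ x) 1) :=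
      (contMDiffOn_extChartAt_symm x).contMDiffAt ((isOpen_extChartAt_target x).mem_nhds h0)
    exact h3.comp ((0 : ℝ), x) h2
  · rw [nhds_prod_eq] at hev
    obtain ⟨P, hP, Q, hQ, hPQ⟩ := eventually_prod_iff.1 hev
    obtain ⟨s₀, hs₀, hPs₀⟩ : ∃ s₀ : ℝ, s₀ ≠ 0 ∧ P s₀ := by
      obtain ⟨δ, hδ, hb⟩ := Metric.eventually_nhds_iff.1 hP
      exact ⟨δ / 2, by positivity, hb (by simp [abs_of_pos hδ]; linarith)⟩
    have hev2 : ∀ᶠ q : ℝ × M in 𝓝 ((0 : ℝ), x), P q.1 ∧ Q (φ q.2) ∧ q.2 ∈ φ.source := by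
      have c1 : Tendsto (fun q : ℝ × M => q.1) (𝓝 ((0 : ℝ), x)) (𝓝 0) := continuousAt_fst
      have c2 : Tendsto (fun q : ℝ × M => q.2) (𝓝 ((0 : ℝ), x)) (𝓝 x) := continuousAt_snd
      exact (c1.eventually hP).and (((hφx.tendsto.comp c2).eventually hQ).and
        (c2.eventually (extChartAt_source_mem_nhds x)))
    filter_upwards [hev2] with ⟨s, y⟩ ⟨h1, h2, h3⟩
    by_cases hs : s = 0
    · subst hs
      refine ⟨_, _, hcurve s₀ y hs₀ h3 (hPQ hPs₀ h2), by simp, ?_⟩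
      obtain ⟨h4, h5⟩ := hPQ h1 h2
      have h6 : u (0, φ y) 1 = u (0, φ y) 0 := by
        refine isOpen_Ioo.is_const_of_deriv_eq_zero (s := Ioo (-2 : ℝ) 2) isPreconnected_Ioo
          (fun t ht => (h5 t ht).2.differentiableAt.differentiableWithinAt) (fun t ht => ?_)
          (by norm_num) (by norm_num)
        rw [(h5 t ht).2.deriv]; simp
      simp only [zero_div]
      rw [(hPQ hPs₀ h2).1, h6, h4]
    · refine ⟨_, _, hcurve s y hs h3 (hPQ h1 h2), by norm_num [div_self hs], ?_⟩
      simp [div_self hs]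

/-- Open order-connected sets are reduced to open intervals, for which the uniqueness of integral
curves is available. -/
theorem exists_Ioo_of_ordConnected {J : Set ℝ} (hJ : IsOpen J) (hJ' : J.OrdConnected) {s t : ℝ}
    (hs : s ∈ J) (ht : t ∈ J) : ∃ a b, s ∈ Ioo a b ∧ t ∈ Ioo a b ∧ Ioo a b ⊆ J := by
  obtain ⟨ε, hε, h1⟩ := Metric.isOpen_iff.1 hJ (min s t)
    (by rcases min_choice s t with h | h <;> rwa [h])
  obtain ⟨δ, hδ, h2⟩ := Metric.isOpen_iff.1 hJ (max s t)
    (by rcases max_choice s t with h | h <;> rwa [h])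
  have ha : min s t - ε / 2 ∈ J := h1 (by simp [abs_of_pos hε]; linarith)
  have hb : max s t + δ / 2 ∈ J := h2 (by simp [abs_of_pos hδ]; linarith)
  refine ⟨min s t - ε / 2, max s t + δ / 2, ⟨?_, ?_⟩, ⟨?_, ?_⟩,
    Ioo_subset_Icc_self.trans (hJ'.out ha hb)⟩
  · linarith [min_le_left s t]
  · linarith [le_max_left s t]
  · linarith [min_le_right s t]
  · linarith [le_max_right s t]

variable [T2Space M]

omit [FiniteDimensional ℝ E] in
include hW in
theorem eqOn_of_isMIntegralCurveOn {J : Set ℝ} (hJ : IsOpen J) (hJ' : J.OrdConnected)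
    {α β : ℝ → M} (hα : IsMIntegralCurveOn (I := 𝓘(ℝ, E)) α W J)
    (hβ : IsMIntegralCurveOn (I := 𝓘(ℝ, E)) β W J) {t₀ : ℝ} (ht₀ : t₀ ∈ J)
    (h : α t₀ = β t₀) : EqOn α β J := by
  intro t ht
  obtain ⟨a, b, h1, h2, h3⟩ := exists_Ioo_of_ordConnected hJ hJ' ht₀ ht
  exact isMIntegralCurveOn_Ioo_eqOn_of_contMDiff_boundaryless h1 (hW.of_le (by simp))
    (hα.mono h3) (hβ.mono h3) h h2

omit [FiniteDimensional ℝ E] in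
include hW in
theorem IsIntegralCurveFrom.flow_eq {x : M} {γ : ℝ → M} {J : Set ℝ}
    (h : IsIntegralCurveFrom W x γ J) {t : ℝ} (ht : t ∈ J) : flow W t x = γ t := by
  have hD : (t, x) ∈ flowDomain W := ⟨γ, J, h, ht⟩
  obtain ⟨J', h', ht'⟩ := hD.choose_spec
  rw [flow, dif_pos hD]
  refine eqOn_of_isMIntegralCurveOn hW (h.isOpen.inter h'.isOpen)
    (h.ordConnected.inter h'.ordConnected) (h'.integral.mono inter_subset_right)
    (h.integral.mono inter_subset_left) (t₀ := 0) ⟨h.zero_mem, h'.zero_mem⟩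
    (h'.init.trans h.init.symm) ⟨ht, ht'⟩

omit [FiniteDimensional ℝ E] in
include hW in
/-- The group law of the flow, including the domains of definition. -/
theorem flow_add {s t : ℝ} {x : M} (hs : (s, x) ∈ flowDomain W)
    (ht : (t, flow W s x) ∈ flowDomain W) :
    (s + t, x) ∈ flowDomain W ∧ flow W (s + t) x = flow W t (flow W s x) := by
  obtain ⟨α, J, hα, hsJ⟩ := hs
  obtain ⟨β, J', hβ, htJ⟩ := ht
  simp only at hα hβ hsJ htJ
  have hαs := hα.flow_eq hW hsJ
  set K : Set ℝ := {r | r + -s ∈ J'} with hK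
  have hβ' : IsMIntegralCurveOn (I := 𝓘(ℝ, E)) (β ∘ (· + -s)) W K := hβ.integral.comp_add (-s)
  have hKo : IsOpen K := hβ.isOpen.preimage (by fun_prop)
  have hKc : K.OrdConnected := hβ.ordConnected.preimage_mono fun a b hab => by simpa using hab
  have hsK : s ∈ K := by simpa [hK] using hβ.zero_mem
  have heq : EqOn α (β ∘ (· + -s)) (J ∩ K) :=
    eqOn_of_isMIntegralCurveOn hW (hα.isOpen.inter hKo) (hα.ordConnected.inter hKc)
      (hα.integral.mono inter_subset_left) (hβ'.mono inter_subset_right) ⟨hsJ, hsK⟩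
      (by simp [hβ.init, hαs])
  classical
  let ζ : ℝ → M := fun r => if r ∈ J then α r else β (r + -s)
  have hζJ : EqOn ζ α J := fun r hr => if_pos hr
  have hζK : EqOn ζ (β ∘ (· + -s)) K := fun r hr => by
    by_cases hrJ : r ∈ J
    · rw [hζJ hrJ, heq ⟨hrJ, hr⟩]
    · exact if_neg hrJ
  have hζ : IsIntegralCurveFrom W x ζ (J ∪ K) := by
    refine ⟨hα.isOpen.union hKo, ?_, Or.inl hα.zero_mem, ?_, ?_⟩
    · exact (isPreconnected_iff_ordConnected.1 (IsPreconnected.union s hsJ hsK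
        hα.ordConnected.isPreconnected hKc.isPreconnected))
    · rw [hζJ hα.zero_mem, hα.init]
    · rw [isMIntegralCurveOn_iff_isMIntegralCurveAt (hα.isOpen.union hKo)]
      rintro r (hr | hr)
      · exact (isMIntegralCurveOn_congr hα.integral hζJ).isMIntegralCurveAt
          (hα.isOpen.mem_nhds hr)
      · exact (isMIntegralCurveOn_congr hβ' hζK).isMIntegralCurveAt (hKo.mem_nhds hr)
  have hst : s + t ∈ K := by simpa [hK] using htJ
  refine ⟨⟨ζ, J ∪ K, hζ, Or.inr hst⟩, ?_⟩
  rw [hζ.flow_eq hW (Or.inr hst), hζK hst, hβ.flow_eq hW htJ]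
  simp

omit [FiniteDimensional ℝ E] in
include hW in
theorem flow_neg {t : ℝ} {x : M} (ht : (t, x) ∈ flowDomain W) :
    (-t, flow W t x) ∈ flowDomain W ∧ flow W (-t) (flow W t x) = x := by
  obtain ⟨α, J, hα, htJ⟩ := ht
  simp only at hα htJ
  have h : IsIntegralCurveFrom W (flow W t x) (α ∘ (· + t)) {r | r + t ∈ J} := by
    refine ⟨hα.isOpen.preimage (by fun_prop),
      hα.ordConnected.preimage_mono fun a b hab => by simpa using hab, by simpa using htJ,
      by simp [hα.flow_eq hW htJ], hα.integral.comp_add t⟩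
  have h0 : -t ∈ {r | r + t ∈ J} := by simpa using hα.zero_mem
  exact ⟨⟨_, _, h, h0⟩, by rw [h.flow_eq hW h0]; simp [hα.init]⟩

omit [FiniteDimensional ℝ E] in
include hW in
theorem isMIntegralCurveAt_flow {t : ℝ} {x : M} (ht : (t, x) ∈ flowDomain W) :
    IsMIntegralCurveAt (I := 𝓘(ℝ, E)) (fun r => flow W r x) W t := by
  obtain ⟨α, J, hα, htJ⟩ := ht
  exact (isMIntegralCurveOn_congr hα.integral
    fun r hr => hα.flow_eq hW hr).isMIntegralCurveAt (hα.isOpen.mem_nhds htJ)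

include hW in
theorem flow_zero_mem (x : M) : ((0 : ℝ), x) ∈ flowDomain W ∧ flow W 0 x = x := by
  obtain ⟨Φ, -, hev⟩ := exists_local_flow hW x
  obtain ⟨γ, J, h, h0, -⟩ := hev.self_of_nhds
  exact ⟨⟨γ, J, h, h0⟩, by rw [h.flow_eq hW h0]; exact h.init⟩

include hW in
theorem flow_contMDiffAt_zero (x : M) :
    ContMDiffAt (𝓘(ℝ, ℝ).prod 𝓘(ℝ, E)) 𝓘(ℝ, E) ∞ (fun q : ℝ × M => flow W q.1 q.2) (0, x) ∧
      flowDomain W ∈ 𝓝 ((0 : ℝ), x) := by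
  obtain ⟨Φ, hΦ, hev⟩ := exists_local_flow hW x
  refine ⟨hΦ.congr_of_eventuallyEq ?_, ?_⟩
  · filter_upwards [hev] with q ⟨γ, J, h, h0, h1⟩
    rw [h.flow_eq hW h0, h1]
  · filter_upwards [hev] with q ⟨γ, J, h, h0, h1⟩
    exact ⟨γ, J, h, h0⟩

include hW in
/-- The domain of the flow is open, and the flow is of class `C^n` on it: the set of times near
which this holds for a given initial point is open and closed in the interval of definition of the
integral curve, by the group law. -/
theorem flow_contMDiffAt_nat (n : ℕ) {t : ℝ} {x : M} (ht : (t, x) ∈ flowDomain W) :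
    ∀ᶠ q in 𝓝 (t, x), q ∈ flowDomain W ∧
      ContMDiffAt (𝓘(ℝ, ℝ).prod 𝓘(ℝ, E)) 𝓘(ℝ, E) n (fun q : ℝ × M => flow W q.1 q.2) q := by
  set good : ℝ × M → Prop := fun q => q ∈ flowDomain W ∧
      ContMDiffAt (𝓘(ℝ, ℝ).prod 𝓘(ℝ, E)) 𝓘(ℝ, E) n (fun q : ℝ × M => flow W q.1 q.2) q with hgood
  have hzero : ∀ y : M, ∀ᶠ q in 𝓝 ((0 : ℝ), y), good q := by
    intro y
    obtain ⟨h1, h2⟩ := flow_contMDiffAt_zero hW y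
    have h3 := (contMDiffAt_iff_contMDiffAt_nhds (by simp)).1
      (h1.of_le (m := (n : WithTop ℕ∞)) (by exact_mod_cast le_top))
    filter_upwards [h2, h3] with q hq hq' using ⟨hq, hq'⟩
  obtain ⟨α, J, hα, htJ⟩ := ht
  simp only at hα htJ
  let S : Set ℝ := {r | ∀ᶠ q in 𝓝 (r, x), good q}
  have hS : IsOpen S := by
    rw [isOpen_iff_mem_nhds]
    intro r hr
    have h1 : ∀ᶠ q in 𝓝 (r, x), ∀ᶠ q' in 𝓝 q, good q' := eventually_eventually_nhds.2 hr
    have h2 : Tendsto (fun r' : ℝ => (r', x)) (𝓝 r) (𝓝 (r, x)) := by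
      exact (Continuous.prodMk_left x).tendsto r
    exact h2.eventually h1
  suffices h : J ⊆ S from h htJ
  refine hα.ordConnected.isPreconnected.subset_of_closure_inter_subset hS
    ⟨0, hα.zero_mem, hzero x⟩ ?_
  rintro τ ⟨hτ, hτJ⟩
  -- near `α τ` the flow is good for small times: start from an earlier good time `r` close to `τ`
  have h0 := eventually_eventually_nhds.2 (hzero (α τ))
  have hαc : ContinuousAt α τ := hα.integral.continuousOn.continuousAt (hα.isOpen.mem_nhds hτJ)
  have h1 : Tendsto (fun r : ℝ => (τ - r, α r)) (𝓝 τ) (𝓝 (0, α τ)) := by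
    have h2 : Tendsto (fun r : ℝ => τ - r) (𝓝 τ) (𝓝 (τ - τ)) :=
      (continuous_const.sub continuous_id).tendsto τ
    rw [sub_self] at h2
    exact h2.prodMk_nhds hαc.tendsto
  obtain ⟨r, ⟨h3, hrJ⟩, hrS⟩ : ∃ r, ((∀ᶠ q in 𝓝 (τ - r, α r), good q) ∧ r ∈ J) ∧ r ∈ S := by
    have h4 := mem_closure_iff_frequently.1 hτ
    obtain ⟨r, hr, hr'⟩ := (h4.and_eventually
      ((h1.eventually h0).and (hα.isOpen.mem_nhds hτJ))).exists
    exact ⟨r, hr', hr⟩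
  have hrx : good (r, x) := hrS.self_of_nhds
  have hflow : flow W r x = α r := hα.flow_eq hW hrJ
  have hcont : Tendsto (fun q : ℝ × M => (r, q.2)) (𝓝 (τ, x)) (𝓝 (r, x)) :=
    (continuous_const.prodMk continuous_snd).tendsto' _ _ rfl
  have hcont2 : Tendsto (fun q : ℝ × M => (q.1 - r, flow W r q.2)) (𝓝 (τ, x))
      (𝓝 (τ - r, α r)) := by
    have h5 : Tendsto (fun q : ℝ × M => q.1 - r) (𝓝 (τ, x)) (𝓝 (τ - r)) :=
      (continuous_fst.sub continuous_const).tendsto' _ _ rfl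
    have h6 := hrx.2.continuousAt.tendsto.comp hcont
    rw [Function.comp_def] at h6
    simp only [hflow] at h6
    exact h5.prodMk_nhds h6
  have hev1 := hcont.eventually (eventually_eventually_nhds.2 hrS)
  have hev2 := hcont2.eventually (eventually_eventually_nhds.2 h3)
  have hev3 : ∀ᶠ q : ℝ × M in 𝓝 (τ, x), q ∈ flowDomain W ∧
      flow W q.1 q.2 = flow W (q.1 - r) (flow W r q.2) := by
    filter_upwards [hev1, hev2] with q hq1 hq2
    have := flow_add hW hq1.self_of_nhds.1 hq2.self_of_nhds.1
    simpa using this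
  filter_upwards [hev1, hev2, eventually_eventually_nhds.2 hev3] with q hq1 hq2 hq3
  refine ⟨hq3.self_of_nhds.1, ?_⟩
  have c1 : ContMDiffAt (𝓘(ℝ, ℝ).prod 𝓘(ℝ, E)) (𝓘(ℝ, ℝ).prod 𝓘(ℝ, E)) n
      (fun q : ℝ × M => (r, q.2)) q := contMDiffAt_const.prodMk contMDiffAt_snd
  have c2 : ContMDiffAt (𝓘(ℝ, ℝ).prod 𝓘(ℝ, E)) 𝓘(ℝ, E) n (fun q : ℝ × M => flow W r q.2) q :=
    ContMDiffAt.comp (g := fun q : ℝ × M => flow W q.1 q.2) q hq1.self_of_nhds.2 c1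
  have c3 : ContMDiffAt (𝓘(ℝ, ℝ).prod 𝓘(ℝ, E)) 𝓘(ℝ, ℝ) n (fun q : ℝ × M => q.1 - r) q :=
    contMDiffAt_fst.sub contMDiffAt_const
  have c4 : ContMDiffAt (𝓘(ℝ, ℝ).prod 𝓘(ℝ, E)) 𝓘(ℝ, E) n
      (fun q : ℝ × M => flow W (q.1 - r) (flow W r q.2)) q :=
    ContMDiffAt.comp (g := fun q : ℝ × M => flow W q.1 q.2) q hq2.self_of_nhds.2 (c3.prodMk c2)
  exact c4.congr_of_eventuallyEq (hq3.mono fun q' h => h.2)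

include hW in
theorem isOpen_flowDomain : IsOpen (flowDomain W) :=
  isOpen_iff_mem_nhds.2 fun _ hq => (flow_contMDiffAt_nat hW 0 hq).mono fun _ h => h.1

include hW in
theorem flow_contMDiffAt {q : ℝ × M} (hq : q ∈ flowDomain W) :
    ContMDiffAt (𝓘(ℝ, ℝ).prod 𝓘(ℝ, E)) 𝓘(ℝ, E) ∞ (fun q : ℝ × M => flow W q.1 q.2) q :=
  contMDiffAt_infty.2 fun n => (flow_contMDiffAt_nat hW n hq).self_of_nhds.2

end Flow

/-! ### Lagrangians on a vector space and the Euler–Lagrange equation -/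

section Lagrangian

variable {E : Type*} [NormedAddCommGroup E] [NormedSpace ℝ E]

/-- The partial derivative `∂G/∂x` of a Lagrangian `G(x, v)`. -/
def baseDeriv (G : E × E → ℝ) (q : E × E) : E →L[ℝ] ℝ :=
  (fderiv ℝ G q).comp (ContinuousLinearMap.inl ℝ E E)

/-- The partial derivative `∂G/∂v` of a Lagrangian `G(x, v)`. -/
def fibreDeriv (G : E × E → ℝ) (q : E × E) : E →L[ℝ] ℝ :=
  (fderiv ℝ G q).comp (ContinuousLinearMap.inr ℝ E E)

/-- The Euler–Lagrange equation `(d/dt) ∂G/∂v(c, c') = ∂G/∂x(c, c')` at time `t`. -/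
def IsELAt (G : E × E → ℝ) (c : ℝ → E) (t : ℝ) : Prop :=
  HasDerivAt (fun r => fibreDeriv G (c r, deriv c r)) (baseDeriv G (c t, deriv c t)) t

theorem isELAt_congr {G : E × E → ℝ} {c₁ c₂ : ℝ → E} {t : ℝ} (h : c₁ =ᶠ[𝓝 t] c₂) :
    IsELAt G c₁ t ↔ IsELAt G c₂ t := by
  have h1 : (fun r => fibreDeriv G (c₁ r, deriv c₁ r)) =ᶠ[𝓝 t]
      fun r => fibreDeriv G (c₂ r, deriv c₂ r) := by
    filter_upwards [h, h.deriv] with r h1 h2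
    rw [h1, h2]
  rw [IsELAt, IsELAt, h1.hasDerivAt_iff, h.self_of_nhds, h.deriv_eq]

theorem fderiv_apply_mk (G : E × E → ℝ) (q : E × E) (h k : E) :
    fderiv ℝ G q (h, k) = baseDeriv G q h + fibreDeriv G q k := by
  simp only [baseDeriv, fibreDeriv, ContinuousLinearMap.comp_apply, ContinuousLinearMap.inl_apply,
    ContinuousLinearMap.inr_apply, ← map_add]
  simp

theorem contDiffAt_fibreDeriv {G : E × E → ℝ} {q : E × E} {m n : WithTop ℕ∞}
    (hG : ContDiffAt ℝ n G q) (hmn : m + 1 ≤ n) : ContDiffAt ℝ m (fibreDeriv G) q :=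
  (hG.fderiv_right hmn).clm_comp contDiffAt_const

theorem contDiffAt_baseDeriv {G : E × E → ℝ} {q : E × E} {m n : WithTop ℕ∞}
    (hG : ContDiffAt ℝ n G q) (hmn : m + 1 ≤ n) : ContDiffAt ℝ m (baseDeriv G) q :=
  (hG.fderiv_right hmn).clm_comp contDiffAt_const

theorem hasDerivAt_fibre {G : E × E → ℝ} {x v u : E} (hG : DifferentiableAt ℝ G (x, v)) :
    HasDerivAt (fun τ : ℝ => G (x, v + τ • u)) (fibreDeriv G (x, v) u) 0 := by
  have h1 : HasDerivAt (fun τ : ℝ => (x, v + τ • u)) ((0 : E), u) 0 := by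
    have := ((hasDerivAt_id (0 : ℝ)).smul_const u).const_add v
    simp only [one_smul] at this
    exact (hasDerivAt_const 0 x).prodMk this
  have hG' : DifferentiableAt ℝ G (x, v + (0 : ℝ) • u) := by simpa using hG
  have h2 := hG'.hasFDerivAt.comp_hasDerivAt (0 : ℝ) h1
  simp only [zero_smul, add_zero] at h2
  rw [fderiv_apply_mk, map_zero, zero_add] at h2
  exact h2

theorem hasDerivAt_fst_param {F : Type*} [NormedAddCommGroup F] [NormedSpace ℝ F]
    {Γ : ℝ × ℝ → F} {s t : ℝ} (h : DifferentiableAt ℝ Γ (s, t)) :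
    HasDerivAt (fun s' => Γ (s', t)) (fderiv ℝ Γ (s, t) (1, 0)) s :=
  h.hasFDerivAt.comp_hasDerivAt s ((hasDerivAt_id s).prodMk (hasDerivAt_const s t))

theorem hasDerivAt_snd_param {F : Type*} [NormedAddCommGroup F] [NormedSpace ℝ F]
    {Γ : ℝ × ℝ → F} {s t : ℝ} (h : DifferentiableAt ℝ Γ (s, t)) :
    HasDerivAt (fun t' => Γ (s, t')) (fderiv ℝ Γ (s, t) (0, 1)) t :=
  h.hasFDerivAt.comp_hasDerivAt t ((hasDerivAt_const t s).prodMk (hasDerivAt_id t))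

theorem eventually_differentiableAt {V V' : Type*} [NormedAddCommGroup V] [NormedSpace ℝ V]
    [NormedAddCommGroup V'] [NormedSpace ℝ V'] {f : V → V'} {x : V} (h : ContDiffAt ℝ ∞ f x) :
    ∀ᶠ y in 𝓝 x, DifferentiableAt ℝ f y :=
  ((h.of_le (m := 1) (by simp)).eventually (by simp)).mono fun _ h => h.differentiableAt (by simp)

/-- The mixed partial derivatives of a function of two real variables agree. -/
theorem exists_mixed_partial {F : Type*} [NormedAddCommGroup F] [NormedSpace ℝ F]
    {Γ : ℝ × ℝ → F} {s t : ℝ} (h : ContDiffAt ℝ 2 Γ (s, t)) :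
    ∃ m, HasDerivAt (fun s' => fderiv ℝ Γ (s', t) (0, 1)) m s ∧
      HasDerivAt (fun t' => fderiv ℝ Γ (s, t') (1, 0)) m t := by
  have hd : DifferentiableAt ℝ (fderiv ℝ Γ) (s, t) :=
    (h.fderiv_right (m := 1) (by norm_num)).differentiableAt (by norm_num)
  have hsymm : IsSymmSndFDerivAt ℝ Γ (s, t) := h.isSymmSndFDerivAt (by simp)
  refine ⟨fderiv ℝ (fderiv ℝ Γ) (s, t) (1, 0) (0, 1), ?_, ?_⟩
  · have := (hasDerivAt_fst_param hd).clm_apply (hasDerivAt_const s ((0 : ℝ), (1 : ℝ)))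
    simpa using this
  · have := (hasDerivAt_snd_param hd).clm_apply (hasDerivAt_const t ((1 : ℝ), (0 : ℝ)))
    rw [hsymm.eq]
    simpa using this

/-- The first variation formula at a point: for a variation `Γ(s, t)` with variation field `V` of
the curve `c = Γ(0, ·)`, one has `∂ₛ G = (d/dt)(G_v V) - ((d/dt) G_v - G_x) V`. -/
theorem first_variation {G : E × E → ℝ} {Γ : ℝ × ℝ → E} {t : ℝ} (hΓ : ContDiffAt ℝ 2 Γ (0, t))
    (hG : ContDiffAt ℝ 2 G (Γ (0, t), fderiv ℝ Γ (0, t) (0, 1))) {P' : E →L[ℝ] ℝ}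
    (hP : HasDerivAt (fun r => fibreDeriv G (Γ (0, r), fderiv ℝ Γ (0, r) (0, 1))) P' t) :
    ∃ a, HasDerivAt (fun s => G (Γ (s, t), fderiv ℝ Γ (s, t) (0, 1))) a 0 ∧
      HasDerivAt (fun r => fibreDeriv G (Γ (0, r), fderiv ℝ Γ (0, r) (0, 1))
          (fderiv ℝ Γ (0, r) (1, 0)))
        (a + (P' - baseDeriv G (Γ (0, t), fderiv ℝ Γ (0, t) (0, 1)))
          (fderiv ℝ Γ (0, t) (1, 0))) t := by
  obtain ⟨m, hm1, hm2⟩ := exists_mixed_partial hΓ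
  have hd : DifferentiableAt ℝ Γ (0, t) := hΓ.differentiableAt (by norm_num)
  have hGd : DifferentiableAt ℝ G (Γ (0, t), fderiv ℝ Γ (0, t) (0, 1)) :=
    hG.differentiableAt (by norm_num)
  refine ⟨_, hGd.hasFDerivAt.comp_hasDerivAt (0 : ℝ) ((hasDerivAt_fst_param hd).prodMk hm1), ?_⟩
  refine (hP.clm_apply hm2).congr_deriv ?_
  rw [fderiv_apply_mk]
  simp only [sub_apply]
  ring

theorem contDiffAt_deriv {F : Type*} [NormedAddCommGroup F] [NormedSpace ℝ F] {c : ℝ → F} {t : ℝ}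
    {m n : WithTop ℕ∞} (hc : ContDiffAt ℝ n c t) (hmn : m + 1 ≤ n) :
    ContDiffAt ℝ m (deriv c) t := by
  have : deriv c = fun r => fderiv ℝ c r 1 := by funext r; exact fderiv_apply_one_eq_deriv.symm
  rw [this]
  exact (hc.fderiv_right hmn).clm_apply contDiffAt_const

theorem differentiableAt_fibreDeriv_curve {G : E × E → ℝ} {c : ℝ → E} {t : ℝ}
    (hc : ContDiffAt ℝ 2 c t) (hG : ContDiffAt ℝ 2 G (c t, deriv c t)) :
    DifferentiableAt ℝ (fun r => fibreDeriv G (c r, deriv c r)) t := by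
  have h1 : DifferentiableAt ℝ (fibreDeriv G) (c t, deriv c t) :=
    (contDiffAt_fibreDeriv (m := 1) hG (by norm_num)).differentiableAt (by norm_num)
  have h2 : DifferentiableAt ℝ (fun r => (c r, deriv c r)) t :=
    (hc.differentiableAt (by norm_num)).prodMk
      ((contDiffAt_deriv (m := 1) hc (by norm_num)).differentiableAt (by norm_num))
  exact h1.comp t h2

/-- The Lagrangian `G(x, u - w(x))`, obtained by translating each fibre by a vector field `w`. -/
def shift (G : E × E → ℝ) (w : E → E) (q : E × E) : ℝ := G (q.1, q.2 - w q.1)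

section Shift

variable {G : E × E → ℝ} {w : E → E} {x u : E}

theorem contDiffAt_shift {n : WithTop ℕ∞} (hG : ContDiffAt ℝ n G (x, u - w x))
    (hw : ContDiffAt ℝ n w x) : ContDiffAt ℝ n (shift G w) (x, u) := by
  have h1 : ContDiffAt ℝ n (fun q : E × E => (q.1, q.2 - w q.1)) (x, u) :=
    contDiffAt_fst.prodMk (contDiffAt_snd.sub (ContDiffAt.comp (x, u) hw contDiffAt_fst))
  exact ContDiffAt.comp (x, u) hG h1

theorem fderiv_shift (hG : DifferentiableAt ℝ G (x, u - w x)) (hw : DifferentiableAt ℝ w x)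
    (h k : E) : fderiv ℝ (shift G w) (x, u) (h, k) =
      baseDeriv G (x, u - w x) h + fibreDeriv G (x, u - w x) (k - fderiv ℝ w x h) := by
  have h1 : HasFDerivAt (fun q : E × E => (q.1, q.2 - w q.1))
      ((ContinuousLinearMap.fst ℝ E E).prod ((ContinuousLinearMap.snd ℝ E E) -
        (fderiv ℝ w x).comp (ContinuousLinearMap.fst ℝ E E))) (x, u) :=
    hasFDerivAt_fst.prodMk (hasFDerivAt_snd.sub
      (HasFDerivAt.comp (x, u) hw.hasFDerivAt hasFDerivAt_fst))
  have h2 : HasFDerivAt (shift G w) _ (x, u) := HasFDerivAt.comp (x, u) hG.hasFDerivAt h1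
  rw [h2.fderiv, ← fderiv_apply_mk]
  rfl

theorem fibreDeriv_shift (hG : DifferentiableAt ℝ G (x, u - w x)) (hw : DifferentiableAt ℝ w x) :
    fibreDeriv (shift G w) (x, u) = fibreDeriv G (x, u - w x) := by
  ext k
  have := fderiv_shift hG hw 0 k
  rw [fderiv_apply_mk] at this
  simpa using this

theorem baseDeriv_shift (hG : DifferentiableAt ℝ G (x, u - w x)) (hw : DifferentiableAt ℝ w x)
    (h : E) : baseDeriv (shift G w) (x, u) h =
      baseDeriv G (x, u - w x) h - fibreDeriv G (x, u - w x) (fderiv ℝ w x h) := by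
  have := fderiv_shift hG hw h 0
  rw [fderiv_apply_mk] at this
  simpa [sub_eq_add_neg] using this

end Shift

/-- Transformation of the Euler–Lagrange expression `Z = (d/dt) G_v - G_x` under the time-dependent
change of variables `Ψ(t, ·)` given by the flow of `w`, when this flow rescales the Lagrangian by
`e^{-σt}`. With `D = ∂Ψ/∂x`, it reads
`((d/dt) G₂_v - G₂_x + G₂_v ∘ dw + σ G₂_v) ∘ D = e^{-σt} Z₁`.
It is obtained by comparing the first variations of `c + s η` and of `Ψ(t, c + s η)`. -/
theorem flow_transport {G₁ G₂ : E × E → ℝ} {Ψ : ℝ × E → E} {w : E → E} {c : ℝ → E} {t σ : ℝ}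
    (hc : ContDiffAt ℝ ∞ c t) (hΨ : ContDiffAt ℝ ∞ Ψ (t, c t))
    (hw : ContDiffAt ℝ ∞ w (Ψ (t, c t)))
    (hG₁ : ContDiffAt ℝ ∞ G₁ (c t, deriv c t))
    (hG₂ : ContDiffAt ℝ ∞ G₂ (Ψ (t, c t), fderiv ℝ Ψ (t, c t) (0, deriv c t)))
    (hflow : ∀ᶠ q in 𝓝 (t, c t), fderiv ℝ Ψ q (1, 0) = w (Ψ q))
    (hhom : ∀ᶠ z : ℝ × E × E in 𝓝 (t, c t, deriv c t),
      G₂ (Ψ (z.1, z.2.1), fderiv ℝ Ψ (z.1, z.2.1) (0, z.2.2)) =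
        Real.exp (-(σ * z.1)) * G₁ (z.2.1, z.2.2))
    {P₁ P₂ : E →L[ℝ] ℝ} (hP₁ : HasDerivAt (fun r => fibreDeriv G₁ (c r, deriv c r)) P₁ t)
    (hP₂ : HasDerivAt (fun r => fibreDeriv G₂ (Ψ (r, c r), fderiv ℝ Ψ (r, c r) (0, deriv c r)))
      P₂ t) (η : E) :
    (P₂ - baseDeriv G₂ (Ψ (t, c t), fderiv ℝ Ψ (t, c t) (0, deriv c t)))
        (fderiv ℝ Ψ (t, c t) (0, η)) +
      fibreDeriv G₂ (Ψ (t, c t), fderiv ℝ Ψ (t, c t) (0, deriv c t))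
        (fderiv ℝ w (Ψ (t, c t)) (fderiv ℝ Ψ (t, c t) (0, η)) +
          σ • fderiv ℝ Ψ (t, c t) (0, η)) =
      Real.exp (-(σ * t)) * (P₁ - baseDeriv G₁ (c t, deriv c t)) η := by
  have two_le : (2 : WithTop ℕ∞) ≤ ∞ := ENat.LEInfty.out
  let Γ : ℝ × ℝ → E := fun q => c q.2 + q.1 • η
  let Γ₂ : ℝ × ℝ → E := fun q => Ψ (q.2, Γ q)
  have hΓ0 : ∀ r, Γ (0, r) = c r := fun r => by simp [Γ]
  have hΓ : ContDiffAt ℝ ∞ Γ (0, t) :=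
    (ContDiffAt.comp ((0 : ℝ), t) hc contDiffAt_snd).add
      (contDiffAt_fst.smul contDiffAt_const)
  have hpair : ContDiffAt ℝ ∞ (fun q : ℝ × ℝ => (q.2, Γ q)) (0, t) := contDiffAt_snd.prodMk hΓ
  have hΨ' : ContDiffAt ℝ ∞ Ψ (t, Γ (0, t)) := by rwa [hΓ0]
  have hΓ₂ : ContDiffAt ℝ ∞ Γ₂ (0, t) := ContDiffAt.comp ((0 : ℝ), t) hΨ' hpair
  -- the curve `c` and the map `Ψ` are differentiable near the points of interest
  have hcd : ∀ᶠ r in 𝓝 t, DifferentiableAt ℝ c r :=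
    eventually_differentiableAt hc
  have hΨd : ∀ᶠ q in 𝓝 (t, c t), DifferentiableAt ℝ Ψ q :=
    eventually_differentiableAt hΨ
  have tsnd : Tendsto (fun q : ℝ × ℝ => q.2) (𝓝 ((0 : ℝ), t)) (𝓝 t) := continuousAt_snd
  have tpair : Tendsto (fun q : ℝ × ℝ => (q.2, Γ q)) (𝓝 ((0 : ℝ), t)) (𝓝 (t, c t)) := by
    have := hpair.continuousAt.tendsto
    simpa only [hΓ0] using this
  have hΓderiv : ∀ q : ℝ × ℝ, DifferentiableAt ℝ c q.2 → DifferentiableAt ℝ Γ q ∧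
      ∀ a b : ℝ, fderiv ℝ Γ q (a, b) = b • deriv c q.2 + a • η := by
    intro q hq
    have h1 : HasFDerivAt Γ (((ContinuousLinearMap.toSpanSingleton ℝ (deriv c q.2)).comp
        (ContinuousLinearMap.snd ℝ ℝ ℝ)) + (ContinuousLinearMap.fst ℝ ℝ ℝ).smulRight η) q :=
      (HasFDerivAt.comp q hq.hasDerivAt.hasFDerivAt hasFDerivAt_snd).add
        (hasFDerivAt_fst.smul_const η)
    exact ⟨h1.differentiableAt, fun a b => by rw [h1.fderiv]; simp⟩
  have hΓ₂deriv : ∀ᶠ q in 𝓝 ((0 : ℝ), t),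
      fderiv ℝ Γ₂ q (0, 1) = w (Γ₂ q) + fderiv ℝ Ψ (q.2, Γ q) (0, deriv c q.2) ∧
      fderiv ℝ Γ₂ q (1, 0) = fderiv ℝ Ψ (q.2, Γ q) (0, η) := by
    filter_upwards [tsnd.eventually hcd, tpair.eventually hΨd, tpair.eventually hflow]
      with q h1 h2 h3
    obtain ⟨h4, h5⟩ := hΓderiv q h1
    have h6 : HasFDerivAt Γ₂ ((fderiv ℝ Ψ (q.2, Γ q)).comp
        ((ContinuousLinearMap.snd ℝ ℝ ℝ).prod (fderiv ℝ Γ q))) q :=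
      HasFDerivAt.comp q h2.hasFDerivAt (hasFDerivAt_snd.prodMk h4.hasFDerivAt)
    constructor
    · rw [h6.fderiv, ← h3, ← map_add]
      simp [h5]
    · rw [h6.fderiv]
      simp [h5]
  have t0 : Tendsto (fun r : ℝ => ((0 : ℝ), r)) (𝓝 t) (𝓝 (0, t)) :=
    (Continuous.prodMk_right 0).tendsto t
  have ts : Tendsto (fun s : ℝ => (s, t)) (𝓝 0) (𝓝 (0, t)) :=
    (Continuous.prodMk_left t).tendsto 0
  have hΓ₂0 : ∀ r, Γ₂ (0, r) = Ψ (r, c r) := fun r => by simp [Γ₂, hΓ0]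
  have hx : fderiv ℝ Γ₂ (0, t) (0, 1) - w (Γ₂ (0, t)) =
      fderiv ℝ Ψ (t, c t) (0, deriv c t) := by
    rw [hΓ₂deriv.self_of_nhds.1, hΓ0]; simp
  have hwt : ContDiffAt ℝ ∞ w (Γ₂ (0, t)) := by rwa [hΓ₂0]
  have hG₂t : ContDiffAt ℝ ∞ G₂ (Γ₂ (0, t), fderiv ℝ Γ₂ (0, t) (0, 1) - w (Γ₂ (0, t))) := by
    rwa [hx, hΓ₂0]
  have hGs : ContDiffAt ℝ ∞ (shift G₂ w) (Γ₂ (0, t), fderiv ℝ Γ₂ (0, t) (0, 1)) :=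
    contDiffAt_shift hG₂t hwt
  -- along the curve, the fibre derivatives of `G₂` and of its translate agree
  have hcurve₂ : ContinuousAt (fun r => (Ψ (r, c r), fderiv ℝ Ψ (r, c r) (0, deriv c r))) t := by
    have h1 : ContinuousAt (fun r => (r, c r)) t := continuousAt_id.prodMk hc.continuousAt
    have h2 : ContinuousAt (fderiv ℝ Ψ) (t, c t) :=
      (hΨ.fderiv_right (m := 0) (by simp)).continuousAt
    have h3 : ContinuousAt (deriv c) t := (contDiffAt_deriv (m := 0) hc (by simp)).continuousAt
    exact (ContinuousAt.comp (x := t) hΨ.continuousAt h1).prodMk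
      ((ContinuousAt.comp (x := t) h2 h1).clm_apply (continuousAt_const.prodMk h3))
  have hG₂d : ∀ᶠ r in 𝓝 t,
      DifferentiableAt ℝ G₂ (Ψ (r, c r), fderiv ℝ Ψ (r, c r) (0, deriv c r)) :=
    hcurve₂.tendsto.eventually (eventually_differentiableAt hG₂)
  have hwd : ∀ᶠ r in 𝓝 t, DifferentiableAt ℝ w (Ψ (r, c r)) := by
    have h1 : ContinuousAt (fun r => Ψ (r, c r)) t :=
      ContinuousAt.comp (x := t) hΨ.continuousAt (continuousAt_id.prodMk hc.continuousAt)
    exact h1.tendsto.eventually (eventually_differentiableAt hw)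
  have hfib : ∀ᶠ r in 𝓝 t, fibreDeriv (shift G₂ w) (Γ₂ (0, r), fderiv ℝ Γ₂ (0, r) (0, 1)) =
      fibreDeriv G₂ (Ψ (r, c r), fderiv ℝ Ψ (r, c r) (0, deriv c r)) := by
    filter_upwards [hG₂d, hwd, t0.eventually hΓ₂deriv] with r h1 h2 h3
    have h4 : fderiv ℝ Γ₂ (0, r) (0, 1) - w (Γ₂ (0, r)) =
        fderiv ℝ Ψ (r, c r) (0, deriv c r) := by rw [h3.1, hΓ0]; simp
    rw [fibreDeriv_shift, h4, hΓ₂0]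
    · rwa [h4, hΓ₂0]
    · rwa [hΓ₂0]
  have hPs : HasDerivAt (fun r => fibreDeriv (shift G₂ w) (Γ₂ (0, r), fderiv ℝ Γ₂ (0, r) (0, 1)))
      P₂ t := hP₂.congr_of_eventuallyEq hfib
  have hΓt : fderiv ℝ Γ (0, t) (0, 1) = deriv c t := by
    rw [(hΓderiv (0, t) hcd.self_of_nhds).2]; simp
  have hP₁' : HasDerivAt (fun r => fibreDeriv G₁ (Γ (0, r), fderiv ℝ Γ (0, r) (0, 1))) P₁ t := by
    refine hP₁.congr_of_eventuallyEq ?_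
    filter_upwards [hcd] with r hr
    rw [(hΓderiv (0, r) hr).2, hΓ0]; simp
  obtain ⟨a₁, ha₁, hb₁⟩ := first_variation (hΓ.of_le two_le) (G := G₁)
    (by rw [hΓt, hΓ0]; exact hG₁.of_le two_le) hP₁'
  obtain ⟨a₂, ha₂, hb₂⟩ := first_variation (hΓ₂.of_le two_le) (hGs.of_le two_le) hPs
  -- the two Lagrangians differ by the factor `e^{-σt}` along the whole variation, so do the
  -- derivatives of their values in the variation parameter
  have ha : a₂ = Real.exp (-(σ * t)) * a₁ := by
    refine ha₂.unique ((ha₁.const_mul (Real.exp (-(σ * t)))).congr_of_eventuallyEq ?_)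
    have h1 : Tendsto (fun s : ℝ => (t, Γ (s, t), deriv c t)) (𝓝 0)
        (𝓝 (t, c t, deriv c t)) := by
      have h2 : Tendsto (fun s : ℝ => Γ (s, t)) (𝓝 0) (𝓝 (c t)) := by
        have h3 := hΓ.continuousAt.tendsto.comp ts
        rw [hΓ0] at h3
        exact h3
      exact tendsto_const_nhds.prodMk_nhds (h2.prodMk_nhds tendsto_const_nhds)
    filter_upwards [h1.eventually hhom, ts.eventually hΓ₂deriv] with s h3 h4
    rw [shift, h4.1, add_sub_cancel_left, (hΓderiv (s, t) hcd.self_of_nhds).2]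
    simpa using h3
  -- differentiating the homothety relation in the fibre direction
  have hvert : ∀ᶠ r in 𝓝 t, fibreDeriv G₂ (Ψ (r, c r), fderiv ℝ Ψ (r, c r) (0, deriv c r))
        (fderiv ℝ Ψ (r, c r) (0, η)) =
        Real.exp (-(σ * r)) * fibreDeriv G₁ (c r, deriv c r) η := by
    have tc : Tendsto (fun r : ℝ => (r, c r, deriv c r)) (𝓝 t) (𝓝 (t, c t, deriv c t)) :=
      tendsto_id.prodMk_nhds (hc.continuousAt.tendsto.prodMk_nhds
        (contDiffAt_deriv (m := 0) hc (by simp)).continuousAt.tendsto)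
    have hG₁d : ∀ᶠ r in 𝓝 t, DifferentiableAt ℝ G₁ (c r, deriv c r) := by
      have tc' : Tendsto (fun r : ℝ => (c r, deriv c r)) (𝓝 t) (𝓝 (c t, deriv c t)) :=
        hc.continuousAt.tendsto.prodMk_nhds
          (contDiffAt_deriv (m := 0) hc (by simp)).continuousAt.tendsto
      exact tc'.eventually (eventually_differentiableAt hG₁)
    filter_upwards [tc.eventually (eventually_eventually_nhds.2 hhom), hG₁d, hG₂d] with r h6 h7 h8
    have h9 := hasDerivAt_fibre (u := fderiv ℝ Ψ (r, c r) (0, η)) h8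
    have h10 := (hasDerivAt_fibre (u := η) h7).const_mul (Real.exp (-(σ * r)))
    have h11 : Tendsto (fun τ : ℝ => (r, c r, deriv c r + τ • η)) (𝓝 0)
        (𝓝 (r, c r, deriv c r)) := by
      have : Continuous fun τ : ℝ => (r, c r, deriv c r + τ • η) := by fun_prop
      simpa using this.tendsto 0
    refine h9.unique (h10.congr_of_eventuallyEq ?_)
    filter_upwards [h11.eventually h6] with τ h13
    rw [← h13, ← map_smul, ← map_add]
    simp
  have hb : a₂ + (P₂ - baseDeriv (shift G₂ w) (Γ₂ (0, t), fderiv ℝ Γ₂ (0, t) (0, 1)))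
        (fderiv ℝ Γ₂ (0, t) (1, 0)) =
      (-σ * Real.exp (-(σ * t))) * fibreDeriv G₁ (c t, deriv c t) η + Real.exp (-(σ * t)) *
        (a₁ + (P₁ - baseDeriv G₁ (Γ (0, t), fderiv ℝ Γ (0, t) (0, 1)))
          (fderiv ℝ Γ (0, t) (1, 0))) := by
    refine hb₂.unique ?_
    have hexp : HasDerivAt (fun r : ℝ => Real.exp (-(σ * r))) (-σ * Real.exp (-(σ * t))) t := by
      have := (((hasDerivAt_id t).const_mul σ).neg).exp
      simpa [mul_comm] using this
    have h1 := hexp.mul hb₁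
    have h2 : fibreDeriv G₁ (Γ (0, t), fderiv ℝ Γ (0, t) (0, 1)) (fderiv ℝ Γ (0, t) (1, 0)) =
        fibreDeriv G₁ (c t, deriv c t) η := by
      rw [hΓt, hΓ0, (hΓderiv (0, t) hcd.self_of_nhds).2]; simp
    rw [h2] at h1
    refine h1.congr_of_eventuallyEq ?_
    filter_upwards [hfib, hcd, t0.eventually hΓ₂deriv, hvert] with r h3 h4 h5 h12
    rw [h3, h5.2, hΓ0, h12, Pi.mul_apply, (hΓderiv (0, r) h4).2, (hΓderiv (0, r) h4).2, hΓ0]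
    simp
  have hD : fderiv ℝ Γ₂ (0, t) (1, 0) = fderiv ℝ Ψ (t, c t) (0, η) := by
    rw [hΓ₂deriv.self_of_nhds.2, hΓ0]
  have hη : fderiv ℝ Γ (0, t) (1, 0) = η := by
    rw [(hΓderiv (0, t) hcd.self_of_nhds).2]; simp
  rw [hD, hη, hΓt, hΓ0, sub_apply, baseDeriv_shift (hG₂t.differentiableAt (by simp))
    (hwt.differentiableAt (by simp)), hx, hΓ₂0, ha] at hb
  simp only [sub_apply, map_add, map_smul, smul_eq_mul] at hb ⊢
  rw [hvert.self_of_nhds]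
  linear_combination hb

/-- The derivative of a Lagrangian `G'` given implicitly by `G(x, u - G'(x, u) w(x)) = G'(x, u)`, at
a vector with `G' = 1`. -/
theorem fderiv_zermelo {G G' : E × E → ℝ} {w : E → E} {x u : E}
    (hG : DifferentiableAt ℝ G (x, u - w x)) (hw : DifferentiableAt ℝ w x)
    (hG' : DifferentiableAt ℝ G' (x, u)) (hone : G' (x, u) = 1)
    (hrel : ∀ᶠ q in 𝓝 (x, u), G (q.1, q.2 - G' q • w q.1) = G' q) (h k : E) :
    fderiv ℝ G' (x, u) (h, k) * (1 + fibreDeriv G (x, u - w x) (w x)) =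
      baseDeriv G (x, u - w x) h + fibreDeriv G (x, u - w x) (k - fderiv ℝ w x h) := by
  have hw' : HasFDerivAt (fun q : E × E => w q.1)
      ((fderiv ℝ w x).comp (ContinuousLinearMap.fst ℝ E E)) (x, u) :=
    HasFDerivAt.comp (x, u) hw.hasFDerivAt hasFDerivAt_fst
  have h1 : HasFDerivAt (fun q : E × E => (q.1, q.2 - G' q • w q.1)) _ (x, u) :=
    hasFDerivAt_fst.prodMk (hasFDerivAt_snd.sub (hG'.hasFDerivAt.smul hw'))
  have hG1 : DifferentiableAt ℝ G (x, u - G' (x, u) • w x) := by rwa [hone, one_smul]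
  have h2 : HasFDerivAt G' _ (x, u) :=
    (HasFDerivAt.comp (x, u) hG1.hasFDerivAt h1).congr_of_eventuallyEq
      (hrel.mono fun q hq => hq.symm)
  have h3 := congrArg (fun A : E × E →L[ℝ] ℝ => A (h, k)) h2.fderiv
  simp only [hone, one_smul] at h3
  have h4 : fderiv ℝ G' (x, u) (h, k) = fderiv ℝ G (x, u - w x)
      (h, k - (fderiv ℝ w x h + fderiv ℝ G' (x, u) (h, k) • w x)) := h3
  rw [fderiv_apply_mk G] at h4
  simp only [map_sub, map_add, map_smul, smul_eq_mul] at h4 ⊢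
  linear_combination h4

/-- Transversality: the factor `1 + G_v(w)` does not vanish. -/
theorem zermelo_transversal {G G' : E × E → ℝ} {w : E → E} {x u : E}
    (hG : DifferentiableAt ℝ G (x, u - w x)) (hw : DifferentiableAt ℝ w x)
    (hG' : DifferentiableAt ℝ G' (x, u)) (hone : G' (x, u) = 1)
    (hrel : ∀ᶠ q in 𝓝 (x, u), G (q.1, q.2 - G' q • w q.1) = G' q) :
    1 + fibreDeriv G (x, u - w x) (w x) ≠ 0 := by
  intro h0
  have h1 := fderiv_zermelo hG hw hG' hone hrel 0 (w x)
  rw [h0] at h1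
  simp only [mul_zero, map_zero, sub_zero, zero_add] at h1
  rw [← h1] at h0
  simp at h0

section ZermeloCurve

variable {G G' : E × E → ℝ} {w : E → E} {x : ℝ → E} {t σ : ℝ}

/-- Derivative of the transversality factor `1 + G_v(w)` along a curve, for an infinitesimally
homothetic field `w`. -/
theorem hasDerivAt_transversality (hx : DifferentiableAt ℝ x t) (hw : DifferentiableAt ℝ w (x t))
    (hinf : baseDeriv G (x t, deriv x t - w (x t)) (w (x t)) +
      fibreDeriv G (x t, deriv x t - w (x t)) (fderiv ℝ w (x t) (deriv x t - w (x t))) = -σ)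
    {P : E →L[ℝ] ℝ} (hP : HasDerivAt (fun r => fibreDeriv G (x r, deriv x r - w (x r))) P t) :
    HasDerivAt (fun r => 1 + fibreDeriv G (x r, deriv x r - w (x r)) (w (x r)))
      (((P - baseDeriv G (x t, deriv x t - w (x t))) (w (x t)) +
        fibreDeriv G (x t, deriv x t - w (x t)) (fderiv ℝ w (x t) (w (x t)) + σ • w (x t))) -
        σ * (1 + fibreDeriv G (x t, deriv x t - w (x t)) (w (x t)))) t := by
  have h1 : HasDerivAt (fun r => w (x r)) (fderiv ℝ w (x t) (deriv x t)) t :=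
    hw.hasFDerivAt.comp_hasDerivAt t hx.hasDerivAt
  refine ((hP.clm_apply h1).const_add 1).congr_deriv ?_
  simp only [sub_apply, map_sub, map_add, map_smul, smul_eq_mul] at hinf ⊢
  linear_combination hinf

/-- The Euler–Lagrange equation of the translated Lagrangian `G'`, for a curve with `G' = 1`, in
terms of `G` and of the infinitesimally homothetic field `w`.
With `p = G_v` and `N = 1 + p(w)`, the implicit relation gives `G'_v = p / N` and
`G'_x = (G_x - p ∘ dw) / N`, so that the equation reads `N Z = Z(w) p`, where `Z` is the expression
on the right. Evaluating it at `w` gives `Z(w) = 0`, hence `Z = 0`. -/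
theorem isELAt_zermelo_iff (hx : ContDiffAt ℝ ∞ x t) (hw : ContDiffAt ℝ ∞ w (x t))
    (hG : ContDiffAt ℝ ∞ G (x t, deriv x t - w (x t)))
    (hG' : ContDiffAt ℝ ∞ G' (x t, deriv x t))
    (hrel : ∀ᶠ q in 𝓝 (x t, deriv x t), G (q.1, q.2 - G' q • w q.1) = G' q)
    (hone : ∀ᶠ r in 𝓝 t, G' (x r, deriv x r) = 1)
    (hinf : baseDeriv G (x t, deriv x t - w (x t)) (w (x t)) +
      fibreDeriv G (x t, deriv x t - w (x t)) (fderiv ℝ w (x t) (deriv x t - w (x t))) = -σ)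
    {P : E →L[ℝ] ℝ} (hP : HasDerivAt (fun r => fibreDeriv G (x r, deriv x r - w (x r))) P t) :
    IsELAt G' x t ↔ ∀ k, (P - baseDeriv G (x t, deriv x t - w (x t))) k +
      fibreDeriv G (x t, deriv x t - w (x t)) (fderiv ℝ w (x t) k + σ • k) = 0 := by
  set p : ℝ → E →L[ℝ] ℝ := fun r => fibreDeriv G (x r, deriv x r - w (x r)) with hp
  set N : ℝ → ℝ := fun r => 1 + p r (w (x r)) with hN
  have tc : Tendsto (fun r => (x r, deriv x r)) (𝓝 t) (𝓝 (x t, deriv x t)) :=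
    hx.continuousAt.tendsto.prodMk_nhds
      (contDiffAt_deriv (m := 0) hx (by simp)).continuousAt.tendsto
  have tv : Tendsto (fun r => (x r, deriv x r - w (x r))) (𝓝 t)
      (𝓝 (x t, deriv x t - w (x t))) :=
    hx.continuousAt.tendsto.prodMk_nhds
      ((contDiffAt_deriv (m := 0) hx (by simp)).continuousAt.sub
        (ContinuousAt.comp (x := t) hw.continuousAt hx.continuousAt)).tendsto
  have hGd : ∀ᶠ q in 𝓝 (x t, deriv x t - w (x t)), DifferentiableAt ℝ G q :=
    eventually_differentiableAt hG
  have hGd' : ∀ᶠ q in 𝓝 (x t, deriv x t), DifferentiableAt ℝ G' q :=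
    eventually_differentiableAt hG'
  have hwd : ∀ᶠ y in 𝓝 (x t), DifferentiableAt ℝ w y :=
    eventually_differentiableAt hw
  have key : ∀ᶠ r in 𝓝 t, N r ≠ 0 ∧ ∀ h k, fderiv ℝ G' (x r, deriv x r) (h, k) * N r =
      baseDeriv G (x r, deriv x r - w (x r)) h + p r (k - fderiv ℝ w (x r) h) := by
    filter_upwards [tv.eventually hGd, tc.eventually hGd', hx.continuousAt.tendsto.eventually hwd,
      hone, tc.eventually (eventually_eventually_nhds.2 hrel)] with r h1 h2 h3 h4 h5
    exact ⟨zermelo_transversal h1 h3 h2 h4 h5, fderiv_zermelo h1 h3 h2 h4 h5⟩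
  have hfib : ∀ᶠ r in 𝓝 t, fibreDeriv G' (x r, deriv x r) = (N r)⁻¹ • p r := by
    filter_upwards [key] with r hr
    ext k
    have h1 := hr.2 0 k
    rw [fderiv_apply_mk] at h1
    simp only [map_zero, zero_add, sub_zero] at h1
    simp only [smul_apply, smul_eq_mul]
    field_simp [hr.1]
    linear_combination h1
  have hbase : ∀ h, baseDeriv G' (x t, deriv x t) h = (N t)⁻¹ *
      (baseDeriv G (x t, deriv x t - w (x t)) h - p t (fderiv ℝ w (x t) h)) := by
    intro h
    obtain ⟨h0, h2⟩ := key.self_of_nhds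
    have h1 := h2 h 0
    rw [fderiv_apply_mk] at h1
    simp only [map_zero, add_zero, zero_sub, map_neg] at h1
    field_simp
    linear_combination h1
  have hNt : N t ≠ 0 := key.self_of_nhds.1
  have hNd := hasDerivAt_transversality (hx.differentiableAt (by simp))
    (hw.differentiableAt (by simp)) hinf hP
  set A : ℝ := (P - baseDeriv G (x t, deriv x t - w (x t))) (w (x t)) +
    p t (fderiv ℝ w (x t) (w (x t)) + σ • w (x t)) with hA
  have hder : HasDerivAt (fun r => fibreDeriv G' (x r, deriv x r))
      ((N t)⁻¹ • P + (-(A - σ * N t) / N t ^ 2) • p t) t :=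
    ((hNd.inv hNt).smul hP).congr_of_eventuallyEq hfib
  have hZ : ∀ k, (P - baseDeriv G (x t, deriv x t - w (x t))) k + p t (fderiv ℝ w (x t) k + σ • k) =
      P k - baseDeriv G (x t, deriv x t - w (x t)) k + p t (fderiv ℝ w (x t) k) + σ * p t k := by
    intro k
    simp only [sub_apply, map_add, map_smul, smul_eq_mul]
    ring
  have hiff : IsELAt G' x t ↔ ∀ k, N t * ((P - baseDeriv G (x t, deriv x t - w (x t))) k +
      p t (fderiv ℝ w (x t) k + σ • k)) = A * p t k := by
    rw [IsELAt]
    constructor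
    · intro h k
      have h1 := congrArg (fun A : E →L[ℝ] ℝ => A k) (hder.unique h)
      simp only [add_apply, smul_apply, smul_eq_mul, hbase] at h1
      rw [hZ k]
      field_simp at h1
      linear_combination h1
    · intro h
      refine hder.congr_deriv ?_
      ext k
      have h1 := h k
      simp only [add_apply, smul_apply, smul_eq_mul, hbase]
      rw [hZ k] at h1
      field_simp
      linear_combination h1
  rw [hiff]
  constructor
  · intro h
    -- at `k = w`, the relation reads `(1 + p(w)) A = A p(w)`
    have h1 := h (w (x t))
    have h2 : A = 0 := by
      rw [← hA] at h1
      simp only [hN] at h1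
      linear_combination h1
    intro k
    have h3 := h k
    rw [h2, zero_mul] at h3
    exact (mul_eq_zero.1 h3).resolve_left hNt
  · intro h k
    have h1 : A = 0 := h (w (x t))
    rw [h k, h1]
    ring

end ZermeloCurve

end Lagrangian

/-! ### Pseudo-Finsler metrics on a vector space -/

section LocalFinsler

theorem one_add_one_le_infty : (1 : WithTop ℕ∞) + 1 ≤ ∞ := by
  rw [one_add_one_eq_two]
  exact ENat.LEInfty.out

variable {E : Type*} [NormedAddCommGroup E] [NormedSpace ℝ E]

/-- `G` is a pseudo-Finsler metric on an open set of a vector space, with domain `U ⊆ E × E`. This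
is the coordinate expression of a `PseudoFinsler` structure, without the conditions that `G` be
positive and that the fibres be connected, which play no role here. -/
structure IsFinslerOn (G : E × E → ℝ) (U : Set (E × E)) : Prop where
  isOpen : IsOpen U
  smooth : ContDiffOn ℝ ∞ G U
  conic : ∀ (x v : E) (c : ℝ), 0 < c → (x, v) ∈ U → (x, c • v) ∈ U
  homogeneous : ∀ (x v : E) (c : ℝ), 0 < c → (x, v) ∈ U → G (x, c • v) = c * G (x, v)
  nondegenerate : ∀ (x v : E), (x, v) ∈ U → ∀ u : E,
    (∀ w : E, deriv (fun t : ℝ => deriv (fun s : ℝ => G (x, v + t • u + s • w) ^ 2) 0) 0 = 0) →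
      u = 0

namespace IsFinslerOn

variable {G : E × E → ℝ} {U : Set (E × E)}

theorem contDiffAt (h : IsFinslerOn G U) {q : E × E} (hq : q ∈ U) : ContDiffAt ℝ ∞ G q :=
  h.smooth.contDiffAt (h.isOpen.mem_nhds hq)

theorem differentiableAt (h : IsFinslerOn G U) {q : E × E} (hq : q ∈ U) :
    DifferentiableAt ℝ G q :=
  (h.contDiffAt hq).differentiableAt (by simp)

/-- Euler's relation. -/
theorem fibreDeriv_self (h : IsFinslerOn G U) {x v : E} (hq : (x, v) ∈ U) :
    fibreDeriv G (x, v) v = G (x, v) := by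
  have h1 := hasDerivAt_fibre (u := v) (h.differentiableAt hq)
  have h2 : HasDerivAt (fun τ : ℝ => (1 + τ) * G (x, v)) (1 * G (x, v)) 0 :=
    ((hasDerivAt_id (0 : ℝ)).const_add 1).mul_const _
  rw [one_mul] at h2
  refine h1.unique (h2.congr_of_eventuallyEq ?_)
  filter_upwards [Ioi_mem_nhds (show (-1 : ℝ) < 0 by norm_num)] with τ hτ
  have : (-1 : ℝ) < τ := hτ
  rw [← h.homogeneous x v (1 + τ) (by linarith) hq, add_smul, one_smul]

theorem fderiv_smul (h : IsFinslerOn G U) {x v : E} (hq : (x, v) ∈ U) {c : ℝ} (hc : 0 < c)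
    (a b : E) : fderiv ℝ G (x, c • v) (a, c • b) = c * fderiv ℝ G (x, v) (a, b) := by
  have h1 : HasFDerivAt (fun q : E × E => (q.1, c • q.2)) ((ContinuousLinearMap.fst ℝ E E).prod
      (c • ContinuousLinearMap.snd ℝ E E)) (x, v) :=
    hasFDerivAt_fst.prodMk (hasFDerivAt_snd.const_smul c)
  have h2 := HasFDerivAt.comp (x, v) (h.differentiableAt (h.conic x v c hc hq)).hasFDerivAt h1
  have h3 := (h.differentiableAt hq).hasFDerivAt.const_mul c
  have h4 := h2.unique (h3.congr_of_eventuallyEq (by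
    filter_upwards [h.isOpen.mem_nhds hq] with q hq'
    exact h.homogeneous q.1 q.2 c hc hq'))
  exact congrArg (fun A : E × E →L[ℝ] ℝ => A (a, b)) h4

theorem fibreDeriv_smul (h : IsFinslerOn G U) {x v : E} (hq : (x, v) ∈ U) {c : ℝ} (hc : 0 < c) :
    fibreDeriv G (x, c • v) = fibreDeriv G (x, v) := by
  ext b
  have := h.fderiv_smul hq hc 0 b
  rw [fderiv_apply_mk, fderiv_apply_mk] at this
  simp only [map_zero, map_smul, smul_eq_mul, zero_add] at this
  exact mul_left_cancel₀ hc.ne' this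

theorem baseDeriv_smul (h : IsFinslerOn G U) {x v : E} (hq : (x, v) ∈ U) {c : ℝ} (hc : 0 < c) :
    baseDeriv G (x, c • v) = c • baseDeriv G (x, v) := by
  ext a
  have := h.fderiv_smul hq hc a 0
  rw [fderiv_apply_mk, fderiv_apply_mk] at this
  simpa using this

end IsFinslerOn

/-- The energy Lagrangian `G² / 2`. -/
def energyLagrangian (G : E × E → ℝ) (q : E × E) : ℝ := G q ^ 2 / 2

section Energy

variable {G : E × E → ℝ} {q : E × E}

theorem contDiffAt_energyLagrangian {n : WithTop ℕ∞} (hG : ContDiffAt ℝ n G q) :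
    ContDiffAt ℝ n (energyLagrangian G) q := (hG.pow 2).div_const 2

theorem fderiv_energyLagrangian (hG : DifferentiableAt ℝ G q) :
    fderiv ℝ (energyLagrangian G) q = G q • fderiv ℝ G q := by
  have h1 : HasFDerivAt (energyLagrangian G) _ q := (hG.hasFDerivAt.pow 2).mul_const (2⁻¹ : ℝ)
  rw [h1.fderiv]
  refine ContinuousLinearMap.ext fun z => ?_
  simp only [smul_apply, smul_eq_mul]
  simp
  ring

theorem fibreDeriv_energyLagrangian (hG : DifferentiableAt ℝ G q) :
    fibreDeriv (energyLagrangian G) q = G q • fibreDeriv G q := by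
  rw [fibreDeriv, fderiv_energyLagrangian hG]; rfl

theorem baseDeriv_energyLagrangian (hG : DifferentiableAt ℝ G q) :
    baseDeriv (energyLagrangian G) q = G q • baseDeriv G q := by
  rw [baseDeriv, fderiv_energyLagrangian hG]; rfl

/-- For curves of constant speed, the Euler–Lagrange equations of energy and length agree. -/
theorem isELAt_energyLagrangian_iff {c : ℝ → E} {t k : ℝ} (hk : k ≠ 0)
    (hG : ∀ᶠ r in 𝓝 t, DifferentiableAt ℝ G (c r, deriv c r))
    (hconst : ∀ᶠ r in 𝓝 t, G (c r, deriv c r) = k) :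
    IsELAt (energyLagrangian G) c t ↔ IsELAt G c t := by
  have h1 : (fun r => fibreDeriv (energyLagrangian G) (c r, deriv c r)) =ᶠ[𝓝 t]
      fun r => k • fibreDeriv G (c r, deriv c r) := by
    filter_upwards [hG, hconst] with r h1 h2
    rw [fibreDeriv_energyLagrangian h1, h2]
  rw [IsELAt, IsELAt, h1.hasDerivAt_iff, baseDeriv_energyLagrangian hG.self_of_nhds,
    hconst.self_of_nhds]
  refine ⟨fun h => ?_, fun h => h.const_smul k⟩
  have := h.const_smul k⁻¹
  simpa only [Pi.smul_def, smul_smul, inv_mul_cancel₀ hk, one_smul] using this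

end Energy

namespace IsFinslerOn

variable {G : E × E → ℝ} {U : Set (E × E)}

theorem eventually_mem_curve (h : IsFinslerOn G U) {c : ℝ → E} {t : ℝ} (hc : ContDiffAt ℝ ∞ c t)
    (hm : (c t, deriv c t) ∈ U) : ∀ᶠ r in 𝓝 t, (c r, deriv c r) ∈ U := by
  have tc : Tendsto (fun r => (c r, deriv c r)) (𝓝 t) (𝓝 (c t, deriv c t)) :=
    hc.continuousAt.tendsto.prodMk_nhds
      (contDiffAt_deriv (m := 0) hc (by simp)).continuousAt.tendsto
  exact tc.eventually (h.isOpen.mem_nhds hm)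

/-- Conservation of energy along the solutions of the Euler–Lagrange equation. -/
theorem hasDerivAt_energy_of_isELAt (h : IsFinslerOn G U) {c : ℝ → E} {t : ℝ}
    (hc : ContDiffAt ℝ ∞ c t) (hm : (c t, deriv c t) ∈ U)
    (hEL : IsELAt (energyLagrangian G) c t) :
    HasDerivAt (fun r => energyLagrangian G (c r, deriv c r)) 0 t := by
  have h1 : HasDerivAt c (deriv c t) t := (hc.differentiableAt (by simp)).hasDerivAt
  have h2 : HasDerivAt (deriv c) (deriv (deriv c) t) t :=
    ((contDiffAt_deriv (m := 1) hc one_add_one_le_infty).differentiableAt (by simp)).hasDerivAt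
  have h3 : DifferentiableAt ℝ (energyLagrangian G) (c t, deriv c t) :=
    (contDiffAt_energyLagrangian (h.contDiffAt hm)).differentiableAt (by simp)
  have h4 := h3.hasFDerivAt.comp_hasDerivAt t (h1.prodMk h2)
  rw [fderiv_apply_mk] at h4
  have h5 := hEL.clm_apply h2
  have h6 : (fun r => fibreDeriv (energyLagrangian G) (c r, deriv c r) (deriv c r)) =ᶠ[𝓝 t]
      fun r => 2 * energyLagrangian G (c r, deriv c r) := by
    filter_upwards [h.eventually_mem_curve hc hm] with r hr
    rw [fibreDeriv_energyLagrangian (h.differentiableAt hr), smul_apply, h.fibreDeriv_self hr,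
      energyLagrangian, smul_eq_mul]
    ring
  have h7 := (h6.hasDerivAt_iff.1 h5).sub h4
  rw [sub_self] at h7
  refine h7.congr_of_eventuallyEq (Eventually.of_forall fun r => ?_)
  simp only [Pi.sub_apply, Function.comp_apply]
  ring

/-- The Euler–Lagrange equation of a homogeneous Lagrangian is invariant under increasing
reparametrizations. -/
theorem isELAt_comp_iff (h : IsFinslerOn G U) {c : ℝ → E} {f : ℝ → ℝ} {f' : ℝ → ℝ} {t : ℝ}
    (hc : ContDiffAt ℝ ∞ c (f t)) (hm : (c (f t), deriv c (f t)) ∈ U)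
    (hf : ∀ r, HasDerivAt f (f' r) r) (hpos : ∀ r, 0 < f' r) :
    IsELAt G (fun r => c (f r)) t ↔ IsELAt G c (f t) := by
  have hcd : ∀ᶠ r in 𝓝 (f t), DifferentiableAt ℝ c r :=
    eventually_differentiableAt hc
  have hft : Tendsto f (𝓝 t) (𝓝 (f t)) := (hf t).continuousAt
  have hder : ∀ᶠ r in 𝓝 t, deriv (fun r => c (f r)) r = f' r • deriv c (f r) := by
    filter_upwards [hft.eventually hcd] with r hr
    exact (hr.hasDerivAt.scomp r (hf r)).deriv
  have h1 : (fun r => fibreDeriv G (c (f r), deriv (fun r => c (f r)) r)) =ᶠ[𝓝 t]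
      fun r => fibreDeriv G (c (f r), deriv c (f r)) := by
    filter_upwards [hder, hft.eventually (h.eventually_mem_curve hc hm)] with r h1 h2
    rw [h1, h.fibreDeriv_smul h2 (hpos r)]
  have h2 : DifferentiableAt ℝ (fun r => fibreDeriv G (c r, deriv c r)) (f t) :=
    differentiableAt_fibreDeriv_curve (hc.of_le ENat.LEInfty.out)
      ((h.contDiffAt hm).of_le ENat.LEInfty.out)
  have h3 := h2.hasDerivAt.scomp t (hf t)
  rw [IsELAt, IsELAt, h1.hasDerivAt_iff, hder.self_of_nhds, h.baseDeriv_smul hm (hpos t)]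
  constructor
  · intro h4
    have h5 := h3.unique h4
    have h6 := smul_right_injective _ (hpos t).ne' h5
    rw [← h6]
    exact h2.hasDerivAt
  · intro h4
    exact h4.scomp t (hf t)

/-- The fundamental tensor in terms of the differential: `g_v(w, v) = G(v) dG_v(w)`. -/
theorem fundamental_apply_self (h : IsFinslerOn G U) {x v : E} (hq : (x, v) ∈ U) (w : E) :
    deriv (fun t : ℝ => deriv (fun s : ℝ => G (x, v + t • w + s • v) ^ 2) 0) 0 =
      2 * (G (x, v) * fibreDeriv G (x, v) w) := by
  set L := energyLagrangian G with hL
  have htend : Tendsto (fun t : ℝ => (x, v + t • w)) (𝓝 0) (𝓝 (x, v)) := by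
    have : Continuous fun t : ℝ => (x, v + t • w) := by fun_prop
    simpa using this.tendsto 0
  have hmem : ∀ᶠ t : ℝ in 𝓝 0, (x, v + t • w) ∈ U := htend.eventually (h.isOpen.mem_nhds hq)
  -- Euler's relation at `v + t w` expresses the inner derivative through first derivatives only
  have h1 : (fun t : ℝ => deriv (fun s : ℝ => G (x, v + t • w + s • v) ^ 2) 0) =ᶠ[𝓝 0]
      fun t => 4 * L (x, v + t • w) - 2 * (t * fibreDeriv L (x, v + t • w) w) := by
    filter_upwards [hmem] with t ht
    have h2 : DifferentiableAt ℝ L (x, v + t • w) :=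
      (contDiffAt_energyLagrangian (h.contDiffAt ht)).differentiableAt (by simp)
    have h3 := (hasDerivAt_fibre (u := v) h2).const_mul 2
    have h4 : (fun s : ℝ => G (x, v + t • w + s • v) ^ 2) =
        fun s => 2 * L (x, v + t • w + s • v) := by
      funext s; simp only [hL, energyLagrangian]; ring
    rw [h4, h3.deriv]
    have h5 : fibreDeriv L (x, v + t • w) (v + t • w) = 2 * L (x, v + t • w) := by
      rw [hL, fibreDeriv_energyLagrangian (h.differentiableAt ht), smul_apply,
        h.fibreDeriv_self ht, energyLagrangian, smul_eq_mul]
      ring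
    rw [map_add, map_smul, smul_eq_mul] at h5
    linear_combination 2 * h5
  have h6 : HasDerivAt (fun t : ℝ => L (x, v + t • w)) (fibreDeriv L (x, v) w) 0 :=
    hasDerivAt_fibre ((contDiffAt_energyLagrangian (h.contDiffAt hq)).differentiableAt (by simp))
  have h7 : DifferentiableAt ℝ (fun t : ℝ => fibreDeriv L (x, v + t • w) w) 0 := by
    have h8 : DifferentiableAt ℝ (fibreDeriv L) (x, v + (0 : ℝ) • w) := by
      rw [zero_smul, add_zero]
      exact (contDiffAt_fibreDeriv (m := 1) (contDiffAt_energyLagrangian (h.contDiffAt hq))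
        one_add_one_le_infty).differentiableAt (by simp)
    have h9 : DifferentiableAt ℝ (fun t : ℝ => (x, v + t • w)) 0 := by fun_prop
    exact (DifferentiableAt.comp (0 : ℝ) h8 h9).clm_apply (differentiableAt_const w)
  have h10 : HasDerivAt (fun t => 4 * L (x, v + t • w) - 2 * (t * fibreDeriv L (x, v + t • w) w))
      _ 0 := (h6.const_mul 4).sub (((hasDerivAt_id (0 : ℝ)).mul h7.hasDerivAt).const_mul 2)
  rw [h1.deriv_eq, h10.deriv]
  simp only [id, zero_mul, add_zero, one_mul, zero_smul]
  rw [hL, fibreDeriv_energyLagrangian (h.differentiableAt hq), smul_apply, smul_eq_mul]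
  ring

/-- A linear map which rescales a pseudo-Finsler metric near an admissible vector is injective: a
vector in its kernel would be in the kernel of the fundamental tensor. -/
theorem injective_of_homothety (h : IsFinslerOn G U) {G₂ : E × E → ℝ} {x y v : E}
    (hq : (x, v) ∈ U) (A : E →L[ℝ] E) {e : ℝ} (he : 0 < e)
    (hA : ∀ᶠ u in 𝓝 v, G₂ (y, A u) = e * G (x, u)) : Function.Injective A := by
  rw [injective_iff_map_eq_zero]
  intro k hk
  refine h.nondegenerate x v hq k fun w => ?_
  have h1 : ∀ᶠ t : ℝ in 𝓝 0, deriv (fun s : ℝ => G (x, v + t • k + s • w) ^ 2) 0 =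
      deriv (fun s : ℝ => G (x, v + s • w) ^ 2) 0 := by
    have ht : Tendsto (fun t : ℝ => v + t • k) (𝓝 0) (𝓝 v) := by
      have : Continuous fun t : ℝ => v + t • k := by fun_prop
      simpa using this.tendsto 0
    filter_upwards [ht.eventually (eventually_eventually_nhds.2 hA)] with t ht'
    refine Filter.EventuallyEq.deriv_eq ?_
    have hs : Tendsto (fun s : ℝ => v + t • k + s • w) (𝓝 0) (𝓝 (v + t • k)) := by
      have : Continuous fun s : ℝ => v + t • k + s • w := by fun_prop
      simpa using this.tendsto 0
    have hs' : Tendsto (fun s : ℝ => v + s • w) (𝓝 0) (𝓝 v) := by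
      have : Continuous fun s : ℝ => v + s • w := by fun_prop
      simpa using this.tendsto 0
    filter_upwards [hs.eventually ht', hs'.eventually hA] with s h2 h3
    have h4 : A (v + t • k + s • w) = A (v + s • w) := by simp [hk]
    rw [h4, h3] at h2
    rw [mul_left_cancel₀ he.ne' h2]
  rw [Filter.EventuallyEq.deriv_eq h1, deriv_const]

/-- Infinitesimal form of the homothety condition. -/
theorem infinitesimal_homothety {Ψ : ℝ × E → E} {w : E → E} {x v : E} {σ : ℝ}
    (hG : DifferentiableAt ℝ G (x, v)) (hw : DifferentiableAt ℝ w x)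
    (hΨ : ContDiffAt ℝ ∞ Ψ (0, x)) (hΨ0 : ∀ᶠ y in 𝓝 x, Ψ (0, y) = y)
    (hflow : ∀ᶠ q in 𝓝 ((0 : ℝ), x), fderiv ℝ Ψ q (1, 0) = w (Ψ q))
    (hhom : ∀ᶠ t in 𝓝 (0 : ℝ), G (Ψ (t, x), fderiv ℝ Ψ (t, x) (0, v)) =
      Real.exp (-(σ * t)) * G (x, v)) :
    baseDeriv G (x, v) (w x) + fibreDeriv G (x, v) (fderiv ℝ w x v) = -σ * G (x, v) := by
  have hΨd : ∀ᶠ q in 𝓝 ((0 : ℝ), x), DifferentiableAt ℝ Ψ q :=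
    eventually_differentiableAt hΨ
  let Γ : ℝ × ℝ → E := fun q => Ψ (q.2, x + q.1 • v)
  have hin : ∀ q : ℝ × ℝ, HasFDerivAt (fun q : ℝ × ℝ => (q.2, x + q.1 • v))
      ((ContinuousLinearMap.snd ℝ ℝ ℝ).prod ((ContinuousLinearMap.fst ℝ ℝ ℝ).smulRight v)) q :=
    fun q => hasFDerivAt_snd.prodMk ((hasFDerivAt_fst.smul_const v).const_add x)
  have hintend : Tendsto (fun q : ℝ × ℝ => (q.2, x + q.1 • v)) (𝓝 (0, 0)) (𝓝 (0, x)) := by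
    have : Continuous fun q : ℝ × ℝ => (q.2, x + q.1 • v) := by fun_prop
    simpa using this.tendsto (0, 0)
  have hΓ : ContDiffAt ℝ 2 Γ (0, 0) := by
    have h1 : ContDiffAt ℝ ∞ Ψ (((0 : ℝ), (0 : ℝ)).2, x + ((0 : ℝ), (0 : ℝ)).1 • v) := by
      simpa using hΨ
    have h2 : ContDiff ℝ ∞ (fun q : ℝ × ℝ => (q.2, x + q.1 • v)) := by fun_prop
    exact (ContDiffAt.comp ((0 : ℝ), (0 : ℝ)) h1 h2.contDiffAt).of_le ENat.LEInfty.out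
  have hΓd : ∀ᶠ q in 𝓝 ((0 : ℝ), (0 : ℝ)), ∀ a b : ℝ,
      fderiv ℝ Γ q (a, b) = fderiv ℝ Ψ (q.2, x + q.1 • v) (b, a • v) := by
    filter_upwards [hintend.eventually hΨd] with q hq a b
    have h1 : HasFDerivAt Γ _ q := HasFDerivAt.comp q hq.hasFDerivAt (hin q)
    rw [h1.fderiv]
    rfl
  obtain ⟨m, hm1, hm2⟩ := exists_mixed_partial hΓ
  have ts : Tendsto (fun s : ℝ => (s, (0 : ℝ))) (𝓝 0) (𝓝 (0, 0)) :=
    (Continuous.prodMk_left 0).tendsto 0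
  have tt : Tendsto (fun t : ℝ => ((0 : ℝ), t)) (𝓝 0) (𝓝 (0, 0)) :=
    (Continuous.prodMk_right 0).tendsto 0
  have hmw : m = fderiv ℝ w x v := by
    have h1 : HasDerivAt (fun s : ℝ => x + s • v) v 0 := by
      simpa using ((hasDerivAt_id (0 : ℝ)).smul_const v).const_add x
    have hw' : DifferentiableAt ℝ w (x + (0 : ℝ) • v) := by simpa using hw
    have h2 := hw'.hasFDerivAt.comp_hasDerivAt (0 : ℝ) h1
    rw [zero_smul, add_zero] at h2
    refine hm1.unique (h2.congr_of_eventuallyEq ?_)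
    have h3 : Tendsto (fun s : ℝ => x + s • v) (𝓝 0) (𝓝 x) := by
      simpa using h1.continuousAt.tendsto
    filter_upwards [ts.eventually hΓd, (hintend.comp ts).eventually hflow, h3.eventually hΨ0]
      with s h4 h5 h6
    rw [h4, zero_smul]
    have h7 : fderiv ℝ Ψ (0, x + s • v) (1, 0) = w (Ψ (0, x + s • v)) := h5
    rw [h7, h6]
    rfl
  have hx0 : Ψ (0, x) = x := hΨ0.self_of_nhds
  have hv0 : fderiv ℝ Γ (0, 0) (1, 0) = v := by
    have h1 := hasDerivAt_fst_param (hΓ.differentiableAt (by norm_num))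
    have h2 : HasDerivAt (fun s : ℝ => x + s • v) v 0 := by
      simpa using ((hasDerivAt_id (0 : ℝ)).smul_const v).const_add x
    have h3 : Tendsto (fun s : ℝ => x + s • v) (𝓝 0) (𝓝 x) := by
      simpa using h2.continuousAt.tendsto
    refine h1.unique (h2.congr_of_eventuallyEq ?_)
    filter_upwards [h3.eventually hΨ0] with s hs using hs
  have h1 : HasDerivAt (fun t : ℝ => Ψ (t, x)) (w x) 0 := by
    have h2 := hΨd.self_of_nhds.hasFDerivAt.comp_hasDerivAt (0 : ℝ)
      ((hasDerivAt_id (0 : ℝ)).prodMk (hasDerivAt_const (0 : ℝ) x))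
    rw [hflow.self_of_nhds, hx0] at h2
    exact h2
  have hG' : DifferentiableAt ℝ G (Ψ (0, x), fderiv ℝ Γ (0, 0) (1, 0)) := by rwa [hx0, hv0]
  have h3 := hG'.hasFDerivAt.comp_hasDerivAt (0 : ℝ) (h1.prodMk hm2)
  rw [fderiv_apply_mk, hx0, hv0, hmw] at h3
  have hexp : HasDerivAt (fun r : ℝ => Real.exp (-(σ * r)) * G (x, v)) (-σ * G (x, v)) 0 := by
    have := ((((hasDerivAt_id (0 : ℝ)).const_mul σ).neg).exp).mul_const (G (x, v))
    simpa using this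
  refine h3.unique (hexp.congr_of_eventuallyEq ?_)
  filter_upwards [hhom, tt.eventually hΓd] with t h4 h5
  simp only [Function.comp_apply, h5]
  rw [zero_smul, add_zero, one_smul]
  exact h4

end IsFinslerOn

end LocalFinsler

/-! ### Pseudo-Finsler metrics and curves in coordinates -/

section InCoordinates

variable {E : Type*} [NormedAddCommGroup E] [NormedSpace ℝ E]
  {M : Type*} [TopologicalSpace M] [ChartedSpace E M] [IsManifold 𝓘(ℝ, E) ∞ M]

/-- The expression of a pseudo-Finsler metric in the chart at `p`. -/
def PseudoFinsler.coord (F : PseudoFinsler E M) (p : M) (q : E × E) : ℝ := F.toFun (tcoordSymm p q)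

/-- The domain of a pseudo-Finsler metric in the chart at `p`. -/
def PseudoFinsler.coordDom (F : PseudoFinsler E M) (p : M) : Set (E × E) :=
  {q | q.1 ∈ (extChartAt 𝓘(ℝ, E) p).target ∧ tcoordSymm p q ∈ F.dom}

variable (F : PseudoFinsler E M) {p : M}

theorem PseudoFinsler.coord_tcoord {z : TangentBundle 𝓘(ℝ, E) M}
    (hz : z.1 ∈ (extChartAt 𝓘(ℝ, E) p).source) : F.coord p (tcoord p z) = F.toFun z := by
  rw [PseudoFinsler.coord, tcoordSymm_tcoord hz]

theorem PseudoFinsler.tcoord_mem_iff {z : TangentBundle 𝓘(ℝ, E) M}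
    (hz : z.1 ∈ (extChartAt 𝓘(ℝ, E) p).source) : tcoord p z ∈ F.coordDom p ↔ z ∈ F.dom := by
  rw [PseudoFinsler.coordDom, mem_ofPred_eq, tcoordSymm_tcoord hz]
  exact and_iff_right (tcoord_fst_mem hz)

theorem exists_tcoord_eq {x : E} (hx : x ∈ (extChartAt 𝓘(ℝ, E) p).target) (v : E) :
    ∃ v' : TangentSpace 𝓘(ℝ, E) ((extChartAt 𝓘(ℝ, E) p).symm x),
      tcoord p ⟨(extChartAt 𝓘(ℝ, E) p).symm x, v'⟩ = (x, v) := by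
  have h1 : (tcoordSymm p (x, v)).1 = (extChartAt 𝓘(ℝ, E) p).symm x := tcoordSymm_fst p (x, v)
  have h2 : tcoord p (tcoordSymm p (x, v)) = (x, v) := tcoord_tcoordSymm (q := (x, v)) hx
  generalize tcoordSymm p (x, v) = z at h1 h2
  obtain ⟨y, v'⟩ := z
  simp only at h1
  subst h1
  exact ⟨v', h2⟩

theorem PseudoFinsler.isFinslerOn_coord (p : M) : IsFinslerOn (F.coord p) (F.coordDom p) := by
  set φ := extChartAt 𝓘(ℝ, E) p with hφ
  have hopen : IsOpen {q : E × E | q.1 ∈ φ.target} :=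
    (isOpen_extChartAt_target p).preimage continuous_fst
  have hU : F.coordDom p = {q : E × E | q.1 ∈ φ.target} ∩ tcoordSymm p ⁻¹' F.dom := rfl
  have hsymm : ∀ x v, (x, v) ∈ F.coordDom p → ∃ v' : TangentSpace 𝓘(ℝ, E) (φ.symm x),
      φ.symm x ∈ φ.source ∧ tcoord p ⟨φ.symm x, v'⟩ = (x, v) ∧
        (⟨φ.symm x, v'⟩ : TangentBundle 𝓘(ℝ, E) M) ∈ F.dom := by
    intro x v hq
    obtain ⟨v', hv'⟩ := exists_tcoord_eq hq.1 v
    have hs : φ.symm x ∈ φ.source := φ.map_target hq.1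
    exact ⟨v', hs, hv', (F.tcoord_mem_iff (z := ⟨φ.symm x, v'⟩) hs).1 (by rwa [hv'])⟩
  have hsmul : ∀ x v (v' : TangentSpace 𝓘(ℝ, E) (φ.symm x)) (c : ℝ),
      tcoord p ⟨φ.symm x, v'⟩ = (x, v) → tcoord p ⟨φ.symm x, c • v'⟩ = (x, c • v) := by
    intro x v v' c h
    rw [tcoord_smul, h]
  refine ⟨?_, ?_, ?_, ?_, ?_⟩
  · rw [hU]
    exact (contMDiffOn_tcoordSymm p).continuousOn.isOpen_inter_preimage hopen F.isOpen_dom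
  · have := F.smooth.comp ((contMDiffOn_tcoordSymm (E := E) p).mono
      (inter_subset_left (t := tcoordSymm p ⁻¹' F.dom))) (fun q hq => hq.2)
    exact contMDiffOn_iff_contDiffOn.1 this
  · intro x v c hc hq
    obtain ⟨v', hs, hv', hd⟩ := hsymm x v hq
    rw [← hsmul x v v' c hv', F.tcoord_mem_iff (z := ⟨φ.symm x, c • v'⟩) hs]
    exact F.conic _ v' c hc hd
  · intro x v c hc hq
    obtain ⟨v', hs, hv', hd⟩ := hsymm x v hq
    rw [← hsmul x v v' c hv', F.coord_tcoord (z := ⟨φ.symm x, c • v'⟩) hs, ← hv',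
      F.coord_tcoord (z := ⟨φ.symm x, v'⟩) hs]
    exact F.homogeneous _ v' c hc hd
  · intro x v hq u hu
    obtain ⟨v', hs, hv', hd⟩ := hsymm x v hq
    obtain ⟨u', hu'⟩ := exists_tcoord_eq (p := p) hq.1 u
    have h0 : u' = 0 := by
      refine F.nondegenerate _ v' hd u' fun w' => ?_
      have h1 : ∀ t s : ℝ, F.toFun ⟨φ.symm x, v' + t • u' + s • w'⟩ =
          F.coord p (x, v + t • u + s • (tcoord p ⟨φ.symm x, w'⟩).2) := by
        intro t s
        rw [← F.coord_tcoord (p := p) (z := ⟨φ.symm x, v' + t • u' + s • w'⟩) hs]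
        congr 1
        rw [tcoord_add, tcoord_add, tcoord_smul, tcoord_smul, hv', hu']
      rw [fundamentalTensor]
      simp only [h1]
      rw [hu, mul_zero]
    have h2 : (tcoord p ⟨φ.symm x, u'⟩).2 = u := by rw [hu']
    rw [← h2, h0, tcoord, map_zero]
    rfl

theorem eventually_mdifferentiableAt_of_contMDiffAt {γ : ℝ → M} {t : ℝ}
    (hγ : ContMDiffAt 𝓘(ℝ, ℝ) 𝓘(ℝ, E) ∞ γ t) :
    ∀ᶠ r in 𝓝 t, MDifferentiableAt 𝓘(ℝ, ℝ) 𝓘(ℝ, E) γ r := by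
  have h1 : ContMDiffAt 𝓘(ℝ, ℝ) 𝓘(ℝ, E) 1 γ t := hγ.of_le (by simp)
  exact ((contMDiffAt_iff_contMDiffAt_nhds (by simp)).1 h1).mono
    fun r h => h.mdifferentiableAt (by simp)

theorem contDiffAt_extChartAt_comp {V : Type*} [NormedAddCommGroup V] [NormedSpace ℝ V]
    {Γ : V → M} {q : V} (hΓ : ContMDiffAt 𝓘(ℝ, V) 𝓘(ℝ, E) ∞ Γ q)
    (hp : Γ q ∈ (extChartAt 𝓘(ℝ, E) p).source) :
    ContDiffAt ℝ ∞ (fun q => extChartAt 𝓘(ℝ, E) p (Γ q)) q := by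
  rw [extChartAt_source] at hp
  exact ((contMDiffAt_extChartAt' hp).comp q hΓ).contDiffAt

/-- Coordinates of the velocity of a smooth curve. -/
theorem eventually_tcoord_velocity {γ : ℝ → M} {t : ℝ}
    (hγ : ContMDiffAt 𝓘(ℝ, ℝ) 𝓘(ℝ, E) ∞ γ t) (hp : γ t ∈ (extChartAt 𝓘(ℝ, E) p).source) :
    ∀ᶠ r in 𝓝 t, γ r ∈ (extChartAt 𝓘(ℝ, E) p).source ∧ tcoord p (velocity γ r) =
      (extChartAt 𝓘(ℝ, E) p (γ r), deriv (fun r => extChartAt 𝓘(ℝ, E) p (γ r)) r) := by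
  filter_upwards [eventually_mdifferentiableAt_of_contMDiffAt hγ,
    hγ.continuousAt.tendsto.eventually ((isOpen_extChartAt_source p).mem_nhds hp)] with r h1 h2
  exact ⟨h2, tcoord_velocity h1 h2⟩

/-- Coordinates of the two partial velocities of a smooth family of curves. -/
theorem eventually_tcoord_velocity_family {Γ : ℝ × ℝ → M} {q₀ : ℝ × ℝ}
    (hΓ : ContMDiffAt 𝓘(ℝ, ℝ × ℝ) 𝓘(ℝ, E) ∞ Γ q₀)
    (hp : Γ q₀ ∈ (extChartAt 𝓘(ℝ, E) p).source) :
    ∀ᶠ q in 𝓝 q₀, Γ q ∈ (extChartAt 𝓘(ℝ, E) p).source ∧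
      tcoord p ⟨Γ q, velocityVec (fun r => Γ (q.1, r)) q.2⟩ = (extChartAt 𝓘(ℝ, E) p (Γ q),
        fderiv ℝ (fun q => extChartAt 𝓘(ℝ, E) p (Γ q)) q (0, 1)) ∧
      tcoord p ⟨Γ q, velocityVec (fun s => Γ (s, q.2)) q.1⟩ = (extChartAt 𝓘(ℝ, E) p (Γ q),
        fderiv ℝ (fun q => extChartAt 𝓘(ℝ, E) p (Γ q)) q (1, 0)) := by
  have h1 : ContMDiffAt 𝓘(ℝ, ℝ × ℝ) 𝓘(ℝ, E) 1 Γ q₀ := hΓ.of_le (by simp)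
  have h2 := ((contMDiffAt_iff_contMDiffAt_nhds (by simp)).1 h1).mono
    fun r h => h.mdifferentiableAt (by simp)
  have h3 : ∀ᶠ q in 𝓝 q₀, DifferentiableAt ℝ (fun q => extChartAt 𝓘(ℝ, E) p (Γ q)) q :=
    eventually_differentiableAt (contDiffAt_extChartAt_comp hΓ hp)
  filter_upwards [h2, h3,
    hΓ.continuousAt.tendsto.eventually ((isOpen_extChartAt_source p).mem_nhds hp)] with q h4 h5 h6
  refine ⟨h6, ?_, ?_⟩
  · have h7 : MDifferentiableAt 𝓘(ℝ, ℝ) 𝓘(ℝ, E) (fun r => Γ (q.1, r)) q.2 := by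
      have h8 : MDifferentiableAt 𝓘(ℝ, ℝ) 𝓘(ℝ, ℝ × ℝ) (fun r : ℝ => (q.1, r)) q.2 :=
        (by fun_prop : DifferentiableAt ℝ (fun r : ℝ => (q.1, r)) q.2).mdifferentiableAt
      exact MDifferentiableAt.comp q.2 (g := Γ) h4 h8
    have h9 := tcoord_velocity h7 h6
    rw [(hasDerivAt_snd_param h5).deriv] at h9
    exact h9
  · have h7 : MDifferentiableAt 𝓘(ℝ, ℝ) 𝓘(ℝ, E) (fun s => Γ (s, q.2)) q.1 := by
      have h8 : MDifferentiableAt 𝓘(ℝ, ℝ) 𝓘(ℝ, ℝ × ℝ) (fun s : ℝ => (s, q.2)) q.1 :=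
        (by fun_prop : DifferentiableAt ℝ (fun s : ℝ => (s, q.2)) q.1).mdifferentiableAt
      exact MDifferentiableAt.comp q.1 (g := Γ) h4 h8
    have h9 := tcoord_velocity h7 h6
    rw [(hasDerivAt_fst_param h5).deriv] at h9
    exact h9

end InCoordinates

/-! ### Geodesics and the Euler–Lagrange equation -/

section Variations

/-- Differentiation under the integral sign for a `C¹` integrand on a compact interval. -/
theorem hasDerivAt_integral_param {H : ℝ × ℝ → ℝ} {a b ε : ℝ} (hab : a ≤ b) (hε : 0 < ε)
    (hH : ∀ s ∈ Ioo (-ε) ε, ∀ t ∈ Icc a b, ContDiffAt ℝ 1 H (s, t)) :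
    IntervalIntegrable (fun t => fderiv ℝ H (0, t) (1, 0)) volume a b ∧
      HasDerivAt (fun s => ∫ t in a..b, H (s, t)) (∫ t in a..b, fderiv ℝ H (0, t) (1, 0)) 0 := by
  have h0 : (0 : ℝ) ∈ Ioo (-ε) ε := ⟨by linarith, hε⟩
  have hsub : Ioo (-(ε / 2)) (ε / 2) ⊆ Ioo (-ε) ε := Ioo_subset_Ioo (by linarith) (by linarith)
  have hsub' : Icc (-(ε / 2)) (ε / 2) ⊆ Ioo (-ε) ε :=
    fun s hs => ⟨by linarith [hs.1], by linarith [hs.2]⟩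
  have hd : ∀ s ∈ Ioo (-ε) ε, ∀ t ∈ Icc a b,
      ContinuousAt (fun q : ℝ × ℝ => fderiv ℝ H q (1, 0)) (s, t) := by
    intro s hs t ht
    exact (((hH s hs t ht).fderiv_right (m := 0) (by simp)).clm_apply
      contDiffAt_const).continuousAt
  have hu : uIoc a b ⊆ Icc a b := by rw [uIoc_of_le hab]; exact Ioc_subset_Icc_self
  have hc1 : ∀ s ∈ Ioo (-ε) ε, ContinuousOn (fun t => H (s, t)) (Icc a b) := fun s hs t ht =>
    (ContinuousAt.comp (f := fun t => (s, t)) (hH s hs t ht).continuousAt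
      (by fun_prop)).continuousWithinAt
  have hc2 : ContinuousOn (fun t => fderiv ℝ H (0, t) (1, 0)) (Icc a b) := fun t ht =>
    (ContinuousAt.comp (f := fun t => ((0 : ℝ), t)) (hd 0 h0 t ht) (by fun_prop)).continuousWithinAt
  obtain ⟨C, hC⟩ := (isCompact_Icc (a := -(ε / 2)) (b := ε / 2)).prod (isCompact_Icc (a := a)
    (b := b)) |>.exists_bound_of_continuousOn (f := fun q : ℝ × ℝ => fderiv ℝ H q (1, 0))
    fun q hq => (hd q.1 (hsub' hq.1) q.2 hq.2).continuousWithinAt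
  refine intervalIntegral.hasDerivAt_integral_of_dominated_loc_of_deriv_le
    (F := fun s t => H (s, t)) (F' := fun s t => fderiv ℝ H (s, t) (1, 0)) (bound := fun _ => C)
    (s := Ioo (-(ε / 2)) (ε / 2)) (Ioo_mem_nhds (by linarith) (by linarith)) ?_ ?_ ?_ ?_ ?_ ?_
  · filter_upwards [Ioo_mem_nhds (show -ε < 0 by linarith) hε] with s hs
    exact ((hc1 s hs).mono hu).aestronglyMeasurable measurableSet_uIoc
  · exact (by rw [uIcc_of_le hab]; exact hc1 0 h0 : ContinuousOn _ (uIcc a b)).intervalIntegrable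
  · exact (hc2.mono hu).aestronglyMeasurable measurableSet_uIoc
  · exact Eventually.of_forall fun t ht s hs => hC (s, t) ⟨Ioo_subset_Icc_self hs, hu ht⟩
  · exact intervalIntegrable_const
  · exact Eventually.of_forall fun t ht s hs =>
      hasDerivAt_fst_param ((hH s (hsub hs) t (hu ht)).differentiableAt (by simp))

variable {E : Type*} [NormedAddCommGroup E] [NormedSpace ℝ E]
  {M : Type*} [TopologicalSpace M] [ChartedSpace E M] [IsManifold 𝓘(ℝ, E) ∞ M]

namespace PseudoFinsler

variable (F : PseudoFinsler E M) {p : M}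

/-- The energy density `F(∂Γ/∂t)² / 2` of a family of curves. -/
def energyDensity (Γ : ℝ × ℝ → M) (q : ℝ × ℝ) : ℝ :=
  F.toFun (⟨Γ q, velocityVec (fun r => Γ (q.1, r)) q.2⟩ : TangentBundle 𝓘(ℝ, E) M) ^ 2 / 2

/-- The momentum `∂(F²/2)/∂v` of the curve `Γ(0, ·)`, evaluated on the variation field
`∂Γ/∂s(0, ·)`. -/
def variationMomentum (Γ : ℝ × ℝ → M) (t : ℝ) : ℝ :=
  deriv (fun τ : ℝ => F.toFun (⟨Γ (0, t), (velocityVec (fun r => Γ (0, r)) t +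
    τ • velocityVec (fun s => Γ (s, t)) 0 : TangentSpace 𝓘(ℝ, E) (Γ (0, t)))⟩ :
      TangentBundle 𝓘(ℝ, E) M) ^ 2 / 2) 0

theorem energy_eq (Γ : ℝ × ℝ → M) (s a b : ℝ) :
    F.energy (fun t => Γ (s, t)) a b = ∫ t in a..b, F.energyDensity Γ (s, t) := by
  rw [energy, ← intervalIntegral.integral_const_mul]
  congr 1
  funext t
  simp only [energyDensity, velocity]
  ring

section Family

variable {Γ : ℝ × ℝ → M} {q₀ : ℝ × ℝ}

theorem eventually_energyDensity_eq (hΓ : ContMDiffAt 𝓘(ℝ, ℝ × ℝ) 𝓘(ℝ, E) ∞ Γ q₀)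
    (hp : Γ q₀ ∈ (extChartAt 𝓘(ℝ, E) p).source) :
    ∀ᶠ q in 𝓝 q₀, F.energyDensity Γ q = energyLagrangian (F.coord p) (extChartAt 𝓘(ℝ, E) p (Γ q),
      fderiv ℝ (fun q => extChartAt 𝓘(ℝ, E) p (Γ q)) q (0, 1)) := by
  filter_upwards [eventually_tcoord_velocity_family hΓ hp] with q hq
  rw [energyLagrangian, ← hq.2.1, F.coord_tcoord hq.1, energyDensity]

theorem coord_velocity_mem (hΓ : ContMDiffAt 𝓘(ℝ, ℝ × ℝ) 𝓘(ℝ, E) ∞ Γ q₀)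
    (hp : Γ q₀ ∈ (extChartAt 𝓘(ℝ, E) p).source)
    (hm : velocity (E := E) (fun r => Γ (q₀.1, r)) q₀.2 ∈ F.dom) :
    (extChartAt 𝓘(ℝ, E) p (Γ q₀), fderiv ℝ (fun q => extChartAt 𝓘(ℝ, E) p (Γ q)) q₀ (0, 1)) ∈
      F.coordDom p := by
  rw [← (eventually_tcoord_velocity_family hΓ hp).self_of_nhds.2.1]
  exact (F.tcoord_mem_iff (z := ⟨Γ q₀, velocityVec (fun r => Γ (q₀.1, r)) q₀.2⟩) hp).2 hm

theorem contDiffAt_energyDensity (hΓ : ContMDiffAt 𝓘(ℝ, ℝ × ℝ) 𝓘(ℝ, E) ∞ Γ q₀)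
    (hm : velocity (E := E) (fun r => Γ (q₀.1, r)) q₀.2 ∈ F.dom) :
    ContDiffAt ℝ ∞ (F.energyDensity Γ) q₀ := by
  have hp : Γ q₀ ∈ (extChartAt 𝓘(ℝ, E) (Γ q₀)).source := mem_extChartAt_source (Γ q₀)
  have h1 := contDiffAt_extChartAt_comp hΓ hp
  have h2 := contDiffAt_energyLagrangian
    ((F.isFinslerOn_coord (Γ q₀)).contDiffAt (F.coord_velocity_mem hΓ hp hm))
  have h3 := h1.prodMk ((h1.fderiv_right (m := ∞) (by simp)).clm_apply
    (contDiffAt_const (c := ((0 : ℝ), (1 : ℝ)))))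
  exact (ContDiffAt.comp (g := energyLagrangian (F.coord (Γ q₀))) q₀ h2 h3).congr_of_eventuallyEq
    (F.eventually_energyDensity_eq hΓ hp)

/-- The first variation formula, in a chart. -/
theorem hasDerivAt_variationMomentum {t : ℝ}
    (hΓ : ContMDiffAt 𝓘(ℝ, ℝ × ℝ) 𝓘(ℝ, E) ∞ Γ (0, t))
    (hp : Γ (0, t) ∈ (extChartAt 𝓘(ℝ, E) p).source)
    (hm : velocity (E := E) (fun r => Γ (0, r)) t ∈ F.dom) {P : E →L[ℝ] ℝ}
    (hP : HasDerivAt (fun r => fibreDeriv (energyLagrangian (F.coord p))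
      (extChartAt 𝓘(ℝ, E) p (Γ (0, r)), deriv (fun r => extChartAt 𝓘(ℝ, E) p (Γ (0, r))) r)) P t) :
    HasDerivAt (F.variationMomentum Γ) (fderiv ℝ (F.energyDensity Γ) (0, t) (1, 0) +
      (P - baseDeriv (energyLagrangian (F.coord p)) (extChartAt 𝓘(ℝ, E) p (Γ (0, t)),
        deriv (fun r => extChartAt 𝓘(ℝ, E) p (Γ (0, r))) t))
          (deriv (fun s => extChartAt 𝓘(ℝ, E) p (Γ (s, t))) 0)) t := by
  set L := energyLagrangian (F.coord p)
  set C : ℝ × ℝ → E := fun q => extChartAt 𝓘(ℝ, E) p (Γ q) with hC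
  have h1 : ContDiffAt ℝ ∞ C (0, t) := contDiffAt_extChartAt_comp hΓ hp
  have hmem := F.coord_velocity_mem hΓ hp hm
  have hL : ContDiffAt ℝ ∞ L (C (0, t), fderiv ℝ C (0, t) (0, 1)) :=
    contDiffAt_energyLagrangian ((F.isFinslerOn_coord p).contDiffAt hmem)
  have hCd : ∀ᶠ q in 𝓝 ((0 : ℝ), t), DifferentiableAt ℝ C q :=
    eventually_differentiableAt h1
  have tt : Tendsto (fun r : ℝ => ((0 : ℝ), r)) (𝓝 t) (𝓝 (0, t)) :=
    (Continuous.prodMk_right 0).tendsto t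
  have ts : Tendsto (fun s : ℝ => (s, t)) (𝓝 0) (𝓝 (0, t)) :=
    (Continuous.prodMk_left t).tendsto 0
  have hder : ∀ᶠ r in 𝓝 t, deriv (fun r => C (0, r)) r = fderiv ℝ C (0, r) (0, 1) :=
    (tt.eventually hCd).mono fun r hr => (hasDerivAt_snd_param hr).deriv
  have hP' : HasDerivAt (fun r => fibreDeriv L (C (0, r), fderiv ℝ C (0, r) (0, 1))) P t := by
    refine hP.congr_of_eventuallyEq ?_
    filter_upwards [hder] with r hr
    rw [hr]
  obtain ⟨a, ha1, ha2⟩ := first_variation (h1.of_le ENat.LEInfty.out)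
    (hL.of_le ENat.LEInfty.out) hP'
  have ha : a = fderiv ℝ (F.energyDensity Γ) (0, t) (1, 0) := by
    have h2 := hasDerivAt_fst_param
      ((F.contDiffAt_energyDensity hΓ hm).differentiableAt (by simp))
    exact ha1.unique (h2.congr_of_eventuallyEq
      ((ts.eventually (F.eventually_energyDensity_eq hΓ hp)).mono fun s hs => hs.symm))
  rw [← ha, hder.self_of_nhds, (hasDerivAt_fst_param hCd.self_of_nhds).deriv]
  refine ha2.congr_of_eventuallyEq ?_
  have hev : ∀ᶠ q in 𝓝 ((0 : ℝ), t), (C q, fderiv ℝ C q (0, 1)) ∈ F.coordDom p :=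
    (h1.continuousAt.prodMk ((h1.fderiv_right (m := 0) (by simp)).clm_apply
      contDiffAt_const).continuousAt).eventually
        ((F.isFinslerOn_coord p).isOpen.mem_nhds hmem)
  filter_upwards [tt.eventually (eventually_tcoord_velocity_family hΓ hp), tt.eventually hev]
    with r hr hr'
  have h3 : DifferentiableAt ℝ L (C (0, r), fderiv ℝ C (0, r) (0, 1)) :=
    (contDiffAt_energyLagrangian ((F.isFinslerOn_coord p).contDiffAt hr')).differentiableAt
      (by simp)
  rw [← (hasDerivAt_fibre (u := fderiv ℝ C (0, r) (1, 0)) h3).deriv, variationMomentum]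
  congr 1
  funext τ
  have h4 := tcoord_add (E := E) p (Γ (0, r)) (velocityVec (fun r => Γ (0, r)) r)
    (τ • velocityVec (fun s => Γ (s, r)) 0)
  rw [tcoord_smul] at h4
  have h5 : tcoord p ⟨Γ (0, r), velocityVec (fun r => Γ (0, r)) r⟩ =
    (C (0, r), fderiv ℝ C (0, r) (0, 1)) := hr.2.1
  have h6 : tcoord p ⟨Γ (0, r), velocityVec (fun s => Γ (s, r)) 0⟩ =
    (C (0, r), fderiv ℝ C (0, r) (1, 0)) := hr.2.2
  rw [h5, h6] at h4
  simp only at h4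
  change _ = F.coord p _ ^ 2 / 2
  rw [← h4, F.coord_tcoord hr.1]

/-- The momentum vanishes where the variation is fixed; this removes the boundary terms of the first
variation. -/
theorem variationMomentum_eq_zero {t : ℝ} {x : M} (h : ∀ᶠ s in 𝓝 (0 : ℝ), Γ (s, t) = x) :
    F.variationMomentum Γ t = 0 := by
  have h1 : velocityVec (E := E) (fun s => Γ (s, t)) 0 = 0 := by
    have h2 : (fun s => Γ (s, t)) =ᶠ[𝓝 0] fun _ => x := h
    have h3 : mfderiv 𝓘(ℝ, ℝ) 𝓘(ℝ, E) (fun s => Γ (s, t)) 0 = 0 := by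
      rw [h2.mfderiv_eq, mfderiv_const]
      rfl
    rw [velocityVec, h3]
    rfl
  have h4 : ∀ τ : ℝ, (velocityVec (fun r => Γ (0, r)) t + τ • velocityVec (fun s => Γ (s, t)) 0 :
      TangentSpace 𝓘(ℝ, E) (Γ (0, t))) = velocityVec (fun r => Γ (0, r)) t := by
    intro τ
    rw [h1]
    erw [smul_zero, add_zero]
  rw [variationMomentum]
  simp only [h4, deriv_const]

end Family

/-- The differentiability of the momentum along a smooth admissible curve. -/
theorem differentiableAt_momentum {γ : ℝ → M} {t : ℝ} {G : E × E → ℝ}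
    (hγ : ContMDiffAt 𝓘(ℝ, ℝ) 𝓘(ℝ, E) ∞ γ t) (hp : γ t ∈ (extChartAt 𝓘(ℝ, E) p).source)
    (hG : ContDiffAt ℝ ∞ G (tcoord p (velocity γ t))) :
    DifferentiableAt ℝ (fun r => fibreDeriv G (extChartAt 𝓘(ℝ, E) p (γ r),
      deriv (fun r => extChartAt 𝓘(ℝ, E) p (γ r)) r)) t := by
  rw [(eventually_tcoord_velocity hγ hp).self_of_nhds.2] at hG
  exact differentiableAt_fibreDeriv_curve
    ((contDiffAt_extChartAt_comp hγ hp).of_le ENat.LEInfty.out) (hG.of_le ENat.LEInfty.out)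

variable {F}

/-- A smooth admissible curve which satisfies the Euler–Lagrange equation of the energy in charts
is a geodesic. -/
theorem isGeodesicOn_of_isELAt {γ : ℝ → M} {J : Set ℝ}
    (hγ : ContMDiffOn 𝓘(ℝ, ℝ) 𝓘(ℝ, E) ∞ γ J) (hadm : ∀ t ∈ J, velocity (E := E) γ t ∈ F.dom)
    (hEL : ∀ t ∈ J, ∃ p, γ t ∈ (extChartAt 𝓘(ℝ, E) p).source ∧
      IsELAt (energyLagrangian (F.coord p)) (fun r => extChartAt 𝓘(ℝ, E) p (γ r)) t) :
    F.IsGeodesicOn γ J := by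
  refine ⟨hγ, hadm, fun a b hab hsub ε hε Γ hΓ => ?_⟩
  have h0 : (0 : ℝ) ∈ Ioo (-ε) ε := ⟨by linarith, hε⟩
  obtain ⟨hint, hder⟩ := hasDerivAt_integral_param hab.le hε (H := F.energyDensity Γ)
    fun s hs t ht => (F.contDiffAt_energyDensity (hΓ.smooth s hs t ht)
      (hΓ.admissible s hs t ht)).of_le (by simp)
  have hθ : ContinuousOn (F.variationMomentum Γ) (Icc a b) := by
    intro t ht
    have hm := hΓ.admissible 0 h0 t ht
    have hs := hΓ.smooth 0 h0 t ht
    have hp : Γ (0, t) ∈ (extChartAt 𝓘(ℝ, E) (Γ (0, t))).source := mem_extChartAt_source _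
    have hc : ContMDiffAt 𝓘(ℝ, ℝ) 𝓘(ℝ, E) ∞ (fun r => Γ (0, r)) t :=
      hs.comp (I' := 𝓘(ℝ, ℝ × ℝ)) (f := fun r : ℝ => ((0 : ℝ), r)) t
        (by fun_prop : ContDiff ℝ ∞ fun r : ℝ => ((0 : ℝ), r)).contMDiff.contMDiffAt
    have hd := differentiableAt_momentum (G := energyLagrangian (F.coord (Γ (0, t)))) hc hp
      (contDiffAt_energyLagrangian ((F.isFinslerOn_coord _).contDiffAt
        ((F.tcoord_mem_iff (z := velocity (fun r => Γ (0, r)) t) hp).2 hm)))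
    exact (F.hasDerivAt_variationMomentum hs hp hm hd.hasDerivAt).continuousAt.continuousWithinAt
  have hθ' : ∀ t ∈ Ioo a b, HasDerivAt (F.variationMomentum Γ)
      (fderiv ℝ (F.energyDensity Γ) (0, t) (1, 0)) t := by
    intro t ht
    have ht' := Ioo_subset_Icc_self ht
    obtain ⟨p, hp, hE⟩ := hEL t (hsub ht')
    have heq : (fun r => Γ (0, r)) =ᶠ[𝓝 t] γ := by
      filter_upwards [Icc_mem_nhds ht.1 ht.2] with r hr using hΓ.base r hr
    have heq' : (fun r => extChartAt 𝓘(ℝ, E) p (Γ (0, r))) =ᶠ[𝓝 t]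
        fun r => extChartAt 𝓘(ℝ, E) p (γ r) := heq.fun_comp (extChartAt 𝓘(ℝ, E) p)
    have hP : HasDerivAt (fun r => fibreDeriv (energyLagrangian (F.coord p))
        (extChartAt 𝓘(ℝ, E) p (Γ (0, r)),
          deriv (fun r => extChartAt 𝓘(ℝ, E) p (Γ (0, r))) r))
        (baseDeriv (energyLagrangian (F.coord p)) (extChartAt 𝓘(ℝ, E) p (γ t),
          deriv (fun r => extChartAt 𝓘(ℝ, E) p (γ r)) t)) t := by
      refine HasDerivAt.congr_of_eventuallyEq hE ?_
      filter_upwards [heq'.deriv, heq'] with r h1 h2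
      rw [h1, h2]
    have h1 := F.hasDerivAt_variationMomentum (hΓ.smooth 0 h0 t ht')
      (by rw [hΓ.base t ht']; exact hp) (hΓ.admissible 0 h0 t ht') hP
    rw [heq'.deriv.self_of_nhds, hΓ.base t ht', sub_self] at h1
    simpa using h1
  have h3 := intervalIntegral.integral_eq_sub_of_hasDerivAt_of_le hab.le hθ hθ' hint
  have hev : ∀ᶠ s in 𝓝 (0 : ℝ), s ∈ Ioo (-ε) ε := Ioo_mem_nhds h0.1 h0.2
  rw [F.variationMomentum_eq_zero (hev.mono fun s hs => hΓ.left s hs),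
    F.variationMomentum_eq_zero (hev.mono fun s hs => hΓ.right s hs), sub_self] at h3
  rw [h3] at hder
  simpa only [energy_eq] using hder

end PseudoFinsler

end Variations

section GeodesicEquation

variable {E : Type*} [NormedAddCommGroup E] [NormedSpace ℝ E]
  {M : Type*} [TopologicalSpace M] [ChartedSpace E M] [IsManifold 𝓘(ℝ, E) ∞ M]

namespace PseudoFinsler

variable {F : PseudoFinsler E M} {p : M}

theorem tcoord_velocity_mem {γ : ℝ → M} {t : ℝ} (hγ : ContMDiffAt 𝓘(ℝ, ℝ) 𝓘(ℝ, E) ∞ γ t)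
    (hp : γ t ∈ (extChartAt 𝓘(ℝ, E) p).source) :
    (extChartAt 𝓘(ℝ, E) p (γ t), deriv (fun r => extChartAt 𝓘(ℝ, E) p (γ r)) t) ∈ F.coordDom p ↔
      velocity (E := E) γ t ∈ F.dom := by
  rw [← (eventually_tcoord_velocity hγ hp).self_of_nhds.2]
  exact F.tcoord_mem_iff (z := velocity γ t) hp

theorem coord_velocity {γ : ℝ → M} {t : ℝ} (hγ : ContMDiffAt 𝓘(ℝ, ℝ) 𝓘(ℝ, E) ∞ γ t)
    (hp : γ t ∈ (extChartAt 𝓘(ℝ, E) p).source) :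
    F.coord p (extChartAt 𝓘(ℝ, E) p (γ t), deriv (fun r => extChartAt 𝓘(ℝ, E) p (γ r)) t) =
      F.toFun (velocity (E := E) γ t) := by
  rw [← (eventually_tcoord_velocity hγ hp).self_of_nhds.2]
  exact F.coord_tcoord (z := velocity γ t) hp

/-- Geodesics satisfy the Euler–Lagrange equation of the energy in every chart. If they did not at
some time, then variations in a fixed direction, cut off by a bump function, would change the
energy to first order. -/
theorem IsGeodesicOn.isELAt {γ : ℝ → M} {J : Set ℝ} (hJ : IsOpen J) (h : F.IsGeodesicOn γ J)
    {t : ℝ} (ht : t ∈ J) (hp : γ t ∈ (extChartAt 𝓘(ℝ, E) p).source) :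
    IsELAt (energyLagrangian (F.coord p)) (fun r => extChartAt 𝓘(ℝ, E) p (γ r)) t := by
  set φ := extChartAt 𝓘(ℝ, E) p with hφ
  set c : ℝ → E := fun r => φ (γ r) with hc
  set L := energyLagrangian (F.coord p) with hL
  set P : ℝ → E →L[ℝ] ℝ := fun r => fibreDeriv L (c r, deriv c r) with hP
  set X : ℝ → E →L[ℝ] ℝ := fun r => baseDeriv L (c r, deriv c r) with hX
  have hγ : ∀ r ∈ J, ContMDiffAt 𝓘(ℝ, ℝ) 𝓘(ℝ, E) ∞ γ r := fun r hr =>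
    h.smooth.contMDiffAt (hJ.mem_nhds hr)
  set S : Set ℝ := {r | r ∈ J ∧ γ r ∈ φ.source} with hS
  have hSn : ∀ r ∈ S, S ∈ 𝓝 r := fun r hr => Filter.inter_mem (hJ.mem_nhds hr.1)
    ((hγ r hr.1).continuousAt.preimage_mem_nhds ((isOpen_extChartAt_source p).mem_nhds hr.2))
  have hcS : ∀ r ∈ S, ContDiffAt ℝ ∞ c r := fun r hr =>
    contDiffAt_extChartAt_comp (hγ r hr.1) hr.2
  have hU : ∀ r ∈ S, (c r, deriv c r) ∈ F.coordDom p := fun r hr =>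
    (tcoord_velocity_mem (hγ r hr.1) hr.2).2 (h.admissible r hr.1)
  have hcd : ∀ r ∈ S, ContDiffAt ℝ ∞ (fun r => (c r, deriv c r)) r := fun r hr =>
    (hcS r hr).prodMk (contDiffAt_deriv (m := ∞) (hcS r hr) (by simp))
  have hLS : ∀ r ∈ S, ContDiffAt ℝ ∞ L (c r, deriv c r) := fun r hr =>
    contDiffAt_energyLagrangian ((F.isFinslerOn_coord p).contDiffAt (hU r hr))
  have hPS : ∀ r ∈ S, ContDiffAt ℝ ∞ P r := fun r hr =>
    ContDiffAt.comp (g := fibreDeriv L) r (contDiffAt_fibreDeriv (m := ∞) (hLS r hr) (by simp))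
      (hcd r hr)
  have hXS : ∀ r ∈ S, ContinuousAt X r := fun r hr =>
    (ContDiffAt.comp (g := baseDeriv L) r
      (contDiffAt_baseDeriv (m := ∞) (hLS r hr) (by simp)) (hcd r hr)).continuousAt
  have hPd : ∀ r ∈ S, HasDerivAt P (deriv P r) r := fun r hr =>
    ((hPS r hr).differentiableAt (by simp)).hasDerivAt
  have hZS : ∀ r ∈ S, ContinuousAt (fun r => deriv P r - X r) r := fun r hr =>
    (contDiffAt_deriv (m := ∞) (hPS r hr) (by simp)).continuousAt.sub (hXS r hr)
  have htS : t ∈ S := ⟨ht, hp⟩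
  -- `e` is a direction in which the Euler–Lagrange expression is positive at time `t`
  by_contra hcon
  obtain ⟨e, he⟩ : ∃ e, 0 < (deriv P t - X t) e := by
    by_contra! hle
    refine hcon ?_
    have h0 : deriv P t = X t := by
      refine sub_eq_zero.1 (ContinuousLinearMap.ext fun e => le_antisymm (hle e) ?_)
      have := hle (-e)
      rw [map_neg] at this
      simpa using this
    have := hPd t htS
    rwa [h0] at this
  set ζ : ℝ → ℝ := fun r => (deriv P r - X r) e with hζ
  have hζS : ∀ r ∈ S, ContinuousAt ζ r := fun r hr => (hZS r hr).clm_apply continuousAt_const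
  obtain ⟨δ, hδ, hball⟩ := Metric.nhds_basis_closedBall.mem_iff.1
    (Filter.inter_mem (hSn t htS) ((hζS t htS).preimage_mem_nhds (Ioi_mem_nhds he)))
  rw [Real.closedBall_eq_Icc] at hball
  set a := t - δ with ha
  set b := t + δ with hb
  have hab : a < b := by linarith
  have hIS : ∀ r ∈ Icc a b, r ∈ S := fun r hr => (hball hr).1
  have hζpos : ∀ r ∈ Icc a b, 0 < ζ r := fun r hr => (hball hr).2
  let f : ContDiffBump t := ⟨δ / 2, δ, by linarith, by linarith⟩
  have hfa : f a = 0 := f.zero_of_le_dist (by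
    change δ ≤ _
    rw [Real.dist_eq, ha, sub_sub_cancel_left, abs_neg, abs_of_pos hδ])
  have hfb : f b = 0 := f.zero_of_le_dist (by
    change δ ≤ _
    rw [Real.dist_eq, hb, add_sub_cancel_left, abs_of_pos hδ])
  have hft : f t = 1 := f.one_of_mem_closedBall (Metric.mem_closedBall_self (by
    change 0 ≤ δ / 2
    linarith))
  have hfs : ContDiff ℝ ∞ f := f.contDiff (n := ⊤)
  -- the variation `c + s f e`, in coordinates
  let C : ℝ × ℝ → E := fun q => c q.2 + (q.1 * f q.2) • e
  let Γ : ℝ × ℝ → M := fun q => φ.symm (C q)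
  have hCs : ∀ q : ℝ × ℝ, q.2 ∈ S → ContDiffAt ℝ ∞ C q := fun q hq =>
    (ContDiffAt.comp q (hcS q.2 hq) contDiffAt_snd).add ((contDiffAt_fst.mul
      (ContDiffAt.comp q hfs.contDiffAt contDiffAt_snd)).smul contDiffAt_const)
  have hC0 : ∀ r, C (0, r) = c r := fun r => by simp [C]
  have hCd0 : ∀ r ∈ S, fderiv ℝ C (0, r) (0, 1) = deriv c r := by
    intro r hr
    have h1 := hasDerivAt_snd_param ((hCs (0, r) hr).differentiableAt (by simp))
    simp only [hC0] at h1
    exact h1.deriv.symm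
  have hgood : ∀ᶠ s in 𝓝 (0 : ℝ), ∀ r ∈ Icc a b,
      (C (s, r), fderiv ℝ C (s, r) (0, 1)) ∈ F.coordDom p := by
    refine isCompact_Icc.eventually_forall_of_forall_eventually
      (P := fun s r => (C (s, r), fderiv ℝ C (s, r) (0, 1)) ∈ F.coordDom p) fun r hr => ?_
    have h1 := hCs (0, r) (hIS r hr)
    have h2 : ContinuousAt (fun q => (C q, fderiv ℝ C q (0, 1))) (0, r) :=
      h1.continuousAt.prodMk ((h1.fderiv_right (m := 0) (by simp)).clm_apply
        contDiffAt_const).continuousAt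
    refine h2.eventually ((F.isFinslerOn_coord p).isOpen.mem_nhds ?_)
    change (C (0, r), fderiv ℝ C (0, r) (0, 1)) ∈ F.coordDom p
    rw [hC0, hCd0 r (hIS r hr)]
    exact hU r (hIS r hr)
  obtain ⟨ε, hε, hεg⟩ := Metric.eventually_nhds_iff_ball.1 hgood
  simp only [Real.ball_eq_Ioo, zero_sub, zero_add] at hεg
  have h0 : (0 : ℝ) ∈ Ioo (-ε) ε := ⟨by linarith, hε⟩
  have hφC : ∀ q : ℝ × ℝ, C q ∈ φ.target → φ (Γ q) = C q := fun q hq => φ.right_inv hq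
  have hφC' : ∀ q : ℝ × ℝ, q.2 ∈ S → C q ∈ φ.target → (fun q => φ (Γ q)) =ᶠ[𝓝 q] C := by
    intro q hq hq'
    filter_upwards [(hCs q hq).continuousAt.preimage_mem_nhds
      ((isOpen_extChartAt_target p).mem_nhds hq')] with q' h1 using hφC q' h1
  have hΓs : ∀ s ∈ Ioo (-ε) ε, ∀ r ∈ Icc a b,
      ContMDiffAt 𝓘(ℝ, ℝ × ℝ) 𝓘(ℝ, E) ∞ Γ (s, r) := by
    intro s hs r hr
    have h1 : C (s, r) ∈ φ.target := (hεg s hs r hr).1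
    have h2 := (contMDiffOn_extChartAt_symm (I := 𝓘(ℝ, E)) (n := ∞) p).contMDiffAt
      ((isOpen_extChartAt_target p).mem_nhds h1)
    exact h2.comp (s, r) (hCs (s, r) (hIS r hr)).contMDiffAt
  have hΓ0 : ∀ r ∈ S, Γ (0, r) = γ r := fun r hr => by
    simp only [Γ, hC0]
    exact φ.left_inv hr.2
  have hvar : F.IsProperVariation γ a b ε Γ := by
    refine ⟨hΓs, fun r hr => hΓ0 r (hIS r hr), fun s _ => ?_, fun s _ => ?_, fun s hs r hr => ?_⟩
    · simp only [Γ, C, hfa, mul_zero, zero_smul, add_zero]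
      exact φ.left_inv (hIS a ⟨le_rfl, hab.le⟩).2
    · simp only [Γ, C, hfb, mul_zero, zero_smul, add_zero]
      exact φ.left_inv (hIS b ⟨hab.le, le_rfl⟩).2
    · have h1 := hεg s hs r hr
      have h2 : Γ (s, r) ∈ φ.source := φ.map_target h1.1
      refine (F.tcoord_mem_iff (p := p) (z := velocity (fun t' => Γ (s, t')) r) h2).1 ?_
      have h3 := (eventually_tcoord_velocity_family (hΓs s hs r hr) h2).self_of_nhds.2.1
      rw [← hφ, (hφC' (s, r) (hIS r hr) h1.1).fderiv_eq, hφC _ h1.1] at h3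
      rw [← h3] at h1
      exact h1
  obtain ⟨hint, hder⟩ := hasDerivAt_integral_param hab.le hε (H := F.energyDensity Γ)
    fun s hs r hr => (F.contDiffAt_energyDensity (hΓs s hs r hr)
      (hvar.admissible s hs r hr)).of_le (by simp)
  have hzero : ∫ r in a..b, fderiv ℝ (F.energyDensity Γ) (0, r) (1, 0) = 0 := by
    have h1 := h.critical a b hab (fun r hr => (hIS r hr).1) ε hε Γ hvar
    simp only [energy_eq] at h1
    exact hder.unique h1
  -- the momentum vanishes at both ends, and the first variation of the energy is zero, so the
  -- integral of `ζ f` would be zero too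
  have hθ : ∀ r ∈ Icc a b, HasDerivAt (F.variationMomentum Γ)
      (fderiv ℝ (F.energyDensity Γ) (0, r) (1, 0) + ζ r * f r) r := by
    intro r hr
    have hrS := hIS r hr
    have h1 : C (0, r) ∈ φ.target := (hεg 0 h0 r hr).1
    have heq : (fun r => φ (Γ (0, r))) =ᶠ[𝓝 r] c := by
      filter_upwards [hSn r hrS] with r' hr'
      rw [hΓ0 r' hr']
    have hP' : HasDerivAt (fun r => fibreDeriv L (φ (Γ (0, r)), deriv (fun r => φ (Γ (0, r))) r))
        (deriv P r) r := by
      refine (hPd r hrS).congr_of_eventuallyEq ?_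
      filter_upwards [heq, heq.deriv] with r' h2 h3
      rw [h2, h3]
    have h2 := F.hasDerivAt_variationMomentum (hΓs 0 h0 r hr)
      (by rw [hΓ0 r hrS]; exact hrS.2) (hvar.admissible 0 h0 r hr) hP'
    have h3 : deriv (fun s => φ (Γ (s, r))) 0 = f r • e := by
      have h4 : HasDerivAt (fun s : ℝ => C (s, r)) (f r • e) 0 := by
        have := ((hasDerivAt_id (0 : ℝ)).mul_const (f r)).smul_const e
        rw [one_mul] at this
        exact this.const_add (c r)
      have h5 : Tendsto (fun s : ℝ => (s, r)) (𝓝 0) (𝓝 (0, r)) :=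
        (Continuous.prodMk_left r).tendsto 0
      exact (h4.congr_of_eventuallyEq (h5.eventually (hφC' (0, r) hrS h1))).deriv
    rw [← hφ, h3, heq.deriv.self_of_nhds, hΓ0 r hrS, map_smul, smul_eq_mul, mul_comm (f r)] at h2
    exact h2
  have hζf : ContinuousOn (fun r => ζ r * f r) (Icc a b) := fun r hr =>
    ((hζS r (hIS r hr)).mul f.continuous.continuousAt).continuousWithinAt
  have hint' : IntervalIntegrable (fun r => ζ r * f r) volume a b :=
    (by rwa [uIcc_of_le hab.le] : ContinuousOn _ (uIcc a b)).intervalIntegrable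
  have h4 := intervalIntegral.integral_eq_sub_of_hasDerivAt_of_le hab.le
    (fun r hr => (hθ r hr).continuousAt.continuousWithinAt)
    (fun r hr => hθ r (Ioo_subset_Icc_self hr)) (hint.add hint')
  have hev : ∀ᶠ s in 𝓝 (0 : ℝ), s ∈ Ioo (-ε) ε := Ioo_mem_nhds h0.1 h0.2
  rw [F.variationMomentum_eq_zero (hev.mono fun s hs => hvar.left s hs),
    F.variationMomentum_eq_zero (hev.mono fun s hs => hvar.right s hs), sub_self,
    intervalIntegral.integral_add hint hint', hzero, zero_add] at h4
  have h5 : 0 < ∫ r in a..b, ζ r * f r := by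
    refine intervalIntegral.integral_pos hab hζf
      (fun r hr => mul_nonneg (hζpos r (Ioc_subset_Icc_self hr)).le f.nonneg) ⟨t, ?_, ?_⟩
    · exact ⟨by linarith, by linarith⟩
    · rw [hft, mul_one]
      exact he
  exact h5.ne' h4

end PseudoFinsler

end GeodesicEquation

section GeodesicProperties

theorem IsFinslerOn.isELAt_energyLagrangian_comp {E : Type*} [NormedAddCommGroup E]
    [NormedSpace ℝ E] {G : E × E → ℝ} {U : Set (E × E)} (h : IsFinslerOn G U) {c : ℝ → E}
    {k d t : ℝ} (hk : 0 < k) (hc : ContDiffAt ℝ ∞ c (k * t + d))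
    (hm : (c (k * t + d), deriv c (k * t + d)) ∈ U)
    (hEL : IsELAt (energyLagrangian G) c (k * t + d)) :
    IsELAt (energyLagrangian G) (fun r => c (k * r + d)) t := by
  have hf : ∀ r, HasDerivAt (fun r : ℝ => k * r + d) k r := fun r => by
    simpa using ((hasDerivAt_id r).const_mul k).add_const d
  have hft : Tendsto (fun r : ℝ => k * r + d) (𝓝 t) (𝓝 (k * t + d)) := (hf t).continuousAt
  have hcd : ∀ᶠ r in 𝓝 (k * t + d), DifferentiableAt ℝ c r :=
    eventually_differentiableAt hc
  have hder : ∀ᶠ r in 𝓝 t, deriv (fun r => c (k * r + d)) r = k • deriv c (k * r + d) := by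
    filter_upwards [hft.eventually hcd] with r hr
    exact (hr.hasDerivAt.scomp r (hf r)).deriv
  have hfib : (fun r => fibreDeriv (energyLagrangian G)
      (c (k * r + d), deriv (fun r => c (k * r + d)) r)) =ᶠ[𝓝 t]
      fun r => k • fibreDeriv (energyLagrangian G) (c (k * r + d), deriv c (k * r + d)) := by
    filter_upwards [hder, hft.eventually (h.eventually_mem_curve hc hm)] with r h1 h2
    rw [h1, fibreDeriv_energyLagrangian (h.differentiableAt (h.conic _ _ k hk h2)),
      fibreDeriv_energyLagrangian (h.differentiableAt h2), h.fibreDeriv_smul h2 hk,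
      h.homogeneous _ _ k hk h2, smul_smul]
  rw [IsELAt, hfib.hasDerivAt_iff, hder.self_of_nhds,
    baseDeriv_energyLagrangian (h.differentiableAt (h.conic _ _ k hk hm)),
    h.baseDeriv_smul hm hk, h.homogeneous _ _ k hk hm]
  have hEL' : HasDerivAt (fun r => fibreDeriv (energyLagrangian G) (c r, deriv c r))
    (baseDeriv (energyLagrangian G) (c (k * t + d), deriv c (k * t + d))) (k * t + d) := hEL
  refine ((hEL'.scomp t (hf t)).const_smul k).congr_deriv ?_
  rw [baseDeriv_energyLagrangian (h.differentiableAt hm), smul_smul, smul_smul, smul_smul]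
  congr 1
  ring

variable {E : Type*} [NormedAddCommGroup E] [NormedSpace ℝ E]
  {M : Type*} [TopologicalSpace M] [ChartedSpace E M]

theorem velocity_congr {γ₁ γ₂ : ℝ → M} {t : ℝ} (h : γ₁ =ᶠ[𝓝 t] γ₂) :
    velocity (E := E) γ₁ t = velocity γ₂ t := by
  have h1 : (γ₁ t : M) = γ₂ t := h.self_of_nhds
  have h2 := h.mfderiv_eq (I := 𝓘(ℝ, ℝ)) (I' := 𝓘(ℝ, E))
  rw [velocity, velocity, velocityVec, velocityVec]
  refine Bundle.TotalSpace.ext h1 ?_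
  simp only
  rw [h2]
  rfl

/-- The velocity of a reparametrized curve. -/
theorem velocity_comp {γ : ℝ → M} {f : ℝ → ℝ} {k t : ℝ} (hf : HasDerivAt f k t)
    (hγ : MDifferentiableAt 𝓘(ℝ, ℝ) 𝓘(ℝ, E) γ (f t)) :
    velocity (E := E) (fun r => γ (f r)) t = ⟨γ (f t), k • velocityVec γ (f t)⟩ := by
  have h1 : MDifferentiableAt 𝓘(ℝ, ℝ) 𝓘(ℝ, ℝ) f t := hf.differentiableAt.mdifferentiableAt
  have h2 := mfderiv_comp t hγ h1
  rw [mfderiv_eq_fderiv] at h2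
  let A : ℝ →L[ℝ] E := mfderiv 𝓘(ℝ, ℝ) 𝓘(ℝ, E) γ (f t)
  have h3 : mfderiv 𝓘(ℝ, ℝ) 𝓘(ℝ, E) (γ ∘ f) t (1 : ℝ) = A (fderiv ℝ f t 1) :=
    congrArg (fun B : ℝ →L[ℝ] E => B 1) h2
  have h4 : A k = k • A 1 := by rw [← map_smul, smul_eq_mul, mul_one]
  have h5 : fderiv ℝ f t 1 = k := fderiv_apply_one_eq_deriv.trans hf.deriv
  rw [h5, h4] at h3
  exact congrArg (fun v => (⟨γ (f t), v⟩ : TangentBundle 𝓘(ℝ, E) M)) h3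

variable [IsManifold 𝓘(ℝ, E) ∞ M] {F : PseudoFinsler E M} {γ γ₁ γ₂ : ℝ → M} {J J' : Set ℝ} {p : M}

/-- Tangent vectors over the chart domain are determined by their coordinates. -/
theorem eq_of_tcoord_eq {z₁ z₂ : TangentBundle 𝓘(ℝ, E) M}
    (h₁ : z₁.1 ∈ (extChartAt 𝓘(ℝ, E) p).source) (h₂ : z₂.1 ∈ (extChartAt 𝓘(ℝ, E) p).source)
    (h : tcoord p z₁ = tcoord p z₂) : z₁ = z₂ := by
  rw [← tcoordSymm_tcoord h₁, h, tcoordSymm_tcoord h₂]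

namespace PseudoFinsler

theorem IsGeodesicOn.contMDiffAt (h : F.IsGeodesicOn γ J) (hJ : IsOpen J) {t : ℝ} (ht : t ∈ J) :
    ContMDiffAt 𝓘(ℝ, ℝ) 𝓘(ℝ, E) ∞ γ t := h.smooth.contMDiffAt (hJ.mem_nhds ht)

theorem IsGeodesicOn.mono (h : F.IsGeodesicOn γ J) (hJ : J' ⊆ J) : F.IsGeodesicOn γ J' :=
  ⟨h.smooth.mono hJ, fun t ht => h.admissible t (hJ ht), fun a b hab hsub =>
    h.critical a b hab (hsub.trans hJ)⟩

theorem IsUnitGeodesicOn.mono (h : F.IsUnitGeodesicOn γ J) (hJ : J' ⊆ J) :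
    F.IsUnitGeodesicOn γ J' := ⟨h.1.mono hJ, fun t ht => h.2 t (hJ ht)⟩

theorem IsGeodesicOn.comp_affine (h : F.IsGeodesicOn γ J) (hJ : IsOpen J) {k : ℝ} (hk : 0 < k)
    (d : ℝ) : F.IsGeodesicOn (fun t => γ (k * t + d)) ((fun t => k * t + d) ⁻¹' J) := by
  have hf : ∀ r, HasDerivAt (fun r : ℝ => k * r + d) k r := fun r => by
    simpa using ((hasDerivAt_id r).const_mul k).add_const d
  have hfs : ContDiff ℝ ∞ (fun r : ℝ => k * r + d) := by fun_prop
  refine isGeodesicOn_of_isELAt (h.smooth.comp hfs.contMDiff.contMDiffOn fun t ht => ht)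
    (fun t ht => ?_) fun t ht => ?_
  · rw [velocity_comp (hf t) ((h.contMDiffAt hJ ht).mdifferentiableAt (by simp))]
    exact F.conic _ _ k hk (h.admissible _ ht)
  · have hp : γ (k * t + d) ∈ (extChartAt 𝓘(ℝ, E) (γ (k * t + d))).source :=
      mem_extChartAt_source _
    exact ⟨_, hp, (F.isFinslerOn_coord _).isELAt_energyLagrangian_comp hk
      (contDiffAt_extChartAt_comp (h.contMDiffAt hJ ht) hp)
      ((tcoord_velocity_mem (h.contMDiffAt hJ ht) hp).2 (h.admissible _ ht))
      (h.isELAt hJ ht hp)⟩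

/-- Geodesics have constant speed. -/
theorem IsGeodesicOn.speed_eq (h : F.IsGeodesicOn γ J) (hJ : IsOpen J) (hJc : J.OrdConnected)
    {t t' : ℝ} (ht : t ∈ J) (ht' : t' ∈ J) :
    F.toFun (velocity (E := E) γ t) = F.toFun (velocity (E := E) γ t') := by
  set g : ℝ → ℝ := fun r => F.toFun (velocity (E := E) γ r) ^ 2 / 2 with hg
  have hd : ∀ r ∈ J, HasDerivAt g 0 r := by
    intro r hr
    have hγ := h.contMDiffAt hJ hr
    have hp : γ r ∈ (extChartAt 𝓘(ℝ, E) (γ r)).source := mem_extChartAt_source _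
    refine ((F.isFinslerOn_coord (γ r)).hasDerivAt_energy_of_isELAt
      (contDiffAt_extChartAt_comp hγ hp) ((tcoord_velocity_mem hγ hp).2 (h.admissible r hr))
      (h.isELAt hJ hr hp)).congr_of_eventuallyEq ?_
    filter_upwards [eventually_tcoord_velocity hγ hp] with r' hr'
    rw [energyLagrangian, ← hr'.2, F.coord_tcoord hr'.1]
  have h1 : g t = g t' := hJ.is_const_of_deriv_eq_zero hJc.isPreconnected
    (fun r hr => (hd r hr).differentiableAt.differentiableWithinAt)
    (fun r hr => (hd r hr).deriv) ht ht'
  have h2 : F.toFun (velocity (E := E) γ t) ^ 2 = F.toFun (velocity (E := E) γ t') ^ 2 := by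
    simp only [hg] at h1
    linarith
  exact (sq_eq_sq₀ (F.pos _ (h.admissible t ht)).le (F.pos _ (h.admissible t' ht')).le).1 h2

/-- For a curve of unit speed, the Euler–Lagrange equations of `F²/2` and of `F` agree. -/
theorem isELAt_energyLagrangian_coord_iff (hJ : IsOpen J)
    (hγ : ContMDiffOn 𝓘(ℝ, ℝ) 𝓘(ℝ, E) ∞ γ J) (hadm : ∀ t ∈ J, velocity (E := E) γ t ∈ F.dom)
    (hone : ∀ t ∈ J, F.toFun (velocity (E := E) γ t) = 1) {t : ℝ} (ht : t ∈ J)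
    (hp : γ t ∈ (extChartAt 𝓘(ℝ, E) p).source) :
    IsELAt (energyLagrangian (F.coord p)) (fun r => extChartAt 𝓘(ℝ, E) p (γ r)) t ↔
      IsELAt (F.coord p) (fun r => extChartAt 𝓘(ℝ, E) p (γ r)) t := by
  have hγt := hγ.contMDiffAt (hJ.mem_nhds ht)
  refine isELAt_energyLagrangian_iff one_ne_zero ?_ ?_
  · filter_upwards [hJ.mem_nhds ht, hγt.continuousAt.preimage_mem_nhds
      ((isOpen_extChartAt_source p).mem_nhds hp)] with r h1 h2
    exact (F.isFinslerOn_coord p).differentiableAt ((tcoord_velocity_mem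
      (hγ.contMDiffAt (hJ.mem_nhds h1)) h2).2 (hadm r h1))
  · filter_upwards [hJ.mem_nhds ht, eventually_tcoord_velocity hγt hp] with r h1 h2
    rw [← h2.2, F.coord_tcoord h2.1, hone r h1]

theorem IsUnitGeodesicOn.isELAt (h : F.IsUnitGeodesicOn γ J) (hJ : IsOpen J) {t : ℝ} (ht : t ∈ J)
    (hp : γ t ∈ (extChartAt 𝓘(ℝ, E) p).source) :
    IsELAt (F.coord p) (fun r => extChartAt 𝓘(ℝ, E) p (γ r)) t :=
  (isELAt_energyLagrangian_coord_iff hJ h.1.smooth h.1.admissible h.2 ht hp).1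
    (h.1.isELAt hJ ht hp)

theorem isUnitGeodesicOn_of_isELAt (hJ : IsOpen J)
    (hγ : ContMDiffOn 𝓘(ℝ, ℝ) 𝓘(ℝ, E) ∞ γ J) (hadm : ∀ t ∈ J, velocity (E := E) γ t ∈ F.dom)
    (hone : ∀ t ∈ J, F.toFun (velocity (E := E) γ t) = 1)
    (hEL : ∀ t ∈ J, ∃ p, γ t ∈ (extChartAt 𝓘(ℝ, E) p).source ∧
      IsELAt (F.coord p) (fun r => extChartAt 𝓘(ℝ, E) p (γ r)) t) : F.IsUnitGeodesicOn γ J := by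
  refine ⟨isGeodesicOn_of_isELAt hγ hadm fun t ht => ?_, hone⟩
  obtain ⟨p, hp, hE⟩ := hEL t ht
  exact ⟨p, hp, (isELAt_energyLagrangian_coord_iff hJ hγ hadm hone ht hp).2 hE⟩

end PseudoFinsler

end GeodesicProperties

/-! ### The flow in coordinates -/

section LocalCorrespondence

variable {E : Type*} [NormedAddCommGroup E] [NormedSpace ℝ E] [FiniteDimensional ℝ E]

/-- The local form of the correspondence between geodesics. Here `Ψ` is the flow of `w`, which
rescales `G₁` to `G₂` by the factor `e^{-σt}`. By `flow_transport`, the Euler–Lagrange expression of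
`c` and the expression `Z` of `isELAt_zermelo_iff` for `x = Ψ(·, c)` differ by the linear map
`∂Ψ/∂x`, which is invertible by the non-degeneracy of the metric. -/
theorem forall_flow_eq_zero_iff_isELAt {G₁ G₂ : E × E → ℝ} {U : Set (E × E)} {Ψ : ℝ × E → E}
    {w : E → E} {c x : ℝ → E} {t σ : ℝ} (h₁ : IsFinslerOn G₁ U) (hc : ContDiffAt ℝ ∞ c t)
    (hm : (c t, deriv c t) ∈ U) (hΨ : ContDiffAt ℝ ∞ Ψ (t, c t))
    (hx : x =ᶠ[𝓝 t] fun r => Ψ (r, c r))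
    (hw : ContDiffAt ℝ ∞ w (x t)) (hG₂ : ContDiffAt ℝ ∞ G₂ (x t, deriv x t - w (x t)))
    (hflow : ∀ᶠ q in 𝓝 (t, c t), fderiv ℝ Ψ q (1, 0) = w (Ψ q))
    (hhom : ∀ᶠ z : ℝ × E × E in 𝓝 (t, c t, deriv c t),
      G₂ (Ψ (z.1, z.2.1), fderiv ℝ Ψ (z.1, z.2.1) (0, z.2.2)) =
        Real.exp (-(σ * z.1)) * G₁ (z.2.1, z.2.2)) {P₂ : E →L[ℝ] ℝ}
    (hP₂ : HasDerivAt (fun r => fibreDeriv G₂ (x r, deriv x r - w (x r))) P₂ t) :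
    (∀ k, (P₂ - baseDeriv G₂ (x t, deriv x t - w (x t))) k +
      fibreDeriv G₂ (x t, deriv x t - w (x t)) (fderiv ℝ w (x t) k + σ • k) = 0) ↔
        IsELAt G₁ c t := by
  have tc : Tendsto (fun r => (r, c r)) (𝓝 t) (𝓝 (t, c t)) :=
    tendsto_id.prodMk_nhds hc.continuousAt.tendsto
  have hxt : x t = Ψ (t, c t) := hx.self_of_nhds
  have hvel : ∀ᶠ r in 𝓝 t, x r = Ψ (r, c r) ∧
      deriv x r - w (x r) = fderiv ℝ Ψ (r, c r) (0, deriv c r) := by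
    filter_upwards [tc.eventually (eventually_differentiableAt hΨ), eventually_differentiableAt hc,
      tc.eventually hflow, hx, hx.deriv] with r h2 h3 h4 h5 h6
    have h7 : HasDerivAt (fun r => Ψ (r, c r)) (fderiv ℝ Ψ (r, c r) (1, deriv c r)) r :=
      h2.hasFDerivAt.comp_hasDerivAt r ((hasDerivAt_id r).prodMk h3.hasDerivAt)
    have h8 : ((1 : ℝ), deriv c r) = (1, 0) + (0, deriv c r) := by simp
    refine ⟨h5, ?_⟩
    rw [h6, h7.deriv, h8, map_add, h4, h5, add_sub_cancel_left]
  have hv := hvel.self_of_nhds.2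
  have hG₁ : ContDiffAt ℝ ∞ G₁ (c t, deriv c t) := h₁.contDiffAt hm
  have hP₁ := (differentiableAt_fibreDeriv_curve (hc.of_le ENat.LEInfty.out)
    (hG₁.of_le ENat.LEInfty.out)).hasDerivAt
  rw [hv, hxt] at hG₂ ⊢
  rw [hxt] at hw
  have htrans := flow_transport hc hΨ hw hG₁ hG₂ hflow hhom hP₁ (hP₂.congr_of_eventuallyEq
    (hvel.mono fun r hr => by beta_reduce; rw [hr.2, hr.1]))
  have hA : ∀ᶠ u in 𝓝 (deriv c t), G₂ (Ψ (t, c t), ((fderiv ℝ Ψ (t, c t)).comp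
      (ContinuousLinearMap.inr ℝ ℝ E)) u) = Real.exp (-(σ * t)) * G₁ (c t, u) := by
    have h2 : Tendsto (fun u : E => (t, c t, u)) (𝓝 (deriv c t)) (𝓝 (t, c t, deriv c t)) :=
      (by fun_prop : Continuous fun u : E => (t, c t, u)).tendsto _
    exact h2.eventually hhom
  have hsurj : Function.Surjective ((fderiv ℝ Ψ (t, c t)).comp (ContinuousLinearMap.inr ℝ ℝ E)) :=
    LinearMap.injective_iff_surjective.1
      (h₁.injective_of_homothety hm _ (Real.exp_pos _) hA)
  constructor
  · intro h
    have h2 : deriv (fun r => fibreDeriv G₁ (c r, deriv c r)) t =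
        baseDeriv G₁ (c t, deriv c t) := by
      refine sub_eq_zero.1 (ContinuousLinearMap.ext fun η => ?_)
      have h3 := htrans η
      rw [h] at h3
      exact (mul_eq_zero.1 h3.symm).resolve_left (Real.exp_pos _).ne'
    rw [IsELAt, ← h2]
    exact hP₁
  · intro h k
    obtain ⟨η, rfl⟩ := hsurj k
    have h2 : deriv (fun r => fibreDeriv G₁ (c r, deriv c r)) t =
      baseDeriv G₁ (c t, deriv c t) := hP₁.unique h
    have h3 := htrans η
    rw [h2, sub_self, zero_apply, mul_zero] at h3
    exact h3

end LocalCorrespondence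

section CoordFlow

variable {E : Type*} [NormedAddCommGroup E] [NormedSpace ℝ E]
  {M : Type*} [TopologicalSpace M] [ChartedSpace E M]

/-- The flow of a vector field, from the chart at `p` to the chart at `q`. -/
def coordFlow (W : (x : M) → TangentSpace 𝓘(ℝ, E) x) (p q : M) (z : ℝ × E) : E :=
  extChartAt 𝓘(ℝ, E) q (flow W z.1 ((extChartAt 𝓘(ℝ, E) p).symm z.2))

/-- The domain of the flow from the chart at `p` to the chart at `q`. -/
def coordFlowDomain (W : (x : M) → TangentSpace 𝓘(ℝ, E) x) (p q : M) : Set (ℝ × E) :=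
  {z | z.2 ∈ (extChartAt 𝓘(ℝ, E) p).target ∧
    (z.1, (extChartAt 𝓘(ℝ, E) p).symm z.2) ∈ flowDomain W ∧
    flow W z.1 ((extChartAt 𝓘(ℝ, E) p).symm z.2) ∈ (extChartAt 𝓘(ℝ, E) q).source}

theorem mem_coordFlowDomain {W : (x : M) → TangentSpace 𝓘(ℝ, E) x} {p q x : M} {t : ℝ}
    (hx : x ∈ (extChartAt 𝓘(ℝ, E) p).source) (ht : (t, x) ∈ flowDomain W)
    (hq : flow W t x ∈ (extChartAt 𝓘(ℝ, E) q).source) :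
    (t, extChartAt 𝓘(ℝ, E) p x) ∈ coordFlowDomain W p q ∧
      coordFlow W p q (t, extChartAt 𝓘(ℝ, E) p x) = extChartAt 𝓘(ℝ, E) q (flow W t x) := by
  rw [coordFlowDomain, mem_ofPred_eq, coordFlow, (extChartAt 𝓘(ℝ, E) p).left_inv hx]
  exact ⟨⟨(extChartAt 𝓘(ℝ, E) p).map_source hx, ht, hq⟩, rfl⟩

variable [FiniteDimensional ℝ E] [IsManifold 𝓘(ℝ, E) ∞ M] [T2Space M]
  {W : (x : M) → TangentSpace 𝓘(ℝ, E) x}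
  (hW : ContMDiff 𝓘(ℝ, E) 𝓘(ℝ, E).tangent ∞
    (fun x => (⟨x, W x⟩ : TangentBundle 𝓘(ℝ, E) M)))
  {p q : M} {z : ℝ × E}

include hW

theorem contMDiffAt_coordFlow_aux (hz : z ∈ coordFlowDomain W p q) :
    ContMDiffAt 𝓘(ℝ, ℝ × E) 𝓘(ℝ, E) ∞
      (fun z : ℝ × E => flow W z.1 ((extChartAt 𝓘(ℝ, E) p).symm z.2)) z := by
  have h1 : ContMDiffAt 𝓘(ℝ, E) 𝓘(ℝ, E) ∞ (extChartAt 𝓘(ℝ, E) p).symm z.2 :=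
    (contMDiffOn_extChartAt_symm (I := 𝓘(ℝ, E)) (n := ∞) p).contMDiffAt
      ((isOpen_extChartAt_target p).mem_nhds hz.1)
  have h2 : ContMDiffAt 𝓘(ℝ, ℝ × E) 𝓘(ℝ, E) ∞ (fun z : ℝ × E =>
      (extChartAt 𝓘(ℝ, E) p).symm z.2) z :=
    h1.comp (I := 𝓘(ℝ, ℝ × E)) z contDiff_snd.contMDiff.contMDiffAt
  have h3 : ContMDiffAt 𝓘(ℝ, ℝ × E) 𝓘(ℝ, ℝ) ∞ (fun z : ℝ × E => z.1) z :=
    contDiff_fst.contMDiff.contMDiffAt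
  exact (flow_contMDiffAt hW hz.2.1).comp z (h3.prodMk h2)

theorem contDiffAt_coordFlow (hz : z ∈ coordFlowDomain W p q) :
    ContDiffAt ℝ ∞ (coordFlow W p q) z :=
  contDiffAt_extChartAt_comp (contMDiffAt_coordFlow_aux hW hz) hz.2.2

theorem isOpen_coordFlowDomain : IsOpen (coordFlowDomain W p q) := by
  rw [isOpen_iff_mem_nhds]
  intro z hz
  have h1 : ContinuousAt (extChartAt 𝓘(ℝ, E) p).symm z.2 :=
    ((contMDiffOn_extChartAt_symm (I := 𝓘(ℝ, E)) (n := ∞) p).contMDiffAt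
      ((isOpen_extChartAt_target p).mem_nhds hz.1)).continuousAt
  have h2 : ContinuousAt (fun z : ℝ × E => (z.1, (extChartAt 𝓘(ℝ, E) p).symm z.2)) z :=
    continuousAt_fst.prodMk (ContinuousAt.comp (f := Prod.snd) h1 continuousAt_snd)
  filter_upwards [continuousAt_snd.preimage_mem_nhds
      ((isOpen_extChartAt_target (I := 𝓘(ℝ, E)) p).mem_nhds hz.1),
    h2.preimage_mem_nhds ((isOpen_flowDomain hW).mem_nhds hz.2.1),
    (contMDiffAt_coordFlow_aux hW hz).continuousAt.preimage_mem_nhds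
      ((isOpen_extChartAt_source q).mem_nhds hz.2.2)] with z' h3 h4 h5
  exact ⟨h3, h4, h5⟩

theorem fderiv_coordFlow_time (hz : z ∈ coordFlowDomain W p q) :
    fderiv ℝ (coordFlow W p q) z (1, 0) = coordField W q (coordFlow W p q z) := by
  obtain ⟨t, y⟩ := z
  set x := (extChartAt 𝓘(ℝ, E) p).symm y with hx
  have h1 : HasMFDerivAt 𝓘(ℝ, ℝ) 𝓘(ℝ, E) (fun r => flow W r x) t
    ((1 : ℝ →L[ℝ] ℝ).smulRight (W (flow W t x))) :=
    (isMIntegralCurveAt_flow hW hz.2.1).self_of_nhds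
  have h2 := tcoord_velocity (p := q) h1.mdifferentiableAt hz.2.2
  have h3 : velocity (fun r => flow W r x) t =
      (⟨flow W t x, W (flow W t x)⟩ : TangentBundle 𝓘(ℝ, E) M) := by
    rw [velocity, velocityVec, h1.mfderiv]
    congr 1
    exact one_smul ℝ _
  rw [h3] at h2
  have h4 : HasDerivAt (fun r => coordFlow W p q (r, y))
      (fderiv ℝ (coordFlow W p q) (t, y) (1, 0)) t :=
    HasFDerivAt.comp_hasDerivAt (l := coordFlow W p q) t
      ((contDiffAt_coordFlow hW hz).differentiableAt (by simp)).hasFDerivAt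
      ((hasDerivAt_id t).prodMk (hasDerivAt_const t y))
  have h5 : coordField W q (coordFlow W p q (t, y)) = _ := coordField_apply hz.2.2
  rw [← h4.deriv, h5]
  exact (congrArg Prod.snd h2).symm

theorem coordFlow_zero {y : E} (hy : y ∈ (extChartAt 𝓘(ℝ, E) q).target) :
    (0, y) ∈ coordFlowDomain W q q ∧ coordFlow W q q (0, y) = y := by
  have h1 := (extChartAt 𝓘(ℝ, E) q).map_target hy
  have h2 := flow_zero_mem hW ((extChartAt 𝓘(ℝ, E) q).symm y)
  have h3 := mem_coordFlowDomain (p := q) (q := q) h1 h2.1 (by rwa [h2.2])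
  rwa [h2.2, (extChartAt 𝓘(ℝ, E) q).right_inv hy] at h3

/-- The coordinate expression of the differential of the flow. -/
theorem tcoord_mfderiv_flow (hz : z ∈ coordFlowDomain W p q)
    (v : TangentSpace 𝓘(ℝ, E) ((extChartAt 𝓘(ℝ, E) p).symm z.2)) :
    tcoord q ⟨flow W z.1 ((extChartAt 𝓘(ℝ, E) p).symm z.2),
        mfderiv 𝓘(ℝ, E) 𝓘(ℝ, E) (flow W z.1) ((extChartAt 𝓘(ℝ, E) p).symm z.2) v⟩ =
      (coordFlow W p q z, fderiv ℝ (coordFlow W p q) z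
        (0, (tcoord p ⟨(extChartAt 𝓘(ℝ, E) p).symm z.2, v⟩).2)) := by
  obtain ⟨t, y⟩ := z
  refine Prod.ext rfl ?_
  revert v
  set x := (extChartAt 𝓘(ℝ, E) p).symm y with hx
  intro v
  have hxs : x ∈ (extChartAt 𝓘(ℝ, E) p).source := (extChartAt 𝓘(ℝ, E) p).map_target hz.1
  have h1 : MDifferentiableAt 𝓘(ℝ, E) 𝓘(ℝ, E) (flow W t) x := by
    have h2 : ContMDiffAt 𝓘(ℝ, E) (𝓘(ℝ, ℝ).prod 𝓘(ℝ, E)) ∞ (fun x : M => (t, x)) x :=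
      contMDiffAt_const.prodMk contMDiffAt_id
    exact (ContMDiffAt.comp x (flow_contMDiffAt hW hz.2.1) h2).mdifferentiableAt (by simp)
  have h2 : MDifferentiableAt 𝓘(ℝ, E) 𝓘(ℝ, E) (extChartAt 𝓘(ℝ, E) q) (flow W t x) :=
    mdifferentiableAt_extChartAt (by have := hz.2.2; rwa [extChartAt_source] at this)
  have h3 : MDifferentiableAt 𝓘(ℝ, E) 𝓘(ℝ, E) (extChartAt 𝓘(ℝ, E) p) x :=
    mdifferentiableAt_extChartAt (by rwa [extChartAt_source] at hxs)
  have hpx : extChartAt 𝓘(ℝ, E) p x = y := (extChartAt 𝓘(ℝ, E) p).right_inv hz.1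
  have h4 : HasFDerivAt (fun y => coordFlow W p q (t, y)) ((fderiv ℝ (coordFlow W p q) (t, y)).comp
      (ContinuousLinearMap.inr ℝ ℝ E)) (extChartAt 𝓘(ℝ, E) p x) := by
    rw [hpx]
    exact HasFDerivAt.comp y ((contDiffAt_coordFlow hW hz).differentiableAt (by simp)).hasFDerivAt
      (hasFDerivAt_prodMk_right t y)
  have h5 : (extChartAt 𝓘(ℝ, E) q ∘ flow W t) =ᶠ[𝓝 x]
      (fun y => coordFlow W p q (t, y)) ∘ extChartAt 𝓘(ℝ, E) p := by
    filter_upwards [(isOpen_extChartAt_source p).mem_nhds hxs] with x' hx'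
    simp only [Function.comp_apply, coordFlow, (extChartAt 𝓘(ℝ, E) p).left_inv hx']
  have h6 := mfderiv_comp x h2 h1
  rw [h5.mfderiv_eq, mfderiv_comp x h4.differentiableAt.mdifferentiableAt h3,
    mfderiv_eq_fderiv, h4.fderiv] at h6
  exact (congrArg (fun A : E →L[ℝ] E => A v) h6).symm

/-- The homothety condition in coordinates. -/
theorem IsHomothetic.coordFlow {F : PseudoFinsler E M} {σ : ℝ} (hhom : IsHomothetic F W σ)
    (hz : z ∈ coordFlowDomain W p q) (v : E) :
    ((coordFlow W p q z, fderiv ℝ (coordFlow W p q) z (0, v)) ∈ F.coordDom q ↔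
        (z.2, v) ∈ F.coordDom p) ∧
      ((z.2, v) ∈ F.coordDom p →
        F.coord q (Zermelo.coordFlow W p q z, fderiv ℝ (Zermelo.coordFlow W p q) z (0, v)) =
          Real.exp (-(σ * z.1)) * F.coord p (z.2, v)) := by
  obtain ⟨v', hv'⟩ := exists_tcoord_eq hz.1 v
  have hs := (extChartAt 𝓘(ℝ, E) p).map_target hz.1
  have h1 := tcoord_mfderiv_flow hW hz v'
  rw [hv'] at h1
  simp only at h1
  have h2 := hhom z.1 _ hz.2.1 v'
  rw [← h1, ← hv', F.tcoord_mem_iff (z := ⟨flow W z.1 _, _⟩) hz.2.2,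
    F.tcoord_mem_iff (z := ⟨(extChartAt 𝓘(ℝ, E) p).symm z.2, v'⟩) hs,
    F.coord_tcoord (z := ⟨flow W z.1 _, _⟩) hz.2.2,
    F.coord_tcoord (z := ⟨(extChartAt 𝓘(ℝ, E) p).symm z.2, v'⟩) hs]
  exact h2

/-- The infinitesimal homothety condition in coordinates. -/
theorem IsHomothetic.coordField {F : PseudoFinsler E M} {σ : ℝ} (hhom : IsHomothetic F W σ)
    {x v : E} (hv : (x, v) ∈ F.coordDom q) :
    baseDeriv (F.coord q) (x, v) (coordField W q x) +
      fibreDeriv (F.coord q) (x, v) (fderiv ℝ (Zermelo.coordField W q) x v) =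
        -σ * F.coord q (x, v) := by
  have hT : (extChartAt 𝓘(ℝ, E) q).target ∈ 𝓝 x := (isOpen_extChartAt_target q).mem_nhds hv.1
  have h0 := coordFlow_zero hW (q := q) hv.1
  have hO : ∀ᶠ z in 𝓝 ((0 : ℝ), x), z ∈ coordFlowDomain W q q :=
    (isOpen_coordFlowDomain hW).mem_nhds h0.1
  have tt : Tendsto (fun t : ℝ => (t, x)) (𝓝 0) (𝓝 (0, x)) :=
    (Continuous.prodMk_left x).tendsto 0
  refine IsFinslerOn.infinitesimal_homothety (Ψ := Zermelo.coordFlow W q q)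
    ((F.isFinslerOn_coord q).differentiableAt hv)
    (((contDiffOn_coordField hW q).contDiffAt hT).differentiableAt (by simp))
    (contDiffAt_coordFlow hW h0.1) ?_ ?_ ?_
  · filter_upwards [hT] with y hy using (coordFlow_zero hW hy).2
  · filter_upwards [hO] with z hz using fderiv_coordFlow_time hW hz
  · filter_upwards [tt.eventually hO] with t ht using (hhom.coordFlow hW ht v).2 hv

end CoordFlow

/-! ### Translations, and curves transported by the flow -/

section Translation

variable {E : Type*} [NormedAddCommGroup E] [NormedSpace ℝ E]
  {M : Type*} [TopologicalSpace M] [ChartedSpace E M] [IsManifold 𝓘(ℝ, E) ∞ M]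
  {F F' : PseudoFinsler E M} {W : (x : M) → TangentSpace 𝓘(ℝ, E) x} {p q : M} {t : ℝ}

theorem PseudoFinsler.exists_of_mem_coordDom {x v : E} (h : (x, v) ∈ F.coordDom q) :
    ∃ z : TangentBundle 𝓘(ℝ, E) M, z.1 ∈ (extChartAt 𝓘(ℝ, E) q).source ∧ tcoord q z = (x, v) ∧
      z ∈ F.dom :=
  ⟨tcoordSymm q (x, v), tcoordSymm_fst_mem (q := (x, v)) h.1, tcoord_tcoordSymm (q := (x, v)) h.1,
    h.2⟩

/-- The relation `F(v - F'(v) W) = F'(v)` which characterizes translations, in coordinates. -/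
theorem IsTranslation.coord (htrans : IsTranslation F F' W) {x v : E}
    (hv : (x, v) ∈ F'.coordDom q) :
    (x, v - F'.coord q (x, v) • coordField W q x) ∈ F.coordDom q ∧
      F.coord q (x, v - F'.coord q (x, v) • coordField W q x) = F'.coord q (x, v) := by
  obtain ⟨⟨y, u⟩, hy, hz, hd⟩ := PseudoFinsler.exists_of_mem_coordDom hv
  have hpos := F'.pos _ hd
  obtain ⟨h1, h2⟩ := htrans y u hd
  have hc : F'.coord q (x, v) = F'.toFun ⟨y, u⟩ := by
    rw [← hz]
    exact F'.coord_tcoord hy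
  set l := F'.toFun ⟨y, u⟩ with hl
  have hx : extChartAt 𝓘(ℝ, E) q y = x := congrArg Prod.fst hz
  replace hy : y ∈ (extChartAt 𝓘(ℝ, E) q).source := hy
  have h3 : tcoord q ⟨y, l⁻¹ • u - W y⟩ = (x, l⁻¹ • v - coordField W q x) := by
    rw [tcoord_sub, tcoord_smul, hz, ← hx, coordField_apply hy]
  have hU : (x, l⁻¹ • v - coordField W q x) ∈ F.coordDom q := by
    rw [← h3]
    exact (F.tcoord_mem_iff (z := ⟨y, l⁻¹ • u - W y⟩) hy).2 h1
  have h4 := (F.isFinslerOn_coord q).homogeneous x _ l hpos hU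
  have h5 := (F.isFinslerOn_coord q).conic x _ l hpos hU
  rw [smul_sub, smul_smul, mul_inv_cancel₀ hpos.ne', one_smul] at h4 h5
  rw [hc]
  refine ⟨h5, ?_⟩
  rw [← h3, F.coord_tcoord (z := ⟨y, l⁻¹ • u - W y⟩) hy, h2, mul_one] at h4
  exact h4

/-- The velocity of a curve relative to the wind `W`. -/
def relVelocity (W : (x : M) → TangentSpace 𝓘(ℝ, E) x) (γ : ℝ → M) (t : ℝ) :
    TangentBundle 𝓘(ℝ, E) M := ⟨γ t, velocityVec γ t - W (γ t)⟩

theorem eventually_tcoord_relVelocity {γ : ℝ → M} (hγ : ContMDiffAt 𝓘(ℝ, ℝ) 𝓘(ℝ, E) ∞ γ t)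
    (hp : γ t ∈ (extChartAt 𝓘(ℝ, E) p).source) :
    ∀ᶠ r in 𝓝 t, γ r ∈ (extChartAt 𝓘(ℝ, E) p).source ∧ tcoord p (relVelocity W γ r) =
      (extChartAt 𝓘(ℝ, E) p (γ r), deriv (fun r => extChartAt 𝓘(ℝ, E) p (γ r)) r -
        coordField W p (extChartAt 𝓘(ℝ, E) p (γ r))) := by
  filter_upwards [eventually_tcoord_velocity hγ hp] with r hr
  refine ⟨hr.1, ?_⟩
  have h1 : tcoord p ⟨γ r, velocityVec γ r⟩ = _ := hr.2
  rw [relVelocity, tcoord_sub, h1, coordField_apply hr.1]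

theorem continuousAt_velocity {γ : ℝ → M} (hγ : ContMDiffAt 𝓘(ℝ, ℝ) 𝓘(ℝ, E) ∞ γ t) :
    ContinuousAt (velocity (E := E) γ) t := by
  have hp : γ t ∈ (extChartAt 𝓘(ℝ, E) (γ t)).source := mem_extChartAt_source _
  have h1 := contDiffAt_extChartAt_comp hγ hp
  have h2 : ContinuousAt (fun r => (extChartAt 𝓘(ℝ, E) (γ t) (γ r),
      deriv (fun r => extChartAt 𝓘(ℝ, E) (γ t) (γ r)) r)) t :=
    h1.continuousAt.prodMk (contDiffAt_deriv (m := 0) h1 (by simp)).continuousAt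
  have hopen : IsOpen {q : E × E | q.1 ∈ (extChartAt 𝓘(ℝ, E) (γ t)).target} :=
    (isOpen_extChartAt_target (I := 𝓘(ℝ, E)) (γ t)).preimage continuous_fst
  have hmem : (extChartAt 𝓘(ℝ, E) (γ t) (γ t),
      deriv (fun r => extChartAt 𝓘(ℝ, E) (γ t) (γ r)) t) ∈
        {q : E × E | q.1 ∈ (extChartAt 𝓘(ℝ, E) (γ t)).target} :=
    (extChartAt 𝓘(ℝ, E) (γ t)).map_source hp
  have h3 := (contMDiffOn_tcoordSymm (E := E) (γ t)).continuousOn.continuousAt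
    (hopen.mem_nhds hmem)
  refine (ContinuousAt.comp (g := tcoordSymm (γ t))
    (f := fun r => (extChartAt 𝓘(ℝ, E) (γ t) (γ r),
      deriv (fun r => extChartAt 𝓘(ℝ, E) (γ t) (γ r)) r)) h3 h2).congr ?_
  filter_upwards [eventually_tcoord_velocity hγ hp] with r hr
  rw [Function.comp_apply, ← hr.2]
  exact tcoordSymm_tcoord (z := velocity γ r) hr.1

theorem IsTranslation.relVelocity_mem (htrans : IsTranslation F F' W) {γ : ℝ → M}
    (h : velocity (E := E) γ t ∈ F'.indicatrix) : relVelocity W γ t ∈ F.indicatrix := by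
  have h1 := htrans (γ t) (velocityVec γ t) h.1
  have h2 : F'.toFun ⟨γ t, velocityVec γ t⟩ = 1 := h.2
  rwa [h2, inv_one, one_smul] at h1

/-- The transversality factor `F(v) + g_v(W, v)` of a vector `v`. -/
def PseudoFinsler.transversality (F : PseudoFinsler E M) (W : (x : M) → TangentSpace 𝓘(ℝ, E) x)
    (z : TangentBundle 𝓘(ℝ, E) M) : ℝ :=
  F.toFun z + fundamentalTensor F.toFun z.1 z.2 (W z.1) z.2

theorem PseudoFinsler.transversality_eq {z : TangentBundle 𝓘(ℝ, E) M}
    (hz : z.1 ∈ (extChartAt 𝓘(ℝ, E) q).source) (hd : z ∈ F.dom) :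
    F.transversality W z = F.toFun z * (1 + fibreDeriv (F.coord q) (tcoord q z)
      (coordField W q (tcoord q z).1)) := by
  obtain ⟨y, v⟩ := z
  have hU := (F.tcoord_mem_iff hz).2 hd
  have h1 : ∀ t s : ℝ, F.toFun ⟨y, v + t • W y + s • v⟩ = F.coord q ((tcoord q ⟨y, v⟩).1,
      (tcoord q ⟨y, v⟩).2 + t • coordField W q (tcoord q ⟨y, v⟩).1 +
        s • (tcoord q ⟨y, v⟩).2) := by
    intro t s
    have h2 : coordField W q (tcoord q ⟨y, v⟩).1 = (tcoord q ⟨y, W y⟩).2 := coordField_apply hz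
    rw [← F.coord_tcoord (p := q) (z := ⟨y, v + t • W y + s • v⟩) hz, h2, tcoord_add, tcoord_add,
      tcoord_smul, tcoord_smul]
  rw [transversality, fundamentalTensor]
  simp only [h1]
  rw [(F.isFinslerOn_coord q).fundamental_apply_self (x := (tcoord q ⟨y, v⟩).1)
    (v := (tcoord q ⟨y, v⟩).2) hU (coordField W q (tcoord q ⟨y, v⟩).1),
    ← F.coord_tcoord (p := q) hz]
  ring

section FlowCurve

variable [FiniteDimensional ℝ E] [T2Space M]
  (hW : ContMDiff 𝓘(ℝ, E) 𝓘(ℝ, E).tangent ∞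
    (fun x => (⟨x, W x⟩ : TangentBundle 𝓘(ℝ, E) M)))
  {b : ℝ → M} (hb : ContMDiffAt 𝓘(ℝ, ℝ) 𝓘(ℝ, E) ∞ b t) (ht : (t, b t) ∈ flowDomain W)

include hW hb ht

theorem contMDiffAt_flow_curve :
    ContMDiffAt 𝓘(ℝ, ℝ) 𝓘(ℝ, E) ∞ (fun r => flow W r (b r)) t := by
  have h1 : ContMDiffAt 𝓘(ℝ, ℝ) (𝓘(ℝ, ℝ).prod 𝓘(ℝ, E)) ∞ (fun r => (r, b r)) t :=
    contMDiffAt_id.prodMk hb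
  exact ContMDiffAt.comp t (flow_contMDiffAt hW ht) h1

theorem eventually_coordFlow_curve (hp : b t ∈ (extChartAt 𝓘(ℝ, E) p).source)
    (hq : flow W t (b t) ∈ (extChartAt 𝓘(ℝ, E) q).source) :
    ∀ᶠ r in 𝓝 t, (r, extChartAt 𝓘(ℝ, E) p (b r)) ∈ coordFlowDomain W p q ∧
      extChartAt 𝓘(ℝ, E) q (flow W r (b r)) =
        coordFlow W p q (r, extChartAt 𝓘(ℝ, E) p (b r)) := by
  have h1 : ContinuousAt (fun r => (r, b r)) t := continuousAt_id.prodMk hb.continuousAt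
  filter_upwards [h1.preimage_mem_nhds ((isOpen_flowDomain hW).mem_nhds ht),
    hb.continuousAt.preimage_mem_nhds ((isOpen_extChartAt_source p).mem_nhds hp),
    (contMDiffAt_flow_curve hW hb ht).continuousAt.preimage_mem_nhds
      ((isOpen_extChartAt_source q).mem_nhds hq)] with r h1 h2 h3
  have h4 := mem_coordFlowDomain h2 h1 h3
  exact ⟨h4.1, h4.2.symm⟩

theorem tcoord_relVelocity_flow (hp : b t ∈ (extChartAt 𝓘(ℝ, E) p).source)
    (hq : flow W t (b t) ∈ (extChartAt 𝓘(ℝ, E) q).source) :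
    tcoord q (relVelocity W (fun r => flow W r (b r)) t) =
      (coordFlow W p q (t, extChartAt 𝓘(ℝ, E) p (b t)),
        fderiv ℝ (coordFlow W p q) (t, extChartAt 𝓘(ℝ, E) p (b t))
          (0, deriv (fun r => extChartAt 𝓘(ℝ, E) p (b r)) t)) := by
  have h1 := eventually_coordFlow_curve hW hb ht hp hq
  have h2 : (fun r => extChartAt 𝓘(ℝ, E) q (flow W r (b r))) =ᶠ[𝓝 t]
    fun r => coordFlow W p q (r, extChartAt 𝓘(ℝ, E) p (b r)) := h1.mono fun r hr => hr.2
  have hz := h1.self_of_nhds.1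
  have h3 : HasDerivAt (fun r => coordFlow W p q (r, extChartAt 𝓘(ℝ, E) p (b r))) _ t :=
    HasFDerivAt.comp_hasDerivAt (l := coordFlow W p q) t
      ((contDiffAt_coordFlow hW hz).differentiableAt (by simp)).hasFDerivAt
      ((hasDerivAt_id t).prodMk
        ((contDiffAt_extChartAt_comp hb hp).differentiableAt (by simp)).hasDerivAt)
  have h4 : ((1 : ℝ), deriv (fun r => extChartAt 𝓘(ℝ, E) p (b r)) t) =
    (1, 0) + (0, deriv (fun r => extChartAt 𝓘(ℝ, E) p (b r)) t) := by simp
  rw [(eventually_tcoord_relVelocity (contMDiffAt_flow_curve hW hb ht) hq).self_of_nhds.2,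
    h2.deriv_eq, h3.deriv, h1.self_of_nhds.2, h4, map_add, fderiv_coordFlow_time hW hz,
    add_sub_cancel_left]

variable {σ : ℝ} (hhom : IsHomothetic F W σ)

include hhom

/-- Homotheties rescale the velocity relative to the wind. -/
theorem relVelocity_flow :
    (relVelocity W (fun r => flow W r (b r)) t ∈ F.dom ↔ velocity b t ∈ F.dom) ∧
      (velocity b t ∈ F.dom → F.toFun (relVelocity W (fun r => flow W r (b r)) t) =
        Real.exp (-(σ * t)) * F.toFun (velocity b t)) := by
  have hp : b t ∈ (extChartAt 𝓘(ℝ, E) (b t)).source := mem_extChartAt_source _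
  have hq : flow W t (b t) ∈ (extChartAt 𝓘(ℝ, E) (flow W t (b t))).source :=
    mem_extChartAt_source _
  have hz := (eventually_coordFlow_curve hW hb ht hp hq).self_of_nhds.1
  have h1 := hhom.coordFlow hW hz (deriv (fun r => extChartAt 𝓘(ℝ, E) (b t) (b r)) t)
  rw [← tcoord_relVelocity_flow hW hb ht hp hq, PseudoFinsler.tcoord_velocity_mem hb hp,
    PseudoFinsler.coord_velocity hb hp,
    F.tcoord_mem_iff (z := relVelocity W _ t) hq, F.coord_tcoord (z := relVelocity W _ t) hq] at h1
  exact h1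

/-- The Euler–Lagrange expressions of a curve and of its image under the flow. -/
theorem exists_momentum_flow (hm : velocity b t ∈ F.dom)
    (hp : b t ∈ (extChartAt 𝓘(ℝ, E) p).source)
    (hq : flow W t (b t) ∈ (extChartAt 𝓘(ℝ, E) q).source) {x : ℝ → E}
    (hx : x = fun r => extChartAt 𝓘(ℝ, E) q (flow W r (b r))) :
    ∃ P, HasDerivAt (fun r => fibreDeriv (F.coord q) (x r, deriv x r - coordField W q (x r))) P t ∧
      ((∀ k, (P - baseDeriv (F.coord q) (x t, deriv x t - coordField W q (x t))) k +
        fibreDeriv (F.coord q) (x t, deriv x t - coordField W q (x t))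
          (fderiv ℝ (coordField W q) (x t) k + σ • k) = 0) ↔
        IsELAt (F.coord p) (fun r => extChartAt 𝓘(ℝ, E) p (b r)) t) := by
  have hys := contMDiffAt_flow_curve hW hb ht
  have hev := eventually_coordFlow_curve hW hb ht hp hq
  have hz := hev.self_of_nhds.1
  have hxs : ContDiffAt ℝ ∞ x t := by rw [hx]; exact contDiffAt_extChartAt_comp hys hq
  have hxt : x t = extChartAt 𝓘(ℝ, E) q (flow W t (b t)) := by rw [hx]
  have hws : ContDiffAt ℝ ∞ (coordField W q) (x t) := by
    rw [hxt]
    exact (contDiffOn_coordField hW q).contDiffAt ((isOpen_extChartAt_target q).mem_nhds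
      ((extChartAt 𝓘(ℝ, E) q).map_source hq))
  have hrel := (eventually_tcoord_relVelocity (W := W) hys hq).self_of_nhds.2
  have hU : (x t, deriv x t - coordField W q (x t)) ∈ F.coordDom q := by
    rw [hx, ← hrel]
    exact (F.tcoord_mem_iff (z := relVelocity W _ t) hq).2
      ((relVelocity_flow hW hb ht hhom).1.2 hm)
  have hG₂ := (F.isFinslerOn_coord q).contDiffAt hU
  have hP : DifferentiableAt ℝ
      (fun r => fibreDeriv (F.coord q) (x r, deriv x r - coordField W q (x r))) t := by
    have h2 : ContDiffAt ℝ ∞ (fun r => (x r, deriv x r - coordField W q (x r))) t :=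
      hxs.prodMk ((contDiffAt_deriv (m := ∞) hxs (by simp)).sub
        (ContDiffAt.comp (g := coordField W q) t hws hxs))
    exact (ContDiffAt.comp (g := fibreDeriv (F.coord q)) t
      (contDiffAt_fibreDeriv (m := ∞) hG₂ (by simp)) h2).differentiableAt (by simp)
  have hD := (isOpen_coordFlowDomain hW).mem_nhds hz
  have hmU := (PseudoFinsler.tcoord_velocity_mem hb hp).2 hm
  refine ⟨_, hP.hasDerivAt, forall_flow_eq_zero_iff_isELAt (Ψ := coordFlow W p q)
    (F.isFinslerOn_coord p) (contDiffAt_extChartAt_comp hb hp) hmU (contDiffAt_coordFlow hW hz)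
    (by rw [hx]; exact hev.mono fun r hr => hr.2) hws hG₂ ?_ ?_ hP.hasDerivAt⟩
  · filter_upwards [hD] with z hz using fderiv_coordFlow_time hW hz
  · have h2 : Tendsto (fun z : ℝ × E × E => (z.1, z.2.1)) (𝓝 (t, extChartAt 𝓘(ℝ, E) p (b t),
        deriv (fun r => extChartAt 𝓘(ℝ, E) p (b r)) t))
        (𝓝 (t, extChartAt 𝓘(ℝ, E) p (b t))) :=
      (by fun_prop : Continuous fun z : ℝ × E × E => (z.1, z.2.1)).tendsto _
    filter_upwards [h2.eventually hD, continuousAt_snd.preimage_mem_nhds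
      ((F.isFinslerOn_coord p).isOpen.mem_nhds hmU)] with z h3 h4
    exact (hhom.coordFlow hW h3 z.2.2).2 h4

/-- The infinitesimal homothety condition at the velocity relative to the wind. -/
theorem coord_relVelocity_flow (hm : relVelocity W (fun r => flow W r (b r)) t ∈ F.indicatrix)
    (hq : flow W t (b t) ∈ (extChartAt 𝓘(ℝ, E) q).source) {x : ℝ → E}
    (hx : x = fun r => extChartAt 𝓘(ℝ, E) q (flow W r (b r))) :
    (x t, deriv x t - coordField W q (x t)) ∈ F.coordDom q ∧ ContDiffAt ℝ ∞ x t ∧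
      ContDiffAt ℝ ∞ (coordField W q) (x t) ∧
      baseDeriv (F.coord q) (x t, deriv x t - coordField W q (x t)) (coordField W q (x t)) +
        fibreDeriv (F.coord q) (x t, deriv x t - coordField W q (x t))
          (fderiv ℝ (coordField W q) (x t) (deriv x t - coordField W q (x t))) = -σ := by
  have hys := contMDiffAt_flow_curve hW hb ht
  have hrel := (eventually_tcoord_relVelocity (W := W) hys hq).self_of_nhds.2
  have hxt : x t = extChartAt 𝓘(ℝ, E) q (flow W t (b t)) := by rw [hx]
  have hU : (x t, deriv x t - coordField W q (x t)) ∈ F.coordDom q := by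
    rw [hx, ← hrel]
    exact (F.tcoord_mem_iff (z := relVelocity W _ t) hq).2 hm.1
  refine ⟨hU, ?_, ?_, ?_⟩
  · rw [hx]
    exact contDiffAt_extChartAt_comp hys hq
  · rw [hxt]
    exact (contDiffOn_coordField hW q).contDiffAt ((isOpen_extChartAt_target q).mem_nhds
      ((extChartAt 𝓘(ℝ, E) q).map_source hq))
  · rw [hhom.coordField hW hU, hx, ← hrel, F.coord_tcoord (z := relVelocity W _ t) hq, hm.2,
      mul_one]

/-- A curve of unit speed for the translation satisfies the Euler–Lagrange equation of the
translation if and only if it is the image under the flow of a curve which satisfies that of the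
original metric. -/
theorem isELAt_flow_iff (htrans : IsTranslation F F' W)
    (hone : ∀ᶠ r in 𝓝 t, velocity (E := E) (fun r => flow W r (b r)) r ∈ F'.indicatrix)
    (hp : b t ∈ (extChartAt 𝓘(ℝ, E) p).source)
    (hq : flow W t (b t) ∈ (extChartAt 𝓘(ℝ, E) q).source) :
    IsELAt (F'.coord q) (fun r => extChartAt 𝓘(ℝ, E) q (flow W r (b r))) t ↔
      IsELAt (F.coord p) (fun r => extChartAt 𝓘(ℝ, E) p (b r)) t := by
  have hys := contMDiffAt_flow_curve hW hb ht
  have hmr := htrans.relVelocity_mem hone.self_of_nhds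
  have hm := (relVelocity_flow hW hb ht hhom).1.1 hmr.1
  obtain ⟨P, hP, hiff⟩ := exists_momentum_flow hW hb ht hhom hm hp hq rfl
  obtain ⟨hU, hxs, hws, hinf⟩ := coord_relVelocity_flow hW hb ht hhom hmr hq rfl
  have hU' := (PseudoFinsler.tcoord_velocity_mem hys hq).2 hone.self_of_nhds.1
  refine (isELAt_zermelo_iff hxs hws ((F.isFinslerOn_coord q).contDiffAt hU)
    ((F'.isFinslerOn_coord q).contDiffAt hU') ?_ ?_ hinf hP).trans hiff
  · filter_upwards [(F'.isFinslerOn_coord q).isOpen.mem_nhds hU'] with z hz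
    exact (htrans.coord hz).2
  · filter_upwards [hone, eventually_tcoord_velocity hys hq] with r h1 h2
    rw [← h2.2, F'.coord_tcoord (z := velocity _ r) h2.1, h1.2]

/-- The transversality factor along the image under the flow of a solution of the Euler–Lagrange
equation satisfies a linear differential equation. -/
theorem hasDerivAt_transversality_flow
    (hone : ∀ᶠ r in 𝓝 t, relVelocity W (fun r => flow W r (b r)) r ∈ F.indicatrix)
    (hp : b t ∈ (extChartAt 𝓘(ℝ, E) p).source)
    (hEL : IsELAt (F.coord p) (fun r => extChartAt 𝓘(ℝ, E) p (b r)) t) :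
    HasDerivAt (fun r => F.transversality W (relVelocity W (fun r => flow W r (b r)) r))
      (-σ * F.transversality W (relVelocity W (fun r => flow W r (b r)) t)) t := by
  have hys := contMDiffAt_flow_curve hW hb ht
  set q := flow W t (b t) with hq'
  have hq : flow W t (b t) ∈ (extChartAt 𝓘(ℝ, E) q).source := mem_extChartAt_source _
  have hmr := hone.self_of_nhds
  have hm := (relVelocity_flow hW hb ht hhom).1.1 hmr.1
  obtain ⟨P, hP, hiff⟩ := exists_momentum_flow hW hb ht hhom hm hp hq rfl
  obtain ⟨hU, hxs, hws, hinf⟩ := coord_relVelocity_flow hW hb ht hhom hmr hq rfl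
  have h1 := hasDerivAt_transversality (hxs.differentiableAt (by simp))
    (hws.differentiableAt (by simp)) hinf hP
  rw [hiff.2 hEL, zero_sub, ← neg_mul] at h1
  have h2 : ∀ᶠ r in 𝓝 t, F.transversality W (relVelocity W (fun r => flow W r (b r)) r) =
      1 + fibreDeriv (F.coord q) (extChartAt 𝓘(ℝ, E) q (flow W r (b r)),
        deriv (fun r => extChartAt 𝓘(ℝ, E) q (flow W r (b r))) r -
          coordField W q (extChartAt 𝓘(ℝ, E) q (flow W r (b r))))
            (coordField W q (extChartAt 𝓘(ℝ, E) q (flow W r (b r)))) := by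
    filter_upwards [hone, eventually_tcoord_relVelocity (W := W) hys hq] with r h3 h4
    rw [F.transversality_eq (q := q) (z := relVelocity W (fun r => flow W r (b r)) r) h4.1 h3.1,
      h3.2, one_mul, h4.2]
  rw [h2.self_of_nhds]
  exact h1.congr_of_eventuallyEq h2

end FlowCurve

end Translation

/-! ### The time change -/

section TimeChange

variable (σ : ℝ)

theorem hasDerivAt_timeChange (t : ℝ) : HasDerivAt (timeChange σ) (Real.exp (σ * t)) t := by
  by_cases h : σ = 0
  · have h1 : timeChange σ = id := by funext t; simp [timeChange, h]
    rw [h1, h, zero_mul, Real.exp_zero]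
    exact hasDerivAt_id t
  · have h1 : timeChange σ = fun t => (Real.exp (σ * t) - 1) / σ := by
      funext t; simp [timeChange, h]
    rw [h1]
    have h2 : HasDerivAt (fun t : ℝ => (Real.exp (σ * t) - 1) / σ) _ t :=
      ((((hasDerivAt_id t).const_mul σ).exp).sub_const 1).div_const σ
    refine h2.congr_deriv ?_
    simp only [id]
    field_simp

theorem timeChange_zero : timeChange σ 0 = 0 := by simp [timeChange]

theorem contDiff_timeChange : ContDiff ℝ ∞ (timeChange σ) := by
  by_cases h : σ = 0
  · have h1 : timeChange σ = fun t => t := by funext t; simp [timeChange, h]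
    rw [h1]
    fun_prop
  · have h1 : timeChange σ = fun t => (Real.exp (σ * t) - 1) / σ := by
      funext t; simp [timeChange, h]
    rw [h1]
    fun_prop

theorem isOpen_timeChange_image {I : Set ℝ} (hI : IsOpen I) : IsOpen (timeChange σ '' I) :=
  isOpenMap_of_hasStrictDerivAt (fun t => (contDiff_timeChange σ).contDiffAt.hasStrictDerivAt'
    (hasDerivAt_timeChange σ t) (by simp)) (fun t => (Real.exp_pos (σ * t)).ne') I hI

/-- The inverse of the time change. -/
def timeChangeInv (s : ℝ) : ℝ := if σ = 0 then s else Real.log (1 + σ * s) / σ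

theorem timeChangeInv_timeChange (t : ℝ) : timeChangeInv σ (timeChange σ t) = t := by
  by_cases h : σ = 0
  · simp [timeChange, timeChangeInv, h]
  · have h1 : 1 + σ * ((Real.exp (σ * t) - 1) / σ) = Real.exp (σ * t) := by field_simp; ring
    simp only [timeChange, timeChangeInv, h, if_false, h1, Real.log_exp]
    field_simp

theorem contDiffAt_timeChangeInv (t : ℝ) : ContDiffAt ℝ ∞ (timeChangeInv σ) (timeChange σ t) := by
  by_cases h : σ = 0
  · have h1 : timeChangeInv σ = fun t => t := by funext t; simp [timeChangeInv, h]
    rw [h1]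
    fun_prop
  · have h1 : timeChangeInv σ = fun s => Real.log (1 + σ * s) / σ := by
      funext t; simp [timeChangeInv, h]
    have h2 : 1 + σ * timeChange σ t ≠ 0 := by
      have h3 : 1 + σ * ((Real.exp (σ * t) - 1) / σ) = Real.exp (σ * t) := by field_simp; ring
      simp only [timeChange, h, if_false, h3]
      exact (Real.exp_pos _).ne'
    rw [h1]
    exact (ContDiffAt.log (f := fun s => 1 + σ * s)
      (by fun_prop : ContDiff ℝ ∞ fun s : ℝ => 1 + σ * s).contDiffAt h2).div_const σ

end TimeChange

/-! ### Geodesics of a translation -/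

section Uniqueness

/-- If `1 + G_v(w) ≠ 0`, then the equation `G(x, u - λ w(x)) = λ` which determines the value `λ` of
the translated metric at `u` has locally at most one solution. -/
theorem eventually_eq_one_of_transversal {E : Type*} [NormedAddCommGroup E] [NormedSpace ℝ E]
    {G : E × E → ℝ} {w : E → E} {x u : E} (hG : ContDiffAt ℝ ∞ G (x, u - w x))
    (hw : ContDiffAt ℝ ∞ w x) (hN : 1 + fibreDeriv G (x, u - w x) (w x) ≠ 0) :
    ∀ᶠ z : (E × E) × ℝ in 𝓝 ((x, u), 1), G (z.1.1, z.1.2 - w z.1.1) = 1 →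
      G (z.1.1, z.1.2 - z.2 • w z.1.1) = z.2 → z.2 = 1 := by
  set z₀ : (E × E) × ℝ := ((x, u), 1) with hz₀
  set Φ : (E × E) × ℝ → ℝ := fun z => G (z.1.1, z.1.2 - z.2 • w z.1.1) - z.2 with hΦ
  have hin : ContDiffAt ℝ ∞ (fun z : (E × E) × ℝ => (z.1.1, z.1.2 - z.2 • w z.1.1)) z₀ := by
    have h1 : ContDiffAt ℝ ∞ (fun z : (E × E) × ℝ => w z.1.1) z₀ :=
      ContDiffAt.comp (f := fun z : (E × E) × ℝ => z.1.1) z₀ hw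
        (contDiffAt_fst.comp z₀ contDiffAt_fst)
    have h2 : ContDiffAt ℝ ∞ (fun z : (E × E) × ℝ => z.1.1) z₀ := by fun_prop
    have h3 : ContDiffAt ℝ ∞ (fun z : (E × E) × ℝ => z.1.2) z₀ := by fun_prop
    exact h2.prodMk (h3.sub (contDiffAt_snd.smul h1))
  have hG' : ContDiffAt ℝ ∞ G (z₀.1.1, z₀.1.2 - z₀.2 • w z₀.1.1) := by
    simpa [hz₀] using hG
  have hs : ContDiffAt ℝ ∞ Φ z₀ := (ContDiffAt.comp z₀ hG' hin).sub contDiffAt_snd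
  set A := fderiv ℝ Φ z₀ with hA
  have hstrict : HasStrictFDerivAt Φ A z₀ := hs.hasStrictFDerivAt (by simp)
  set N := 1 + fibreDeriv G (x, u - w x) (w x) with hNdef
  have hA1 : A ((0, 0), 1) = -N := by
    have h1 : HasDerivAt (fun l : ℝ => Φ ((x, u), l)) (A ((0, 0), 1)) 1 :=
      HasFDerivAt.comp_hasDerivAt (l := Φ) (1 : ℝ) hstrict.hasFDerivAt
        ((hasDerivAt_const (1 : ℝ) (x, u)).prodMk (hasDerivAt_id (1 : ℝ)))
    have h2 : HasDerivAt (fun l : ℝ => (x, u - l • w x)) ((0 : E), -w x) 1 := by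
      have := ((hasDerivAt_id (1 : ℝ)).smul_const (w x)).const_sub u
      rw [one_smul] at this
      exact (hasDerivAt_const (1 : ℝ) x).prodMk this
    have hG1 : DifferentiableAt ℝ G (x, u - (1 : ℝ) • w x) := by
      rw [one_smul]; exact hG.differentiableAt (by simp)
    have h3 := (hG1.hasFDerivAt.comp_hasDerivAt (1 : ℝ) h2).sub (hasDerivAt_id (1 : ℝ))
    rw [one_smul, fderiv_apply_mk, map_zero, zero_add, map_neg] at h3
    rw [h1.unique h3, hNdef]
    ring
  have hc : 0 < |N| / 2 := half_pos (abs_pos.2 hN)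
  have hlo := (hasStrictFDerivAt_iff_isLittleO.1 hstrict).def hc
  have hcont : Tendsto (fun z : (E × E) × ℝ => (z, (z.1, (1 : ℝ)))) (𝓝 z₀) (𝓝 (z₀, z₀)) :=
    (by fun_prop : Continuous fun z : (E × E) × ℝ => (z, (z.1, (1 : ℝ)))).tendsto z₀
  filter_upwards [hcont.eventually hlo] with z hz h1 h2
  have h3 : z - (z.1, (1 : ℝ)) = (z.2 - 1) • (((0 : E), (0 : E)), (1 : ℝ)) := by
    refine Prod.ext (Prod.ext ?_ ?_) ?_ <;> simp
  have h4 : Φ z = 0 := by simp only [hΦ, h2, sub_self]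
  have h5 : Φ (z.1, 1) = 0 := by simp only [hΦ, one_smul, h1, sub_self]
  rw [h3, map_smul, hA1, h4, h5, norm_smul, smul_eq_mul] at hz
  simp only [sub_zero, zero_sub, norm_neg, norm_mul, Real.norm_eq_abs, Prod.norm_def, norm_zero,
    norm_one, max_self] at hz
  by_contra hne
  have h6 : 0 < |z.2 - 1| := abs_pos.2 (sub_ne_zero.2 hne)
  have h7 : max (0 : ℝ) 1 = 1 := max_eq_right zero_le_one
  rw [h7] at hz
  nlinarith [abs_pos.2 hN, mul_pos h6 (abs_pos.2 hN)]

end Uniqueness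

section Correspondence

variable {E : Type*} [NormedAddCommGroup E] [NormedSpace ℝ E] [FiniteDimensional ℝ E]
  {M : Type*} [TopologicalSpace M] [ChartedSpace E M] [IsManifold 𝓘(ℝ, E) ∞ M] [T2Space M]
  {F F' : PseudoFinsler E M} {W : (x : M) → TangentSpace 𝓘(ℝ, E) x} {σ : ℝ}
  {γ : ℝ → M} {J : Set ℝ} {t : ℝ}

omit [FiniteDimensional ℝ E] [T2Space M] in
/-- A unit speed geodesic, after the time change. -/
theorem PseudoFinsler.IsUnitGeodesicOn.comp_timeChange (h : F.IsUnitGeodesicOn γ J)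
    (hJ : IsOpen J) (ht : timeChange σ t ∈ J) :
    ContMDiffAt 𝓘(ℝ, ℝ) 𝓘(ℝ, E) ∞ (fun r => γ (timeChange σ r)) t ∧
      velocity (E := E) (fun r => γ (timeChange σ r)) t ∈ F.dom ∧
      F.toFun (velocity (E := E) (fun r => γ (timeChange σ r)) t) = Real.exp (σ * t) ∧
      ∀ p, γ (timeChange σ t) ∈ (extChartAt 𝓘(ℝ, E) p).source →
        IsELAt (F.coord p) (fun r => extChartAt 𝓘(ℝ, E) p (γ (timeChange σ r))) t := by
  have hγ := h.1.contMDiffAt hJ ht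
  have hv := velocity_comp (hasDerivAt_timeChange σ t) (hγ.mdifferentiableAt (by simp))
  have hm := h.1.admissible _ ht
  have h1 : F.toFun ⟨γ (timeChange σ t), velocityVec γ (timeChange σ t)⟩ = 1 := h.2 _ ht
  refine ⟨ContMDiffAt.comp t hγ (contDiff_timeChange σ).contMDiff.contMDiffAt, ?_, ?_, ?_⟩
  · rw [hv]
    exact F.conic _ _ _ (Real.exp_pos _) hm
  · rw [hv, F.homogeneous _ _ _ (Real.exp_pos _) hm, h1, mul_one]
  · intro p hp
    exact ((F.isFinslerOn_coord p).isELAt_comp_iff (contDiffAt_extChartAt_comp hγ hp)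
      ((PseudoFinsler.tcoord_velocity_mem hγ hp).2 hm) (hasDerivAt_timeChange σ)
      (fun r => Real.exp_pos _)).2 (h.isELAt hJ ht hp)

variable (hW : ContMDiff 𝓘(ℝ, E) 𝓘(ℝ, E).tangent ∞
    (fun x => (⟨x, W x⟩ : TangentBundle 𝓘(ℝ, E) M)))
  (hhom : IsHomothetic F W σ)

section

include hW

/-- The velocity at time zero of a curve transported by the flow. -/
theorem velocity_flow_zero {b : ℝ → M} (hb : ContMDiffAt 𝓘(ℝ, ℝ) 𝓘(ℝ, E) ∞ b 0) :
    velocity (E := E) (fun r => flow W r (b r)) 0 = ⟨b 0, velocityVec b 0 + W (b 0)⟩ := by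
  have h0 := flow_zero_mem hW (b 0)
  have hys := contMDiffAt_flow_curve hW hb h0.1
  have hp : b 0 ∈ (extChartAt 𝓘(ℝ, E) (b 0)).source := mem_extChartAt_source _
  have hq : flow W 0 (b 0) ∈ (extChartAt 𝓘(ℝ, E) (b 0)).source := by rw [h0.2]; exact hp
  refine eq_of_tcoord_eq (p := b 0) hq hp ?_
  set φ := extChartAt 𝓘(ℝ, E) (b 0) with hφ
  have h1 := (eventually_tcoord_relVelocity (W := W) hys hq).self_of_nhds.2
  have h2 := (eventually_tcoord_velocity hb hp).self_of_nhds.2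
  have h3 : tcoord (b 0) ⟨b 0, velocityVec b 0⟩ = _ := h2
  rw [(eventually_tcoord_velocity hys hq).self_of_nhds.2, tcoord_add, h3]
  rw [tcoord_relVelocity_flow hW hb h0.1 hp hq] at h1
  have hz := (coordFlow_zero hW (q := b 0) (φ.map_source hp)).1
  have hid : ∀ v : E, fderiv ℝ (coordFlow W (b 0) (b 0)) (0, φ (b 0)) (0, v) = v := by
    intro v
    have h4 : HasFDerivAt (fun y => coordFlow W (b 0) (b 0) (0, y))
        ((fderiv ℝ (coordFlow W (b 0) (b 0)) (0, φ (b 0))).comp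
          (ContinuousLinearMap.inr ℝ ℝ E)) (φ (b 0)) :=
      HasFDerivAt.comp (φ (b 0))
        ((contDiffAt_coordFlow hW hz).differentiableAt (by simp)).hasFDerivAt
        (hasFDerivAt_prodMk_right (0 : ℝ) (φ (b 0)))
    have h5 : (fun y => coordFlow W (b 0) (b 0) (0, y)) =ᶠ[𝓝 (φ (b 0))] id := by
      filter_upwards [(isOpen_extChartAt_target (I := 𝓘(ℝ, E)) (b 0)).mem_nhds
        (φ.map_source hp)] with y hy using (coordFlow_zero hW hy).2
    exact congrArg (fun A : E →L[ℝ] E => A v)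
      (h4.unique ((hasFDerivAt_id _).congr_of_eventuallyEq h5))
  rw [hid] at h1
  have h6 := congrArg Prod.snd h1
  simp only at h6
  refine Prod.ext (congrArg φ h0.2) ?_
  rw [← coordField_apply hp]
  simp only
  rw [h6, h0.2, sub_add_cancel]

omit [FiniteDimensional ℝ E] [T2Space M] in
/-- The translated indicatrix is transversal to the radial directions. -/
theorem IsTranslation.transversal (htrans : IsTranslation F F' W) {q : M} {x u : E}
    (hu : (x, u) ∈ F'.coordDom q) (hone : F'.coord q (x, u) = 1) :
    (x, u - coordField W q x) ∈ F.coordDom q ∧ ContDiffAt ℝ ∞ (coordField W q) x ∧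
      1 + fibreDeriv (F.coord q) (x, u - coordField W q x) (coordField W q x) ≠ 0 := by
  have h1 := (htrans.coord hu).1
  rw [hone, one_smul] at h1
  have hws : ContDiffAt ℝ ∞ (coordField W q) x :=
    (contDiffOn_coordField hW q).contDiffAt ((isOpen_extChartAt_target q).mem_nhds hu.1)
  refine ⟨h1, hws, zermelo_transversal ((F.isFinslerOn_coord q).differentiableAt h1)
    (hws.differentiableAt (by simp)) ((F'.isFinslerOn_coord q).differentiableAt hu) hone ?_⟩
  filter_upwards [(F'.isFinslerOn_coord q).isOpen.mem_nhds hu] with z hz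
  exact (htrans.coord hz).2

omit [FiniteDimensional ℝ E] [T2Space M] in
theorem IsTranslation.transversality_ne_zero (htrans : IsTranslation F F' W)
    (hγ : ContMDiffAt 𝓘(ℝ, ℝ) 𝓘(ℝ, E) ∞ γ t) (h : velocity (E := E) γ t ∈ F'.indicatrix) :
    F.transversality W (relVelocity W γ t) ≠ 0 := by
  have hq : γ t ∈ (extChartAt 𝓘(ℝ, E) (γ t)).source := mem_extChartAt_source _
  have hU := (PseudoFinsler.tcoord_velocity_mem hγ hq).2 h.1
  have h1 := (htrans.transversal hW hU ((PseudoFinsler.coord_velocity hγ hq).trans h.2)).2.2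
  have h2 := htrans.relVelocity_mem h
  rw [F.transversality_eq (z := relVelocity W γ t) hq h2.1, h2.2, one_mul,
    (eventually_tcoord_relVelocity hγ hq).self_of_nhds.2]
  exact h1

omit [FiniteDimensional ℝ E] [T2Space M] in
/-- A curve whose velocity relative to the wind has unit length, and whose velocity lies in the
indicatrix of the translation at one time, has unit speed for the translation near this time. -/
theorem IsTranslation.eventually_mem_indicatrix (htrans : IsTranslation F F' W)
    (hγ : ContMDiffAt 𝓘(ℝ, ℝ) 𝓘(ℝ, E) ∞ γ t) (h : velocity (E := E) γ t ∈ F'.indicatrix)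
    (hrel : ∀ᶠ r in 𝓝 t, relVelocity W γ r ∈ F.indicatrix) :
    ∀ᶠ r in 𝓝 t, velocity (E := E) γ r ∈ F'.indicatrix := by
  have hq : γ t ∈ (extChartAt 𝓘(ℝ, E) (γ t)).source := mem_extChartAt_source _
  set q := γ t with hq'
  set c : ℝ → E := fun r => extChartAt 𝓘(ℝ, E) q (γ r) with hc
  have hcs : ContDiffAt ℝ ∞ c t := contDiffAt_extChartAt_comp hγ hq
  have hU : (c t, deriv c t) ∈ F'.coordDom q :=
    (PseudoFinsler.tcoord_velocity_mem hγ hq).2 h.1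
  have hone : F'.coord q (c t, deriv c t) = 1 :=
    (PseudoFinsler.coord_velocity hγ hq).trans h.2
  obtain ⟨h1, hws, h2⟩ := htrans.transversal hW hU hone
  have hev := eventually_eq_one_of_transversal ((F.isFinslerOn_coord q).contDiffAt h1) hws h2
  have h3 : ContinuousAt (fun r => (c r, deriv c r)) t :=
    hcs.continuousAt.prodMk (contDiffAt_deriv (m := 0) hcs (by simp)).continuousAt
  have h4 : ContinuousAt (fun r => F'.coord q (c r, deriv c r)) t :=
    ContinuousAt.comp (g := F'.coord q) (f := fun r => (c r, deriv c r))
      ((F'.isFinslerOn_coord q).contDiffAt hU).continuousAt h3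
  have h5 : Tendsto (fun r => ((c r, deriv c r), F'.coord q (c r, deriv c r))) (𝓝 t)
      (𝓝 ((c t, deriv c t), 1)) := by
    have := h3.prodMk h4
    rwa [ContinuousAt, hone] at this
  filter_upwards [h5.eventually hev, h3.preimage_mem_nhds
    ((F'.isFinslerOn_coord q).isOpen.mem_nhds hU), hrel, eventually_tcoord_velocity hγ hq,
    eventually_tcoord_relVelocity (W := W) hγ hq] with r h6 h7 h8 h9 h10
  have h11 : F.coord q (c r, deriv c r - coordField W q (c r)) = 1 := by
    rw [← h10.2, F.coord_tcoord (z := relVelocity W γ r) h9.1, h8.2]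
  have h12 := h6 h11 (htrans.coord h7).2
  have h13 : F'.coord q (c r, deriv c r) = 1 := h12
  have h14 : (c r, deriv c r) ∈ F'.coordDom q := h7
  rw [← h9.2] at h13 h14
  exact ⟨(F'.tcoord_mem_iff (z := velocity γ r) h9.1).1 h14,
    (F'.coord_tcoord (z := velocity γ r) h9.1).symm.trans h13⟩

end

include hW hhom

/-- Along the transported curve, the velocity relative to the wind is the image under the homothety
`ψ_t` of a velocity of length `f'(t) = e^{σt}`, hence has unit length. -/
theorem PseudoFinsler.IsUnitGeodesicOn.relVelocity_mem (h : F.IsUnitGeodesicOn γ J)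
    (hJ : IsOpen J) (ht : timeChange σ t ∈ J) (hD : (t, γ (timeChange σ t)) ∈ flowDomain W) :
    relVelocity W (fun r => flow W r (γ (timeChange σ r))) t ∈ F.indicatrix := by
  obtain ⟨hb, hm, hs, -⟩ := h.comp_timeChange (σ := σ) hJ ht
  have h1 := relVelocity_flow hW (b := fun r => γ (timeChange σ r)) hb hD hhom
  refine ⟨h1.1.2 hm, ?_⟩
  rw [h1.2 hm, hs, ← Real.exp_add, neg_add_cancel, Real.exp_zero]

/-- The flow and the time change transform unit speed geodesics of `F` into unit speed geodesics of
its translation, as long as the velocities remain in the indicatrix of the translation. -/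
theorem IsTranslation.isUnitGeodesicOn_flow (htrans : IsTranslation F F' W) {I : Set ℝ}
    (hI : IsOpen I) (hJ : IsOpen J) (h : F.IsUnitGeodesicOn γ J)
    (hIJ : ∀ t ∈ I, timeChange σ t ∈ J)
    (hD : ∀ t ∈ I, (t, γ (timeChange σ t)) ∈ flowDomain W)
    (hind : ∀ t ∈ I, velocity (E := E) (fun t => flow W t (γ (timeChange σ t))) t ∈
      F'.indicatrix) :
    F'.IsUnitGeodesicOn (fun t => flow W t (γ (timeChange σ t))) I := by
  refine PseudoFinsler.isUnitGeodesicOn_of_isELAt hI (fun t ht => ?_) (fun t ht => (hind t ht).1)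
    (fun t ht => (hind t ht).2) fun t ht => ⟨_, mem_extChartAt_source _, ?_⟩
  · exact (contMDiffAt_flow_curve hW (b := fun r => γ (timeChange σ r))
      (h.comp_timeChange hJ (hIJ t ht)).1 (hD t ht)).contMDiffWithinAt
  · obtain ⟨hb, -, -, hEL⟩ := h.comp_timeChange (σ := σ) hJ (hIJ t ht)
    refine (isELAt_flow_iff hW (b := fun r => γ (timeChange σ r)) hb (hD t ht) hhom htrans ?_
      (mem_extChartAt_source _) (mem_extChartAt_source _)).2 (hEL _ (mem_extChartAt_source _))
    filter_upwards [hI.mem_nhds ht] with r hr using hind r hr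

/-- Conversely, the inverse transformation maps unit speed geodesics of the translation to unit
speed geodesics of `F`. -/
theorem IsTranslation.isUnitGeodesicOn_of_flow (htrans : IsTranslation F F' W) {I : Set ℝ}
    (hI : IsOpen I) (h : F'.IsUnitGeodesicOn γ I) (hD : ∀ t ∈ I, (-t, γ t) ∈ flowDomain W) :
    F.IsUnitGeodesicOn (fun s => flow W (-timeChangeInv σ s) (γ (timeChangeInv σ s)))
      (timeChange σ '' I) := by
  set b : ℝ → M := fun t => flow W (-t) (γ t) with hb'
  set β : ℝ → M := fun s => b (timeChangeInv σ s) with hβ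
  have hβb : (fun r => β (timeChange σ r)) = b := by
    funext r
    simp only [hβ, timeChangeInv_timeChange]
  have hb : ∀ t ∈ I, ContMDiffAt 𝓘(ℝ, ℝ) 𝓘(ℝ, E) ∞ b t := by
    intro t ht
    have h1 : ContMDiffAt 𝓘(ℝ, ℝ) 𝓘(ℝ, ℝ) ∞ (fun r : ℝ => -r) t :=
      contDiff_neg.contMDiff.contMDiffAt
    exact ContMDiffAt.comp t (flow_contMDiffAt hW (hD t ht))
      (h1.prodMk (h.1.contMDiffAt hI ht))
  have hfl : ∀ t ∈ I, (t, b t) ∈ flowDomain W ∧ flow W t (b t) = γ t := by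
    intro t ht
    have h1 := flow_neg hW (hD t ht)
    rwa [neg_neg] at h1
  have hfl' : EqOn (fun r => flow W r (b r)) γ I := fun t ht => (hfl t ht).2
  have hvel : ∀ t ∈ I, velocity (E := E) (fun r => flow W r (b r)) t ∈ F'.indicatrix := by
    intro t ht
    rw [velocity_congr (hfl'.eventuallyEq_of_mem (hI.mem_nhds ht))]
    exact ⟨h.1.admissible t ht, h.2 t ht⟩
  have hbv : ∀ t ∈ I, velocity (E := E) b t ∈ F.dom ∧
      F.toFun (velocity (E := E) b t) = Real.exp (σ * t) := by
    intro t ht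
    have h1 := htrans.relVelocity_mem (hvel t ht)
    have h2 := relVelocity_flow hW (hb t ht) (hfl t ht).1 hhom
    have hm := h2.1.1 h1.1
    have h3 := h2.2 hm
    rw [h1.2] at h3
    refine ⟨hm, ?_⟩
    rw [← mul_right_inj' (Real.exp_pos (-(σ * t))).ne', ← h3, ← Real.exp_add, neg_add_cancel,
      Real.exp_zero]
  have hβs : ∀ t ∈ I, ContMDiffAt 𝓘(ℝ, ℝ) 𝓘(ℝ, E) ∞ β (timeChange σ t) := by
    intro t ht
    refine ContMDiffAt.comp (g := b) (timeChange σ t) ?_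
      (contDiffAt_timeChangeInv σ t).contMDiffAt
    rw [timeChangeInv_timeChange]
    exact hb t ht
  have hβv : ∀ t ∈ I, velocity (E := E) β (timeChange σ t) ∈ F.dom ∧
      F.toFun (velocity (E := E) β (timeChange σ t)) = 1 := by
    intro t ht
    have h1 := velocity_comp (hasDerivAt_timeChange σ t)
      ((hβs t ht).mdifferentiableAt (by simp))
    obtain ⟨h2, h3⟩ := hbv t ht
    rw [hβb] at h1
    rw [h1] at h2 h3
    have hpos := Real.exp_pos (σ * t)
    have h4 := F.conic _ _ _ (inv_pos.2 hpos) h2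
    have h5 := F.homogeneous _ _ _ (inv_pos.2 hpos) h2
    rw [smul_smul, inv_mul_cancel₀ hpos.ne', one_smul] at h4 h5
    rw [h3, inv_mul_cancel₀ hpos.ne'] at h5
    exact ⟨h4, h5⟩
  refine PseudoFinsler.isUnitGeodesicOn_of_isELAt (isOpen_timeChange_image σ hI) ?_ ?_ ?_ ?_
  · rintro _ ⟨t, ht, rfl⟩
    exact (hβs t ht).contMDiffWithinAt
  · rintro _ ⟨t, ht, rfl⟩
    exact (hβv t ht).1
  · rintro _ ⟨t, ht, rfl⟩
    exact (hβv t ht).2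
  · rintro _ ⟨t, ht, rfl⟩
    have hp : β (timeChange σ t) ∈ (extChartAt 𝓘(ℝ, E) (β (timeChange σ t))).source :=
      mem_extChartAt_source _
    refine ⟨_, hp, ?_⟩
    set p := β (timeChange σ t) with hp'
    have hbt : b t = p := (congrFun hβb t).symm
    refine ((F.isFinslerOn_coord p).isELAt_comp_iff
      (contDiffAt_extChartAt_comp (hβs t ht) hp)
      ((PseudoFinsler.tcoord_velocity_mem (hβs t ht) hp).2 (hβv t ht).1) (hasDerivAt_timeChange σ)
      (fun r => Real.exp_pos _)).1 ?_
    have h1 : (fun r => extChartAt 𝓘(ℝ, E) p (β (timeChange σ r))) =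
        fun r => extChartAt 𝓘(ℝ, E) p (b r) := by
      funext r
      rw [← hβb]
    rw [h1]
    refine (isELAt_flow_iff hW (hb t ht) (hfl t ht).1 hhom htrans ?_ (by rw [hbt]; exact hp)
      (mem_extChartAt_source _)).1 ?_
    · filter_upwards [hI.mem_nhds ht] with r hr using hvel r hr
    · have h2 : (fun r => extChartAt 𝓘(ℝ, E) (flow W t (b t)) (flow W r (b r))) =ᶠ[𝓝 t]
          fun r => extChartAt 𝓘(ℝ, E) (flow W t (b t)) (γ r) :=
        (hfl'.eventuallyEq_of_mem (hI.mem_nhds ht)).fun_comp _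
      refine (isELAt_congr h2).2 (h.isELAt hI ht ?_)
      rw [(hfl t ht).2]
      exact mem_extChartAt_source _

end Correspondence

/-! ### Completeness of a translation -/

section Completeness

variable {E : Type*} [NormedAddCommGroup E] [NormedSpace ℝ E] [FiniteDimensional ℝ E]
  {M : Type*} [TopologicalSpace M] [ChartedSpace E M] [IsManifold 𝓘(ℝ, E) ∞ M] [T2Space M]
  {F F' : PseudoFinsler E M} {W : (x : M) → TangentSpace 𝓘(ℝ, E) x} {σ : ℝ}
  (hW : ContMDiff 𝓘(ℝ, E) 𝓘(ℝ, E).tangent ∞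
    (fun x => (⟨x, W x⟩ : TangentBundle 𝓘(ℝ, E) M)))
  (hhom : IsHomothetic F W σ) (htrans : IsTranslation F F' W)

omit [FiniteDimensional ℝ E] [IsManifold 𝓘(ℝ, E) ∞ M] [T2Space M] in
theorem IsCompleteField.mem_flowDomain (h : IsCompleteField W) (t : ℝ) (x : M) :
    (t, x) ∈ flowDomain W := by
  obtain ⟨γ, h0, hγ⟩ := h x
  exact ⟨γ, univ, ⟨isOpen_univ, ordConnected_univ, mem_univ _, h0, hγ.isMIntegralCurveOn univ⟩,
    mem_univ _⟩

omit [FiniteDimensional ℝ E] [T2Space M] in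
theorem mem_transversalTranslate {γ : ℝ → M} {t : ℝ} (h : relVelocity W γ t ∈ F.indicatrix)
    (hN : F.transversality W (relVelocity W γ t) ≠ 0) :
    velocity (E := E) γ t ∈ transversalTranslate F W := by
  refine ⟨γ t, velocityVec γ t - W (γ t), h.1, hN, ?_⟩
  have h1 : F.toFun ⟨γ t, velocityVec γ t - W (γ t)⟩ = 1 := h.2
  rw [h1, inv_one, one_smul, sub_add_cancel]
  rfl

include hW hhom htrans

/-- A unit speed geodesic of the translation which is defined near time zero extends to the whole
real line. Its extension is the image of a geodesic of `F`; the velocities of this image stay in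
one component of the transversal part of the translated indicatrix, since the transversality factor
solves a linear differential equation and hence never vanishes. -/
theorem exists_complete_unit_geodesic (hF : F.GeodesicallyComplete) (hWc : IsCompleteField W)
    (hfull : IsFullTranslation F F' W) {J : Set ℝ} {γ : ℝ → M} (hJ : IsOpen J)
    (hJc : J.OrdConnected) (h0 : (0 : ℝ) ∈ J) (h : F'.IsUnitGeodesicOn γ J) :
    ∃ η : ℝ → M, F'.IsGeodesicOn η univ ∧ EqOn η γ J := by
  have hD := fun t x => hWc.mem_flowDomain t x
  have hα := htrans.isUnitGeodesicOn_of_flow hW hhom hJ h fun t _ => hD _ _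
  set α : ℝ → M := fun s => flow W (-timeChangeInv σ s) (γ (timeChangeInv σ s)) with hα'
  have hαγ : ∀ t, flow W t (α (timeChange σ t)) = γ t := by
    intro t
    have h1 := (flow_neg hW (hD (-t) (γ t))).2
    rw [neg_neg] at h1
    simp only [hα', timeChangeInv_timeChange]
    exact h1
  have hfJ : IsOpen (timeChange σ '' J) := isOpen_timeChange_image σ hJ
  have hfJ0 : (0 : ℝ) ∈ timeChange σ '' J := ⟨0, h0, timeChange_zero σ⟩
  obtain ⟨β, hβ, hβα⟩ := hF (timeChange σ '' J) α hfJ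
    (hJc.isPreconnected.image _ (contDiff_timeChange σ).continuous.continuousOn).ordConnected
    ⟨0, hfJ0⟩ hα.1
  have hβu : F.IsUnitGeodesicOn β univ := by
    refine ⟨hβ, fun t _ => ?_⟩
    rw [hβ.speed_eq isOpen_univ ordConnected_univ (mem_univ t) (mem_univ 0),
      velocity_congr (hβα.eventuallyEq_of_mem (hfJ.mem_nhds hfJ0))]
    exact hα.2 0 hfJ0
  -- the candidate for the extension; at this point only its velocities in `J` are known to be
  -- admissible for `F'`
  set η : ℝ → M := fun t => flow W t (β (timeChange σ t)) with hη
  have hηγ : EqOn η γ J := by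
    intro t ht
    rw [hη, ← hαγ t]
    simp only
    rw [hβα (mem_image_of_mem _ ht)]
  have hβt := fun t => hβu.comp_timeChange (σ := σ) (t := t) isOpen_univ (mem_univ _)
  have hηs : ∀ t, ContMDiffAt 𝓘(ℝ, ℝ) 𝓘(ℝ, E) ∞ η t := fun t =>
    contMDiffAt_flow_curve hW (b := fun r => β (timeChange σ r)) (hβt t).1 (hD _ _)
  have hrel : ∀ t, relVelocity W η t ∈ F.indicatrix := fun t =>
    hβu.relVelocity_mem hW hhom isOpen_univ (mem_univ _) (hD _ _)
  have hη0 : velocity (E := E) η 0 ∈ F'.indicatrix := by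
    rw [velocity_congr (hηγ.eventuallyEq_of_mem (hJ.mem_nhds h0))]
    exact ⟨h.1.admissible 0 h0, h.2 0 h0⟩
  set N : ℝ → ℝ := fun t => F.transversality W (relVelocity W η t) with hN
  have hN' : ∀ t, HasDerivAt N (-σ * N t) t := fun t =>
    hasDerivAt_transversality_flow hW (b := fun r => β (timeChange σ r)) (hβt t).1 (hD _ _) hhom
      (Eventually.of_forall hrel) (mem_extChartAt_source _)
      ((hβt t).2.2.2 _ (mem_extChartAt_source _))
  -- hence `N(t) e^{σt}` is constant, and `N(0) ≠ 0` because `η'(0)` is in the indicatrix of `F'`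
  have hconst : ∀ t, N t * Real.exp (σ * t) = N 0 * Real.exp (σ * 0) := by
    have h1 : ∀ t, HasDerivAt (fun t => N t * Real.exp (σ * t)) 0 t := by
      intro t
      have h2 := (hN' t).mul (((hasDerivAt_id t).const_mul σ).exp)
      refine h2.congr_deriv ?_
      simp only [id]
      ring
    intro t
    exact is_const_of_deriv_eq_zero (fun t => (h1 t).differentiableAt) (fun t => (h1 t).deriv) t 0
  have hN0 : ∀ t, N t ≠ 0 := by
    intro t ht
    have h1 := hconst t
    rw [ht, zero_mul, mul_zero, Real.exp_zero, mul_one] at h1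
    exact htrans.transversality_ne_zero hW (hηs 0) hη0 h1.symm
  obtain ⟨y, hy, hcomp⟩ := hfull
  have hT : range (velocity (E := E) η) ⊆ transversalTranslate F W := by
    rintro _ ⟨t, rfl⟩
    exact mem_transversalTranslate (hrel t) (hN0 t)
  have hconn : IsPreconnected (range (velocity (E := E) η)) :=
    isPreconnected_range (continuous_iff_continuousAt.2 fun t => continuousAt_velocity (hηs t))
  have hind : ∀ t, velocity (E := E) η t ∈ F'.indicatrix := by
    intro t
    have h1 := hconn.subset_connectedComponentIn (mem_range_self 0) hT
    rw [hcomp] at hη0 ⊢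
    rw [connectedComponentIn_eq hη0]
    exact h1 (mem_range_self t)
  exact ⟨η, (htrans.isUnitGeodesicOn_flow hW hhom isOpen_univ isOpen_univ hβu
    (fun _ _ => mem_univ _) (fun _ _ => hD _ _) fun t _ => hind t).1, hηγ⟩

/-- Geodesics have constant speed, so completeness reduces to unit speed geodesics which are defined
at time zero. -/
theorem geodesicallyComplete_of_isFullTranslation (hF : F.GeodesicallyComplete)
    (hWc : IsCompleteField W) (hfull : IsFullTranslation F F' W) : F'.GeodesicallyComplete := by
  rintro J γ hJ hJc ⟨t₁, ht₁⟩ hγ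
  set k := F'.toFun (velocity (E := E) γ t₁) with hk
  have hkpos : 0 < k := F'.pos _ (hγ.admissible t₁ ht₁)
  -- the reparametrization by arc length, starting at `t₁`
  set g : ℝ → ℝ := fun t => k⁻¹ * t + t₁ with hg
  have hgd : ∀ t, HasDerivAt g k⁻¹ t := fun t => by
    have := ((hasDerivAt_id t).const_mul k⁻¹).add_const t₁
    rwa [mul_one] at this
  have hgm : Monotone g := fun a b hab => by
    simp only [hg]
    gcongr
  have hI : IsOpen (g ⁻¹' J) := hJ.preimage (by fun_prop)
  have hδ : F'.IsUnitGeodesicOn (fun t => γ (g t)) (g ⁻¹' J) := by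
    refine ⟨hγ.comp_affine hJ (inv_pos.2 hkpos) t₁, fun t ht => ?_⟩
    have h1 : F'.toFun ⟨γ (g t), velocityVec γ (g t)⟩ = k := hγ.speed_eq hJ hJc ht ht₁
    rw [velocity_comp (hgd t) ((hγ.contMDiffAt hJ ht).mdifferentiableAt (by simp)),
      F'.homogeneous _ _ _ (inv_pos.2 hkpos) (hγ.admissible _ ht), h1, inv_mul_cancel₀ hkpos.ne']
  obtain ⟨η, hη, heq⟩ := exists_complete_unit_geodesic hW hhom htrans hF hWc hfull hI
    (hJc.preimage_mono hgm) (by simpa [hg] using ht₁) hδ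
  refine ⟨fun t => η (k * t + -(k * t₁)), hη.comp_affine isOpen_univ hkpos _, fun t ht => ?_⟩
  have h1 : g (k * t + -(k * t₁)) = t := by
    simp only [hg]
    field_simp
    ring
  have h2 : k * t + -(k * t₁) ∈ g ⁻¹' J := by
    rw [mem_preimage, h1]
    exact ht
  have h3 := heq h2
  simp only [h1] at h3
  exact h3

end Completeness

end Zermelo

end

theorem theorem1p2
    {E : Type*} [NormedAddCommGroup E] [NormedSpace ℝ E] [FiniteDimensional ℝ E]
    {M : Type*} [TopologicalSpace M] [ChartedSpace E M] [IsManifold 𝓘(ℝ, E) ∞ M]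
    [T2Space M] [SecondCountableTopology M] [ConnectedSpace M]
    (F F' : Zermelo.PseudoFinsler E M)
    (W : (x : M) → TangentSpace 𝓘(ℝ, E) x)
    (hW : ContMDiff 𝓘(ℝ, E) 𝓘(ℝ, E).tangent ∞
      (fun x => (⟨x, W x⟩ : TangentBundle 𝓘(ℝ, E) M)))
    (σ : ℝ) (hhom : Zermelo.IsHomothetic F W σ)
    (htrans : Zermelo.IsTranslation F F' W) :
    -- every unit speed geodesic of the translation is locally of the stated form
    (∀ (J : Set ℝ) (γ' : ℝ → M), IsOpen J → J.OrdConnected → (0 : ℝ) ∈ J →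
      F'.IsUnitGeodesicOn γ' J →
      ∃ ε > 0, ∃ γ : ℝ → M, Set.Ioo (-ε) ε ⊆ J ∧
        F.IsUnitGeodesicOn γ (Zermelo.timeChange σ '' Set.Ioo (-ε) ε) ∧
        ∀ t ∈ Set.Ioo (-ε) ε,
          (t, γ (Zermelo.timeChange σ t)) ∈ Zermelo.flowDomain W ∧
          γ' t = Zermelo.flow W t (γ (Zermelo.timeChange σ t))) ∧
    -- conversely, every curve of this form starting in the indicatrix of the translation is
    -- locally a unit speed geodesic of the translation
    (∀ (J : Set ℝ) (γ : ℝ → M), IsOpen J → J.OrdConnected → (0 : ℝ) ∈ J →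
      F.IsUnitGeodesicOn γ J →
      (⟨γ 0, Zermelo.velocityVec (E := E) γ 0 + W (γ 0)⟩ : TangentBundle 𝓘(ℝ, E) M)
        ∈ F'.indicatrix →
      ∃ ε > 0, Zermelo.timeChange σ '' Set.Ioo (-ε) ε ⊆ J ∧
        (∀ t ∈ Set.Ioo (-ε) ε, (t, γ (Zermelo.timeChange σ t)) ∈ Zermelo.flowDomain W) ∧
        F'.IsUnitGeodesicOn (fun t => Zermelo.flow W t (γ (Zermelo.timeChange σ t)))
          (Set.Ioo (-ε) ε)) ∧
    -- completeness
    (F.GeodesicallyComplete → Zermelo.IsCompleteField W → Zermelo.IsFullTranslation F F' W →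
      F'.GeodesicallyComplete) := by
  refine ⟨fun J γ' hJ _ h0 hγ' => ?_, fun J γ hJ _ h0 hγ hind => ?_, fun hF hWc hfull =>
    Zermelo.geodesicallyComplete_of_isFullTranslation hW hhom htrans hF hWc hfull⟩
  · have hc : ContinuousAt (fun t => (-t, γ' t)) 0 :=
      continuousAt_id.neg.prodMk (hγ'.1.contMDiffAt hJ h0).continuousAt
    have hD : ∀ᶠ t in 𝓝 (0 : ℝ), (-t, γ' t) ∈ Zermelo.flowDomain W := by
      refine hc.eventually ((Zermelo.isOpen_flowDomain hW).mem_nhds ?_)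
      change (-(0 : ℝ), γ' 0) ∈ Zermelo.flowDomain W
      rw [neg_zero]
      exact (Zermelo.flow_zero_mem hW (γ' 0)).1
    obtain ⟨ε, hε, h⟩ := Metric.eventually_nhds_iff_ball.1 (hD.and (hJ.mem_nhds h0))
    simp only [Real.ball_eq_Ioo, zero_sub, zero_add] at h
    refine ⟨ε, hε, _, fun t ht => (h t ht).2, htrans.isUnitGeodesicOn_of_flow hW hhom isOpen_Ioo
      (hγ'.mono fun t ht => (h t ht).2) fun t ht => (h t ht).1, fun t ht => ?_⟩
    rw [Zermelo.timeChangeInv_timeChange]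
    have h1 := Zermelo.flow_neg hW (h t ht).1
    rw [neg_neg] at h1
    exact ⟨h1.1, h1.2.symm⟩
  · have hf := (Zermelo.contDiff_timeChange σ).continuous
    have hfJ : ∀ᶠ t in 𝓝 (0 : ℝ), Zermelo.timeChange σ t ∈ J := by
      refine hf.continuousAt.eventually (hJ.mem_nhds ?_)
      rwa [Zermelo.timeChange_zero]
    obtain ⟨hb, -⟩ := hγ.comp_timeChange (σ := σ) hJ hfJ.self_of_nhds
    have hD : ∀ᶠ t in 𝓝 (0 : ℝ), (t, γ (Zermelo.timeChange σ t)) ∈ Zermelo.flowDomain W :=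
      (continuousAt_id.prodMk hb.continuousAt).eventually
        ((Zermelo.isOpen_flowDomain hW).mem_nhds (Zermelo.flow_zero_mem hW _).1)
    have h0v : Zermelo.velocity (E := E)
        (fun t => Zermelo.flow W t (γ (Zermelo.timeChange σ t))) 0 ∈ F'.indicatrix := by
      have h1 := Zermelo.velocity_comp (E := E) (Zermelo.hasDerivAt_timeChange σ 0)
        ((hγ.1.contMDiffAt hJ hfJ.self_of_nhds).mdifferentiableAt (by simp))
      rw [mul_zero, Real.exp_zero, one_smul, Zermelo.timeChange_zero] at h1
      have h2 := congrArg (fun z : TangentBundle 𝓘(ℝ, E) M =>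
        (⟨z.1, z.2 + W z.1⟩ : TangentBundle 𝓘(ℝ, E) M)) h1
      rw [Zermelo.velocity_flow_zero hW hb]
      exact h2 ▸ hind
    have hrel : ∀ᶠ t in 𝓝 (0 : ℝ), Zermelo.relVelocity W
        (fun t => Zermelo.flow W t (γ (Zermelo.timeChange σ t))) t ∈ F.indicatrix := by
      filter_upwards [hfJ, hD] with t h1 h2
      exact hγ.relVelocity_mem hW hhom hJ h1 h2
    have hv := htrans.eventually_mem_indicatrix hW
      (Zermelo.contMDiffAt_flow_curve hW (b := fun t => γ (Zermelo.timeChange σ t)) hb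
        hD.self_of_nhds) h0v hrel
    obtain ⟨ε, hε, h⟩ := Metric.eventually_nhds_iff_ball.1 (hfJ.and (hD.and hv))
    simp only [Real.ball_eq_Ioo, zero_sub, zero_add] at h
    refine ⟨ε, hε, ?_, fun t ht => (h t ht).2.1, htrans.isUnitGeodesicOn_flow hW hhom isOpen_Ioo hJ
      hγ (fun t ht => (h t ht).1) (fun t ht => (h t ht).2.1) fun t ht => (h t ht).2.2⟩
    rintro _ ⟨t, ht, rfl⟩
    exact (h t ht).1
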